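/- Let $N\ge 1$ be an integer and let $\mathbb U(N)$ be the group of $N\times N$ unitary matrices with normalised Haar measure $\mu_N$. For $A\in\mathbb U(N)$ with eigenangles $\theta_1,\dots,\theta_N\in[0,2\pi)$ put $$Z_A(\theta)=\prod_{j=1}^N\bigl(1-e^{i(\theta_j-\theta)}\bigr),\qquad V_A(\theta)=\exp\Bigl[\tfrac{iN}{2}(\theta+\pi)-\tfrac i2\sum_{j=1}^N\theta_j\Bigr]Z_A(\theta),$$ and $$F_N(s,h)=\int_{\mathbb U(N)}|V_A(0)|^{2(s-h)}\,|V_A'(0)|^{2h}\,d\mu_N(A).$$ For $\epsilon>0$, $t\in\mathbb R$ and $\operatorname{Re}(h)>-1$ put $$K_h^{\epsilon}(t)=\frac1{2\pi}\int_{-\infty}^{\infty}|x|^{h}e^{-\epsilon|x|-itx}\,dx,$$ and for $t>0$ put $$\mathcal J_N(t;s)=\det\bigl[U(1-s-N,\;2-2s-2N+j+k,\;2t)\bigr]_{j,k=0}^{N-1},$$ where $U(a,b,x)$ is the confluent hypergeometric function of the second kind, i.e. the unique solution $w$ of Kummer's equation $xw''+(b-x)w'-aw=0$ on $(0,\infty)$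 with $w(x)\sim x^{-a}$ as $x\to+\infty$. Then for all $s,h\in\mathbb C$ with $\operatorname{Re}(s)>-\tfrac12$ and $0<\operatorname{Re}(h)<\operatorname{Re}(s)+\tfrac12$, the integral defining $F_N(s,h)$ and, for every $\epsilon>0$, the integral below converge absolutely, the limit below exists, and $$F_N(s,h)=\frac{(-1)^{N(N-1)/2}\,2^{1-2h}}{\Gamma(s+N)^{N}}\;\lim_{\epsilon\downarrow0}\int_0^{\infty}K_{2h}^{\epsilon}(t)\,e^{-Nt}\,\mathcal J_N(t;s)\,dt .$$ -/

import Mathlib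

open MeasureTheory Filter Topology

/-- The compact group `𝕌(N)` of `N × N` complex unitary matrices carries its Borel sigma-algebra. -/
noncomputable instance unitaryMeasurableSpace (N : ℕ) : MeasurableSpace (Matrix.unitaryGroup (Fin N) ℂ) :=
  borel _

instance unitaryBorelSpace (N : ℕ) : BorelSpace (Matrix.unitaryGroup (Fin N) ℂ) :=
  ⟨rfl⟩

instance unitaryCompactSpace (N : ℕ) : CompactSpace (Matrix.unitaryGroup (Fin N) ℂ) := by
  refine isCompact_iff_compactSpace.mp (?_ :
    IsCompact (Matrix.unitaryGroup (Fin N) ℂ : Set (Matrix (Fin N) (Fin N) ℂ)))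
  have hK : IsCompact (Set.univ.pi fun _ : Fin N => Set.univ.pi fun _ : Fin N =>
      Metric.closedBall (0 : ℂ) 1) :=
    isCompact_univ_pi fun _ => isCompact_univ_pi fun _ => isCompact_closedBall 0 1
  refine IsCompact.of_isClosed_subset (X := Matrix (Fin N) (Fin N) ℂ) hK ?_ ?_
  · have h : (Matrix.unitaryGroup (Fin N) ℂ : Set (Matrix (Fin N) (Fin N) ℂ))
        = {A | A * star A = 1} := by
      ext A
      exact Matrix.mem_unitaryGroup_iff
    rw [h]
    exact isClosed_eq (continuous_id.mul continuous_star) continuous_const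
  · intro A hA i _ j _
    simpa using entry_norm_bound_of_unitary hA i j

noncomputable section

/-- The Haar measure on `𝕌(N)`, normalised so that the whole group has measure `1`. -/
def unitaryHaar (N : ℕ) : Measure (Matrix.unitaryGroup (Fin N) ℂ) :=
  Measure.haarMeasure ⊤

/-- The eigenangles of `A`, in `[0, 2π)`, with multiplicity: for each root of the characteristic
polynomial, the representative of its argument in `[0, 2π)`. -/
def eigenangles {N : ℕ} (A : Matrix.unitaryGroup (Fin N) ℂ) : Multiset ℝ :=
  (A : Matrix (Fin N) (Fin N) ℂ).charpoly.roots.map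
    fun z => toIcoMod Real.two_pi_pos 0 (Complex.arg z)

/-- `Z_A(θ) = ∏_j (1 - e^{i(θ_j - θ)})`. -/
def charZ {N : ℕ} (A : Matrix.unitaryGroup (Fin N) ℂ) (θ : ℝ) : ℂ :=
  ((eigenangles A).map fun φ : ℝ => 1 - Complex.exp (Complex.I * ((φ : ℂ) - (θ : ℂ)))).prod

/-- `V_A(θ) = exp (iN(θ + π)/2 - (i/2) ∑_j θ_j) Z_A(θ)`, for all real `θ`. -/
def charV {N : ℕ} (A : Matrix.unitaryGroup (Fin N) ℂ) (θ : ℝ) : ℂ :=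
  Complex.exp (Complex.I * (N : ℂ) / 2 * ((θ : ℂ) + (Real.pi : ℂ))
    - Complex.I / 2 * ((eigenangles A).sum : ℂ)) * charZ A θ

/-- The integrand `|V_A(0)|^{2(s-h)} |V_A'(0)|^{2h}` of the joint moments. -/
def jointMomentIntegrand (N : ℕ) (s h : ℂ) (A : Matrix.unitaryGroup (Fin N) ℂ) : ℂ :=
  (‖charV A 0‖ : ℂ) ^ (2 * (s - h)) * (‖deriv (charV A) 0‖ : ℂ) ^ (2 * h)

/-- The joint moments `F_N(s,h)`. -/
def jointMoment (N : ℕ) (s h : ℂ) : ℂ :=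
  ∫ A, jointMomentIntegrand N s h A ∂(unitaryHaar N)

/-- `w` is, on `(0, ∞)`, a solution of Kummer's equation `x w'' + (b - x) w' - a w = 0` with
`w(x) ~ x^{-a}` as `x → +∞`. Since a second, linearly independent solution behaves like
`e^x x^{a-b}`, for all complex `a`, `b` exactly one function on `(0, ∞)` has this property. -/
def IsKummerU (a b : ℂ) (w : ℝ → ℂ) : Prop :=
  (∃ w₁ w₂ : ℝ → ℂ, ∀ x : ℝ, 0 < x →
    HasDerivAt w (w₁ x) x ∧ HasDerivAt w₁ (w₂ x) x ∧
      (x : ℂ) * w₂ x + (b - (x : ℂ)) * w₁ x - a * w x = 0) ∧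
  Tendsto (fun x : ℝ => w x * (x : ℂ) ^ a) atTop (𝓝 1)

open Classical in
/-- The confluent hypergeometric function of the second kind `U(a, b, x)` (Tricomi's function), for
`x > 0` and all complex `a`, `b`: the solution of Kummer's equation on `(0, ∞)` asymptotic to
`x^{-a}` at `+∞`. Only its values at `x > 0` are meaningful. -/
def kummerU (a b : ℂ) : ℝ → ℂ :=
  if hw : ∃ w : ℝ → ℂ, IsKummerU a b w then Classical.choose hw else 0

/-- The Hankel determinant `𝒥_N(t; s) = det [U(1-s-N, 2-2s-2N+j+k, 2t)]_{j,k=0}^{N-1}`. -/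
def hankelJ (N : ℕ) (t : ℝ) (s : ℂ) : ℂ :=
  (Matrix.of fun j k : Fin N =>
    kummerU (1 - s - (N : ℂ))
      (2 - 2 * s - 2 * (N : ℂ) + ((j : ℕ) : ℂ) + ((k : ℕ) : ℂ)) (2 * t)).det

/-- `K_h^ε(t) = (1/2π) ∫_ℝ |x|^h e^{-ε|x| - itx} dx`. -/
def kernelK (h : ℂ) (ε t : ℝ) : ℂ :=
  1 / (2 * (Real.pi : ℂ)) *
    ∫ x : ℝ, ((|x| : ℝ) : ℂ) ^ h *
      Complex.exp (-((ε : ℂ) * ((|x| : ℝ) : ℂ)) - Complex.I * (t : ℂ) * (x : ℂ))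

end

/-! The proof is Fourier analysis in Cayley coordinates. Weyl's integration formula writes F_N as an
integral over eigenvalues z_j, and z_j = (x_j + i)/(x_j - i) turns Haar measure on the circle into
the Cauchy distribution. There |Z_A(0)|² = ∏ 4/(1 + x_j²), and since 1/(1 - z_j) = (1 + i x_j)/2,
the quotient |V_A'(0)|/|V_A(0)| equals |S|/2 with S = ∑ x_j (`torusCharpoly_cayleyPi_derivative`).
So F_N is 2^{-2h}/N! times the integral of w |S|^{2h}, where w collects the squared Vandermonde and
the density (`jointMoment_eq_integral`).

In φ(t) = ∫ w e^{itS} everything except the squared Vandermonde factorises over coordinates.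
Andréief's identity therefore gives N! times a Hankel determinant of Fourier transforms of (1 +
ix)^{-α}(1 - ix)^{-β}, with α = s + N and β = s + N - j - k. Each of these, times e^t, is a multiple
of Tricomi's U at 2t (`kummerU_two_mul`), so for t > 0 the function φ is a constant times e^{-Nt}
𝒥_N (`integral_cayleyWeight_mul_exp_eq_hankelJ`). The kernel K is the Fourier transform of |x|^{2h}
e^{-ε|x|}, so Parseval gives ∫ K φ = ∫ w |S|^{2h} e^{-ε|S|} (`integral_mul_dampedPower`). K and φ
are even, hence the half-line integral is half of this, and dominated convergence lets ε tend to 0.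

Two ingredients carry most of the work. First, U is known only through its equation and its
asymptotics: a Wronskian argument shows that these determine it (`IsKummerU.eqOn`), and contiguous
relations supply both for the Fourier transforms. Second, Weyl's formula is obtained without a
Jacobian. Haar measure on the group and the density |Δ(z)|² on the torus satisfy the same
Schwinger-Dyson equations for polynomials in power sums. Positivity of the Dirichlet form of the
associated Laplacian shows that, on the torus, every such polynomial is a constant plus an element
of the image of that Laplacian (`exists_laplace_add_const`). Both functionals vanish on this image,
so they are proportional (`torusFunctional_eq_haarFunctional_mul`), and the polynomials determine
the measures. -/

section

/-! ### Uniqueness of Tricomi's function -/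

lemma eq_zero_of_tendsto_deriv {r r' : ℝ → ℂ} {C : ℂ} {X : ℝ}
    (hd : ∀ x, X < x → HasDerivAt r (r' x) x) (h0 : Tendsto r atTop (𝓝 0))
    (h1 : Tendsto r' atTop (𝓝 C)) : C = 0 := by
  by_contra hC
  have hC' : 0 < ‖C‖ := norm_pos_iff.mpr hC
  have e1 : ∀ᶠ x in atTop, ‖r' x - C‖ ≤ ‖C‖ / 4 := by
    filter_upwards [h1.eventually (Metric.ball_mem_nhds C (by positivity : 0 < ‖C‖ / 4))] with x hx
    rw [dist_eq_norm] at hx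
    exact hx.le
  have e2 : ∀ᶠ x in atTop, ‖r x‖ ≤ ‖C‖ / 4 := by
    filter_upwards [h0.eventually (Metric.ball_mem_nhds 0 (by positivity : 0 < ‖C‖ / 4))] with x hx
    rw [dist_zero_right] at hx
    exact hx.le
  obtain ⟨Y, hY⟩ := eventually_atTop.mp (e1.and (e2.and (eventually_gt_atTop X)))
  -- On [Y, Y + 1] the function r - xC varies by at most ‖C‖/4, and r is at most ‖C‖/4 at both ends,
  -- so ‖C‖ ≤ 3‖C‖/4.
  have key := Convex.norm_image_sub_le_of_norm_hasDerivWithin_le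
    (f := fun x : ℝ => r x - x * C) (f' := fun x => r' x - C) (s := Set.Icc Y (Y + 1))
    (C := ‖C‖ / 4) (x := Y) (y := Y + 1) (fun x hx => by
      have := ((hd x (hY x hx.1).2.2).fun_sub
        ((Complex.ofRealCLM.hasDerivAt (x := x)).mul_const C)).hasDerivWithinAt
          (s := Set.Icc Y (Y + 1))
      simpa using this)
    (fun x hx => (hY x hx.1).1) (convex_Icc _ _) (by simp) (by simp)
  have a1 := (hY Y le_rfl).2.1
  have a2 := (hY (Y + 1) (by simp)).2.1
  have : C = r (Y + 1) - r Y - (r (Y + 1) - ((Y + 1 : ℝ) : ℂ) * C - (r Y - Y * C)) := by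
    push_cast; ring
  have h3 : ‖C‖ ≤ ‖C‖ / 4 + ‖C‖ / 4 + ‖C‖ / 4 := by
    calc ‖C‖ = ‖r (Y + 1) - r Y - (r (Y + 1) - ((Y + 1 : ℝ) : ℂ) * C - (r Y - Y * C))‖ := by
          rw [← this]
      _ ≤ ‖r (Y + 1)‖ + ‖r Y‖ + ‖r (Y + 1) - ((Y + 1 : ℝ) : ℂ) * C - (r Y - Y * C)‖ :=
          (norm_sub_le _ _).trans (add_le_add_left (norm_sub_le _ _) _)
      _ ≤ _ := by
          refine add_le_add (add_le_add a2 a1) (key.trans ?_)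
          simp
  linarith

lemma hasDerivAt_ofReal_cpow_pos (κ : ℂ) {x : ℝ} (hx : 0 < x) :
    HasDerivAt (fun y : ℝ => (y : ℂ) ^ κ) (κ / x * (x : ℂ) ^ κ) x := by
  have hx' : (x : ℂ) ≠ 0 := by exact_mod_cast hx.ne'
  have h := (hasDerivAt_id (x : ℂ)).cpow_const (c := κ) (Or.inl (by simpa using hx))
  have h2 := h.comp_ofReal
  simp only [id] at h2
  convert h2 using 1
  rw [Complex.cpow_sub _ _ hx', Complex.cpow_one]
  field_simp

lemma tendsto_exp_neg_mul_cpow (κ : ℂ) :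
    Tendsto (fun x : ℝ => Complex.exp (-x) * (x : ℂ) ^ κ) atTop (𝓝 0) := by
  rw [tendsto_zero_iff_norm_tendsto_zero]
  have h := tendsto_rpow_mul_exp_neg_mul_atTop_nhds_zero κ.re 1 one_pos
  refine h.congr' ?_
  filter_upwards [eventually_gt_atTop 0] with x hx
  rw [norm_mul, Complex.norm_exp, Complex.norm_cpow_eq_rpow_re_of_pos hx, mul_comm]
  simp

/-- A solution of Kummer's equation which vanishes on a half-line vanishes on `(0, ∞)`. -/
lemma kummer_eq_zero_of_eventually {a b : ℂ} {d d₁ d₂ : ℝ → ℂ}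
    (hd : ∀ x : ℝ, 0 < x → HasDerivAt d (d₁ x) x ∧ HasDerivAt d₁ (d₂ x) x ∧
      (x : ℂ) * d₂ x + (b - (x : ℂ)) * d₁ x - a * d x = 0)
    {X : ℝ} (hX : ∀ x, X < x → d x = 0) {x : ℝ} (hx : 0 < x) : d x = 0 := by
  set Y : ℝ := max X x + 1
  have hY : X < Y := by have := le_max_left X x; simp only [Y]; linarith
  have hxY : x < Y := by have := le_max_right X x; simp only [Y]; linarith
  have hY1 : d₁ Y = 0 := by
    have h1 := (hd Y (hx.trans hxY)).1
    have h2 : HasDerivAt d 0 Y := (hasDerivAt_const Y (0 : ℂ)).congr_of_eventuallyEq (by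
      filter_upwards [lt_mem_nhds hY] with y hy using hX y hy)
    exact h1.unique h2
  -- A Lipschitz constant on (x/2, Y + 1) for Kummer's equation as a first-order system in (d, d').
  -- Staying above x/2 controls the singular coefficient 1/t, so the zero solution propagates from Y
  -- back to x.
  set K : ℝ := 1 + (‖b‖ + (Y + 1)) / (x / 2) + ‖a‖ / (x / 2)
  have hK : 0 ≤ K := by
    have : 0 < Y := hx.trans hxY
    positivity
  let v : ℝ → ℂ × ℂ → ℂ × ℂ := fun t p => (p.2, (((t : ℂ) - b) * p.2 + a * p.1) / t)
  have hlip : ∀ t ∈ Set.Ioo (x / 2) (Y + 1), LipschitzOnWith ⟨K, hK⟩ (v t) Set.univ := by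
    intro t ht
    have ht0 : 0 < t := lt_trans (by positivity) ht.1
    refine LipschitzOnWith.of_dist_le_mul fun p _ q _ => ?_
    rw [dist_eq_norm, dist_eq_norm]
    have h1 : ‖(p - q).1‖ ≤ ‖p - q‖ := norm_fst_le _
    have h2 : ‖(p - q).2‖ ≤ ‖p - q‖ := norm_snd_le _
    have hb : ‖(t : ℂ) - b‖ ≤ ‖b‖ + (Y + 1) := by
      refine (norm_sub_le _ _).trans ?_
      rw [Complex.norm_real, Real.norm_of_nonneg ht0.le]
      linarith [ht.2]
    have hv : v t p - v t q = ((p - q).2, (((t : ℂ) - b) * (p - q).2 + a * (p - q).1) / t) := by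
      ext
      · simp [v]
      · simp [v]; ring
    rw [hv]
    change ‖_‖ ≤ K * ‖p - q‖
    rw [Prod.norm_def]
    refine max_le ?_ ?_
    · refine h2.trans ?_
      have : 1 ≤ K := by
        have : 0 < Y := hx.trans hxY
        have : 0 ≤ (‖b‖ + (Y + 1)) / (x / 2) + ‖a‖ / (x / 2) := by positivity
        simp only [K]; linarith
      nlinarith [norm_nonneg (p - q)]
    · simp only
      rw [norm_div, Complex.norm_real, Real.norm_of_nonneg ht0.le]
      have : ‖((t : ℂ) - b) * (p - q).2 + a * (p - q).1‖
          ≤ (‖b‖ + (Y + 1)) * ‖p - q‖ + ‖a‖ * ‖p - q‖ := by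
        refine (norm_add_le _ _).trans ?_
        rw [norm_mul, norm_mul]
        gcongr
      have hY0 : 0 < Y := hx.trans hxY
      calc _ ≤ ((‖b‖ + (Y + 1)) * ‖p - q‖ + ‖a‖ * ‖p - q‖) / (x / 2) := by
            gcongr
            exact ht.1.le
        _ = (K - 1) * ‖p - q‖ := by simp only [K]; ring
        _ ≤ K * ‖p - q‖ := by gcongr; linarith
  have key := ODE_solution_unique_of_mem_Ioo (v := v) (s := fun _ => Set.univ) hlip
    (f := fun t => (d t, d₁ t)) (g := fun _ => 0) (t₀ := Y)
    ⟨by linarith, by linarith⟩ (fun t ht => ⟨?_, trivial⟩) (fun t ht => ⟨?_, trivial⟩) ?_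
  · have := key (show x ∈ Set.Ioo (x / 2) (Y + 1) from ⟨by linarith, by linarith⟩)
    exact congrArg Prod.fst this
  · have ht0 : 0 < t := lt_trans (by positivity) ht.1
    have ht0' : (t : ℂ) ≠ 0 := by exact_mod_cast ht0.ne'
    obtain ⟨h1, h2, h3⟩ := hd t ht0
    have h4 : d₂ t = (((t : ℂ) - b) * d₁ t + a * d t) / t := by
      field_simp
      linear_combination h3
    rw [h4] at h2
    exact h1.prodMk h2
  · have : v t 0 = 0 := by simp [v]
    rw [this]
    exact hasDerivAt_const _ _
  · simp only [hX Y hY, hY1]; rfl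

/-- Let d be the difference of two candidates. By Abel's identity the weighted Wronskian of w and d
is a constant C, so (d/w)' = C e^x x^{-b}/w² ~ C e^x x^{2a-b}. A nonzero C would force exponential
growth of d/w, which tends to 0. Hence C = 0, d/w is constant far out and equal to its limit 0, and
d vanishes everywhere. -/
theorem IsKummerU.eqOn {a b : ℂ} {w v : ℝ → ℂ} (hw : IsKummerU a b w) (hv : IsKummerU a b v)
    {x : ℝ} (hx : 0 < x) : w x = v x := by
  obtain ⟨⟨w₁, w₂, hw'⟩, hwl⟩ := hw
  obtain ⟨⟨v₁, v₂, hv'⟩, hvl⟩ := hv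
  set d : ℝ → ℂ := fun x => w x - v x with hd_def
  set d₁ : ℝ → ℂ := fun x => w₁ x - v₁ x with hd1_def
  set d₂ : ℝ → ℂ := fun x => w₂ x - v₂ x with hd2_def
  have hd : ∀ x : ℝ, 0 < x → HasDerivAt d (d₁ x) x ∧ HasDerivAt d₁ (d₂ x) x ∧
      (x : ℂ) * d₂ x + (b - (x : ℂ)) * d₁ x - a * d x = 0 := by
    intro x hx
    obtain ⟨p1, p2, p3⟩ := hw' x hx
    obtain ⟨q1, q2, q3⟩ := hv' x hx
    exact ⟨p1.sub q1, p2.sub q2, by simp only [hd_def, hd1_def, hd2_def]; linear_combination p3 - q3⟩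
  have hdl : Tendsto (fun x : ℝ => d x * (x : ℂ) ^ a) atTop (𝓝 0) := by
    have := hwl.sub hvl
    rw [sub_self] at this
    exact this.congr fun x => by simp only [hd_def]; ring
  -- the Wronskian
  set W : ℝ → ℂ := fun x => (w x * d₁ x - w₁ x * d x) * (x : ℂ) ^ b * Complex.exp (-x) with hW
  have hWd : ∀ x : ℝ, 0 < x → HasDerivAt W 0 x := by
    intro x hx
    obtain ⟨p1, p2, p3⟩ := hw' x hx
    obtain ⟨q1, q2, q3⟩ := hd x hx
    have hx' : (x : ℂ) ≠ 0 := by exact_mod_cast hx.ne'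
    have he : HasDerivAt (fun y : ℝ => Complex.exp (-(y : ℂ))) (-Complex.exp (-x)) x := by
      have := ((Complex.ofRealCLM.hasDerivAt (x := x)).neg).cexp
      simpa using this
    have h := (((p1.mul q2).sub (p2.mul q1)).mul (hasDerivAt_ofReal_cpow_pos b hx)).mul he
    refine h.congr_deriv ?_
    have e1 : w₂ x = ((x - b) * w₁ x + a * w x) / x := by
      field_simp; linear_combination p3
    have e2 : d₂ x = ((x - b) * d₁ x + a * d x) / x := by
      field_simp; linear_combination q3
    simp only [Pi.mul_apply, Pi.sub_apply]
    rw [e1, e2]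
    field_simp
    ring
  obtain ⟨C, hC⟩ : ∃ C, ∀ x : ℝ, 0 < x → W x = C := by
    refine ⟨W 1, fun x hx => ?_⟩
    refine (convex_Ioi (0 : ℝ)).is_const_of_fderivWithin_eq_zero (𝕜 := ℝ) (f := W)
      (fun y hy => (hWd y hy).differentiableAt.differentiableWithinAt) (fun y hy => ?_) hx
      (Set.mem_Ioi.mpr one_pos)
    have h3 := (hWd y hy).hasDerivWithinAt (s := Set.Ioi 0)
    have h2 := h3.hasFDerivWithinAt.fderivWithin (isOpen_Ioi.uniqueDiffWithinAt hy)
    rw [h2]; ext; simp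
  have hwne : ∀ᶠ x : ℝ in atTop, w x ≠ 0 := by
    filter_upwards [hwl.eventually_ne one_ne_zero] with x hx h0
    simp [h0] at hx
  obtain ⟨X, hX⟩ := eventually_atTop.mp (hwne.and (eventually_gt_atTop 0))
  set κ : ℂ := 2 * a - b with hκ
  set q' : ℝ → ℂ := fun x => C * Complex.exp x * (x : ℂ) ^ (-b) / w x ^ 2 with hq'
  have hq : ∀ x, X < x → HasDerivAt (fun x => d x / w x) (q' x) x := by
    intro x hx
    obtain ⟨hw0, hx0⟩ := hX x hx.le
    have hx' : (x : ℂ) ≠ 0 := by exact_mod_cast hx0.ne'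
    refine (((hd x hx0).1).div (hw' x hx0).1 hw0).congr_deriv ?_
    rw [hq', ← hC x hx0, hW]
    simp only
    rw [Complex.cpow_neg, Complex.exp_neg]
    have := Complex.exp_ne_zero x
    have := Complex.cpow_ne_zero_iff_of_exponent_ne_zero (x := (x : ℂ)) (y := b)
    have hb : (x : ℂ) ^ b ≠ 0 := by simp [Complex.cpow_eq_zero_iff, hx']
    field_simp
  have hql : Tendsto (fun x => d x / w x) atTop (𝓝 0) := by
    have := hdl.div hwl one_ne_zero
    rw [zero_div] at this
    refine this.congr' ?_
    filter_upwards [eventually_gt_atTop 0] with x hx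
    have hx' : (x : ℂ) ≠ 0 := by exact_mod_cast hx.ne'
    have hb : (x : ℂ) ^ a ≠ 0 := by simp [Complex.cpow_eq_zero_iff, hx']
    simp only [Pi.div_apply]
    rw [mul_div_mul_right _ _ hb]
  -- E is the reciprocal of the growth e^x x^{2a-b}. Then r = (d/w)E tends to 0 while r' = q'E - (1
  -- + κ/x) r tends to C, which `eq_zero_of_tendsto_deriv` allows only for C = 0.
  set E : ℝ → ℂ := fun x => Complex.exp (-x) * (x : ℂ) ^ (-κ) with hE
  have hEl : Tendsto E atTop (𝓝 0) := tendsto_exp_neg_mul_cpow _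
  set r : ℝ → ℂ := fun x => d x / w x * E x with hr
  set r' : ℝ → ℂ := fun x => q' x * E x - (1 + κ / x) * r x with hr'
  have hrl : Tendsto r atTop (𝓝 0) := by simpa using hql.mul hEl
  have hrd : ∀ x, X < x → HasDerivAt r (r' x) x := by
    intro x hx
    obtain ⟨hw0, hx0⟩ := hX x hx.le
    have he : HasDerivAt (fun y : ℝ => Complex.exp (-(y : ℂ))) (-Complex.exp (-x)) x := by
      have := ((Complex.ofRealCLM.hasDerivAt (x := x)).neg).cexp
      simpa using this
    refine ((hq x hx).mul (he.mul (hasDerivAt_ofReal_cpow_pos (-κ) hx0))).congr_deriv ?_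
    simp only [hr', hr, hE, Pi.mul_apply]
    ring
  have hr'l : Tendsto r' atTop (𝓝 C) := by
    have h1 : Tendsto (fun x => q' x * E x) atTop (𝓝 C) := by
      have := (tendsto_const_nhds (x := C)).div (hwl.pow 2) (by simp)
      simp only [one_pow, div_one] at this
      refine this.congr' ?_
      filter_upwards [eventually_gt_atTop 0, hwne] with x hx hw0
      have hx' : (x : ℂ) ≠ 0 := by exact_mod_cast hx.ne'
      have hb : (x : ℂ) ^ a ≠ 0 := by simp [Complex.cpow_eq_zero_iff, hx']
      have hb2 : (x : ℂ) ^ b ≠ 0 := by simp [Complex.cpow_eq_zero_iff, hx']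
      simp only [hq', hE, hκ, Pi.div_apply]
      rw [show -(2 * a - b) = -a - a + b by ring, Complex.cpow_add _ _ hx',
        Complex.cpow_sub _ _ hx', Complex.cpow_neg, Complex.cpow_neg, Complex.exp_neg]
      have := Complex.exp_ne_zero x
      field_simp
    have h2 : Tendsto (fun x : ℝ => (1 + κ / x) * r x) atTop (𝓝 0) := by
      have h3 : Tendsto (fun x : ℝ => κ / (x : ℂ)) atTop (𝓝 0) := by
        have : Tendsto (fun x : ℝ => (((x⁻¹ : ℝ)) : ℂ)) atTop (𝓝 ((0 : ℝ) : ℂ)) :=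
          (Complex.continuous_ofReal.tendsto 0).comp tendsto_inv_atTop_zero
        have h4 := this.const_mul κ
        simp only [Complex.ofReal_zero, mul_zero] at h4
        exact h4.congr fun x => by push_cast; rw [div_eq_mul_inv]
      have := (h3.const_add 1).mul hrl
      simpa using this
    simpa using h1.sub h2
  have hC0 : C = 0 := eq_zero_of_tendsto_deriv hrd hrl hr'l
  have hq0 : ∀ x, X < x → d x / w x = 0 := by
    have hconst : ∀ x, X < x → ∀ y, X < y → d x / w x = d y / w y := by
      intro x hx y hy
      refine (convex_Ioi X).is_const_of_fderivWithin_eq_zero (𝕜 := ℝ) (f := fun x => d x / w x)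
        (fun y hy => (hq y hy).differentiableAt.differentiableWithinAt) (fun y hy => ?_) hx hy
      have h3 := (hq y hy).hasDerivWithinAt (s := Set.Ioi X)
      have h2 := h3.hasFDerivWithinAt.fderivWithin (isOpen_Ioi.uniqueDiffWithinAt hy)
      rw [h2]; ext; simp [hq', hC0]
    intro x hx
    have : Tendsto (fun y => d y / w y) atTop (𝓝 (d x / w x)) :=
      tendsto_const_nhds.congr' (by
        filter_upwards [eventually_gt_atTop X] with y hy using hconst x hx y hy)
    exact tendsto_nhds_unique this hql
  have hdz : ∀ x, X < x → d x = 0 := fun x hx => by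
    have := hq0 x hx
    rw [div_eq_zero_iff] at this
    exact this.resolve_right (hX x hx.le).1
  exact sub_eq_zero.mp (kummer_eq_zero_of_eventually hd hdz hx)

theorem IsKummerU.kummerU_eq {a b : ℂ} {w : ℝ → ℂ} (hw : IsKummerU a b w) {x : ℝ} (hx : 0 < x) :
    kummerU a b x = w x := by
  have h : ∃ w : ℝ → ℂ, IsKummerU a b w := ⟨w, hw⟩
  rw [kummerU, dif_pos h]
  exact (Classical.choose_spec h).eqOn hw hx

end

/-! ### Gamma integrals with complex rate and Fourier inversion -/

section

lemma integrableOn_cpow_mul_exp_neg_mul {a r : ℂ} (ha : 0 < a.re) (hr : 0 < r.re) :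
    IntegrableOn (fun t : ℝ => (t : ℂ) ^ (a - 1) * Complex.exp (-(r * t))) (Set.Ioi 0) := by
  have h := integrableOn_rpow_mul_exp_neg_mul_rpow (s := a.re - 1) (p := 1) (b := r.re)
    (by linarith) one_pos hr
  refine (integrable_norm_iff ?_).mp ((integrableOn_congr_fun ?_ measurableSet_Ioi).mp h)
  · refine (ContinuousOn.mul (fun t ht => ?_) (by fun_prop)).aestronglyMeasurable
      measurableSet_Ioi
    exact (hasDerivAt_ofReal_cpow_pos _ ht).continuousAt.continuousWithinAt
  · intro t ht
    simp only [norm_mul, Complex.norm_exp]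
    rw [Complex.norm_cpow_eq_rpow_re_of_pos ht]
    simp

/-- The Gamma integral with a complex rate. -/
theorem integral_cpow_mul_exp_neg_mul_Ioi_complex {a r : ℂ} (ha : 0 < a.re) (hr : 0 < r.re) :
    ∫ t in Set.Ioi (0 : ℝ), (t : ℂ) ^ (a - 1) * Complex.exp (-(r * t)) =
      r ^ (-a) * Complex.Gamma a := by
  have hU : IsOpen {z : ℂ | 0 < z.re} := isOpen_lt continuous_const Complex.continuous_re
  have hUc : Convex ℝ {z : ℂ | 0 < z.re} := convex_halfSpace_re_gt 0
  have hF : DifferentiableOn ℂ (fun r : ℂ => ∫ t in Set.Ioi (0 : ℝ),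
      (t : ℂ) ^ (a - 1) * Complex.exp (-(r * t))) {z : ℂ | 0 < z.re} := by
    intro r₀ hr₀
    have hr₀' : 0 < r₀.re := hr₀
    -- On Re z > Re r₀/2 the derivative in the rate is dominated by one integrable function of t,
    -- which gives holomorphy at r₀.
    have hs : {z : ℂ | r₀.re / 2 < z.re} ∈ 𝓝 r₀ :=
      (isOpen_lt continuous_const Complex.continuous_re).mem_nhds
        (show r₀.re / 2 < r₀.re by linarith)
    refine (hasDerivAt_integral_of_dominated_loc_of_deriv_le (𝕜 := ℂ) hs
      (μ := volume.restrict (Set.Ioi 0))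
      (F := fun (r : ℂ) (t : ℝ) => (t : ℂ) ^ (a - 1) * Complex.exp (-(r * t)))
      (F' := fun (r : ℂ) (t : ℝ) => (t : ℂ) ^ (a - 1) * (-t * Complex.exp (-(r * t))))
      (bound := fun t => t ^ a.re * Real.exp (-(r₀.re / 2) * t ^ (1 : ℝ))) ?_
      (integrableOn_cpow_mul_exp_neg_mul ha hr₀') ?_ ?_ ?_ ?_).2.differentiableAt.differentiableWithinAt
    · filter_upwards [hU.mem_nhds hr₀] with z hz
      exact (integrableOn_cpow_mul_exp_neg_mul ha hz).aestronglyMeasurable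
    · refine (ContinuousOn.mul (fun t ht => ?_) (by fun_prop)).aestronglyMeasurable
        measurableSet_Ioi
      exact (hasDerivAt_ofReal_cpow_pos _ ht).continuousAt.continuousWithinAt
    · refine (ae_restrict_iff' measurableSet_Ioi).mpr (Eventually.of_forall fun t ht z hz => ?_)
      have ht' : 0 < t := ht
      have hz' : r₀.re / 2 < z.re := hz
      simp only [norm_mul, Complex.norm_exp, norm_neg]
      rw [Complex.norm_cpow_eq_rpow_re_of_pos ht, Complex.norm_real, Real.norm_of_nonneg ht'.le,
        ← mul_assoc, ← Real.rpow_add_one ht'.ne']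
      simp only [Complex.sub_re, Complex.one_re, sub_add_cancel, Real.rpow_one]
      gcongr
      simp
      nlinarith
    · exact integrableOn_rpow_mul_exp_neg_mul_rpow (by linarith) one_pos (by linarith)
    · refine Eventually.of_forall fun t z hz => ?_
      have h1 : HasDerivAt (fun z : ℂ => -(z * t)) (-(t : ℂ)) z := by
        simpa using ((hasDerivAt_id z).mul_const (t : ℂ)).fun_neg
      have := (h1.cexp).const_mul ((t : ℂ) ^ (a - 1))
      refine this.congr_deriv ?_
      ring
  have hG : DifferentiableOn ℂ (fun r : ℂ => r ^ (-a) * Complex.Gamma a) {z : ℂ | 0 < z.re} := by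
    intro z hz
    have : z ∈ Complex.slitPlane := Or.inl hz
    exact (((hasDerivAt_id z).cpow_const (c := -a)
      this).mul_const _).differentiableAt.differentiableWithinAt
  -- Identity theorem: both sides are holomorphic on the right half-plane and agree at real rates r
  -- > 1, which accumulate at 1.
  refine (hF.analyticOnNhd hU).eqOn_of_preconnected_of_frequently_eq (hG.analyticOnNhd hU)
    hUc.isPreconnected (z₀ := 1) (by simp) ?_ hr
  have ht : Tendsto (fun x : ℝ => (x : ℂ)) (𝓝[>] 1) (𝓝[≠] 1) := by
    refine tendsto_nhdsWithin_iff.mpr ⟨?_, ?_⟩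
    · exact (Complex.continuous_ofReal.tendsto 1).mono_left nhdsWithin_le_nhds
    · filter_upwards [self_mem_nhdsWithin] with x hx
      have hx' : (1 : ℝ) < x := hx
      simp [hx'.ne']
  refine ht.frequently (Eventually.frequently ?_)
  filter_upwards [self_mem_nhdsWithin] with x hx
  have hx' : (1 : ℝ) < x := hx
  have hx0 : 0 < x := by linarith
  rw [Complex.integral_cpow_mul_exp_neg_mul_Ioi ha hx0, one_div, Complex.inv_cpow, Complex.cpow_neg]
  rw [Complex.arg_ofReal_of_nonneg hx0.le]
  exact Real.pi_pos.ne

/-- Fourier inversion, without `2π` in the exponent. -/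
lemma integral_exp_mul_fourier {f F : ℝ → ℂ} (hf : Integrable f)
    (hF : ∀ x, F x = ∫ y : ℝ, Complex.exp (-(Complex.I * x * y)) * f y) (hFi : Integrable F) {y : ℝ}
    (hy : ContinuousAt f y) :
    ∫ x : ℝ, Complex.exp (Complex.I * x * y) * F x = 2 * Real.pi * f y := by
  have h2 : (2 * Real.pi : ℝ) ≠ 0 := by positivity
  have hFF : ∀ ξ : ℝ, FourierTransform.fourier f ξ = F (2 * Real.pi * ξ) := by
    intro ξ
    rw [Real.fourier_real_eq_integral_exp_smul, hF]
    refine integral_congr_ae (Eventually.of_forall fun v => ?_)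
    simp only [smul_eq_mul]
    congr 2
    push_cast
    ring
  have hFi' : Integrable (FourierTransform.fourier f) := by
    have := hFi.comp_mul_left' h2
    refine this.congr (Eventually.of_forall fun ξ => (hFF ξ).symm)
  have key := hf.fourierInv_fourier_eq hFi' hy
  rw [Real.fourierInv_eq'] at key
  have h3 := Measure.integral_comp_mul_left
    (fun x : ℝ => Complex.exp (Complex.I * x * y) * F x) (2 * Real.pi)
  rw [abs_of_pos (by positivity)] at h3
  have h4 : ∫ x : ℝ, Complex.exp (Complex.I * ((2 * Real.pi * x : ℝ) : ℂ) * y)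
      * F (2 * Real.pi * x) = f y := by
    rw [← key]
    refine integral_congr_ae (Eventually.of_forall fun v => ?_)
    simp only [smul_eq_mul, hFF]
    congr 2
    simp
    ring
  rw [h4] at h3
  rw [h3]
  simp only [Complex.real_smul]
  have : (2 * Real.pi : ℂ) ≠ 0 := by exact_mod_cast h2
  push_cast
  rw [← mul_assoc, mul_inv_cancel₀ this, one_mul]

end

/-! ### Fourier transforms of Cauchy-type weights and Kummer's equation -/

section

/-- `(1 + ix)^{-α} (1 - ix)^{-β}`. -/
noncomputable def cauchyWeight (α β : ℂ) (x : ℝ) : ℂ :=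
  (1 + Complex.I * x) ^ (-α) * (1 - Complex.I * x) ^ (-β)

/-- The Fourier transform of `cauchyWeight α β`. -/
noncomputable def cauchyFourier (α β : ℂ) (t : ℝ) : ℂ :=
  ∫ x : ℝ, cauchyWeight α β x * Complex.exp (Complex.I * t * x)

/-- The Fourier transform of `cauchyWeight α β`, multiplied by `e^t`. -/
noncomputable def expCauchyFourier (α β : ℂ) (t : ℝ) : ℂ :=
  Complex.exp t * cauchyFourier α β t

lemma one_add_I_mul_mem_slitPlane (x : ℝ) : 1 + Complex.I * x ∈ Complex.slitPlane :=
  Or.inl (by simp)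

lemma one_sub_I_mul_mem_slitPlane (x : ℝ) : 1 - Complex.I * x ∈ Complex.slitPlane :=
  Or.inl (by simp)

lemma one_add_I_mul_ne_zero (x : ℝ) : 1 + Complex.I * x ≠ 0 :=
  Complex.slitPlane_ne_zero (one_add_I_mul_mem_slitPlane x)

lemma one_sub_I_mul_ne_zero (x : ℝ) : 1 - Complex.I * x ≠ 0 :=
  Complex.slitPlane_ne_zero (one_sub_I_mul_mem_slitPlane x)

lemma norm_one_add_I_mul (x : ℝ) : ‖1 + Complex.I * x‖ = (1 + x ^ 2) ^ (1 / 2 : ℝ) := by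
  rw [← Real.sqrt_eq_rpow, Complex.norm_def, Complex.normSq_apply]
  simp
  ring_nf

lemma norm_one_sub_I_mul (x : ℝ) : ‖1 - Complex.I * x‖ = (1 + x ^ 2) ^ (1 / 2 : ℝ) := by
  have := norm_one_add_I_mul (-x)
  simpa [sub_eq_add_neg] using this

/-- A complex exponent multiplies the modulus by exp(arg z · Im α). As |arg z| ≤ π this is a bounded
factor, and only Re α governs the decay. -/
lemma norm_cpow_neg_le {z α : ℂ} {q : ℝ} (hz : z ≠ 0) (hq : ‖z‖ = (1 + q ^ 2) ^ (1 / 2 : ℝ)) :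
    ‖z ^ (-α)‖ ≤ Real.exp (Real.pi * |α.im|) * (1 + q ^ 2) ^ (-α.re / 2) := by
  rw [Complex.norm_cpow_of_ne_zero hz, hq, ← Real.rpow_mul (by positivity), div_eq_mul_inv,
    ← Real.exp_neg, mul_comm]
  gcongr
  · rw [Complex.neg_im]
    have h1 := Complex.abs_arg_le_pi z
    calc -(z.arg * -α.im) ≤ |-(z.arg * -α.im)| := le_abs_self _
      _ = |z.arg| * |α.im| := by rw [abs_neg, abs_mul, abs_neg]
      _ ≤ _ := by gcongr
  · nlinarith [sq_nonneg q]
  · apply le_of_eq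
    rw [Complex.neg_re]; ring

lemma norm_cauchyWeight_le (α β : ℂ) (x : ℝ) :
    ‖cauchyWeight α β x‖ ≤ Real.exp (Real.pi * |α.im|) * Real.exp (Real.pi * |β.im|) *
      (1 + x ^ 2) ^ (-(α + β).re / 2) := by
  rw [cauchyWeight, norm_mul]
  refine (mul_le_mul (norm_cpow_neg_le (one_add_I_mul_ne_zero x) (norm_one_add_I_mul x))
    (norm_cpow_neg_le (one_sub_I_mul_ne_zero x) (norm_one_sub_I_mul x)) (norm_nonneg _)
    (by positivity)).trans (le_of_eq ?_)
  rw [show -(α + β).re / 2 = -α.re / 2 + -β.re / 2 by rw [Complex.add_re]; ring,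
    Real.rpow_add (by positivity)]
  ring

lemma continuous_cauchyWeight (α β : ℂ) : Continuous (cauchyWeight α β) := by
  refine Continuous.mul ?_ ?_
  · exact (by fun_prop : Continuous fun x : ℝ => 1 + Complex.I * (x : ℂ)).cpow
      continuous_const one_add_I_mul_mem_slitPlane
  · exact (by fun_prop : Continuous fun x : ℝ => 1 - Complex.I * (x : ℂ)).cpow
      continuous_const one_sub_I_mul_mem_slitPlane

lemma integrable_one_add_sq_rpow {r : ℝ} (hr : 1 < r) :
    Integrable fun x : ℝ => (1 + x ^ 2) ^ (-r / 2) := by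
  have := integrable_rpow_neg_one_add_norm_sq (E := ℝ) (μ := volume) (r := r) (by simpa using hr)
  simpa using this

lemma integrable_cauchyWeight {α β : ℂ} (h : 1 < (α + β).re) : Integrable (cauchyWeight α β) :=
  ((integrable_one_add_sq_rpow h).const_mul _).mono' (continuous_cauchyWeight α β).aestronglyMeasurable
    (Eventually.of_forall fun x => norm_cauchyWeight_le α β x)

lemma norm_exp_I_mul_mul (t x : ℝ) : ‖Complex.exp (Complex.I * t * x)‖ = 1 := by
  rw [Complex.norm_exp]; simp

lemma integrable_cauchyWeight_mul_exp {α β : ℂ} (h : 1 < (α + β).re) (t : ℝ) :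
    Integrable fun x : ℝ => cauchyWeight α β x * Complex.exp (Complex.I * t * x) :=
  (integrable_cauchyWeight h).mul_bdd (c := 1)
    (by fun_prop : Continuous _).aestronglyMeasurable
    (Eventually.of_forall fun x => (norm_exp_I_mul_mul t x).le)

lemma cauchyWeight_sub_one_left (α β : ℂ) (x : ℝ) :
    cauchyWeight (α - 1) β x = (1 + Complex.I * x) * cauchyWeight α β x := by
  rw [cauchyWeight, cauchyWeight, show -(α - 1) = -α + 1 by ring,
    Complex.cpow_add _ _ (one_add_I_mul_ne_zero x), Complex.cpow_one]
  ring

lemma cauchyWeight_sub_one_right (α β : ℂ) (x : ℝ) :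
    cauchyWeight α (β - 1) x = (1 - Complex.I * x) * cauchyWeight α β x := by
  rw [cauchyWeight, cauchyWeight, show -(β - 1) = -β + 1 by ring,
    Complex.cpow_add _ _ (one_sub_I_mul_ne_zero x), Complex.cpow_one]
  ring

/-- A contiguous relation that amounts to (1 + ix) + (1 - ix) = 2. -/
lemma two_mul_cauchyFourier {α β : ℂ} (h : 2 < (α + β).re) (t : ℝ) :
    2 * cauchyFourier α β t = cauchyFourier (α - 1) β t + cauchyFourier α (β - 1) t := by
  have h1 : 1 < (α - 1 + β).re := by simp at h ⊢; linarith
  have h2 : 1 < (α + (β - 1)).re := by simp at h ⊢; linarith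
  unfold cauchyFourier
  rw [← integral_add (integrable_cauchyWeight_mul_exp h1 t) (integrable_cauchyWeight_mul_exp h2 t),
    ← integral_const_mul]
  refine integral_congr_ae (Eventually.of_forall fun x => ?_)
  simp only [cauchyWeight_sub_one_left, cauchyWeight_sub_one_right]
  ring

lemma hasDerivAt_cauchyWeight (α β : ℂ) (x : ℝ) :
    HasDerivAt (cauchyWeight α β)
      (Complex.I * (-α * cauchyWeight (α + 1) β x + β * cauchyWeight α (β + 1) x)) x := by
  have e1 : HasDerivAt (fun z : ℂ => 1 + Complex.I * z) Complex.I (x : ℂ) := by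
    simpa using ((hasDerivAt_id (x : ℂ)).const_mul Complex.I).const_add 1
  have e2 : HasDerivAt (fun z : ℂ => 1 - Complex.I * z) (-Complex.I) (x : ℂ) := by
    simpa using ((hasDerivAt_id (x : ℂ)).const_mul Complex.I).const_sub 1
  have h := ((e1.cpow_const (c := -α) (one_add_I_mul_mem_slitPlane x)).mul
    (e2.cpow_const (c := -β) (one_sub_I_mul_mem_slitPlane x))).comp_ofReal
  refine h.congr_deriv ?_
  simp only [cauchyWeight]
  rw [show -(α + 1) = -α - 1 by ring, show -(β + 1) = -β - 1 by ring]
  ring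

/-- Integration by parts: the x-derivative of the whole integrand has integral zero. -/
lemma mul_cauchyFourier {α β : ℂ} (h : 1 < (α + β).re) (t : ℝ) :
    t * cauchyFourier α β t =
      α * cauchyFourier (α + 1) β t - β * cauchyFourier α (β + 1) t := by
  have h1 : 1 < (α + 1 + β).re := by simp at h ⊢; linarith
  have h2 : 1 < (α + (β + 1)).re := by simp at h ⊢; linarith
  have i0 := integrable_cauchyWeight_mul_exp h t
  have i1 := integrable_cauchyWeight_mul_exp h1 t
  have i2 := integrable_cauchyWeight_mul_exp h2 t
  have hd : ∀ x : ℝ, HasDerivAt (fun x : ℝ => cauchyWeight α β x * Complex.exp (Complex.I * t * x))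
      (Complex.I * t * (cauchyWeight α β x * Complex.exp (Complex.I * t * x))
        - Complex.I * α * (cauchyWeight (α + 1) β x * Complex.exp (Complex.I * t * x))
        + Complex.I * β * (cauchyWeight α (β + 1) x * Complex.exp (Complex.I * t * x))) x := by
    intro x
    have e : HasDerivAt (fun x : ℝ => Complex.exp (Complex.I * t * x))
        (Complex.exp (Complex.I * t * x) * (Complex.I * t)) x := by
      have := (((hasDerivAt_id (x : ℂ)).const_mul (Complex.I * t)).cexp).comp_ofReal
      simpa using this
    refine ((hasDerivAt_cauchyWeight α β x).mul e).congr_deriv ?_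
    ring
  have key := integral_eq_zero_of_hasDerivAt_of_integrable hd
    (((i0.const_mul _).sub (i1.const_mul _)).add (i2.const_mul _)) i0
  have i3 : Integrable fun x : ℝ =>
      Complex.I * t * (cauchyWeight α β x * Complex.exp (Complex.I * t * x))
        - Complex.I * α * (cauchyWeight (α + 1) β x * Complex.exp (Complex.I * t * x)) :=
    (i0.const_mul _).sub (i1.const_mul _)
  rw [integral_add i3 (i2.const_mul _),
    integral_sub (i0.const_mul _) (i1.const_mul _), integral_const_mul, integral_const_mul,
    integral_const_mul] at key
  change Complex.I * t * cauchyFourier α β t - Complex.I * α * cauchyFourier (α + 1) β t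
    + Complex.I * β * cauchyFourier α (β + 1) t = 0 at key
  have hI := Complex.I_ne_zero
  refine mul_left_cancel₀ hI ?_
  linear_combination key

/-- The factor e^t is introduced for this: differentiating e^t e^{itx} in t produces 1 + ix, which
lowers α by one. -/
lemma hasDerivAt_expCauchyFourier {α β : ℂ} (h : 2 < (α + β).re) (t : ℝ) :
    HasDerivAt (expCauchyFourier α β) (expCauchyFourier (α - 1) β t) t := by
  have h0 : 1 < (α + β).re := by linarith
  have h1 : 1 < (α - 1 + β).re := by simp at h ⊢; linarith
  have hd : ∀ (x t : ℝ), HasDerivAt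
      (fun t : ℝ => cauchyWeight α β x * Complex.exp (Complex.I * t * x))
      (cauchyWeight (α - 1) β x * Complex.exp (Complex.I * t * x)
        - cauchyWeight α β x * Complex.exp (Complex.I * t * x)) t := by
    intro x t
    have := ((((hasDerivAt_id (t : ℂ)).const_mul Complex.I).mul_const
      (x : ℂ)).cexp.const_mul (cauchyWeight α β x)).comp_ofReal
    simp only [id] at this
    refine this.congr_deriv ?_
    rw [cauchyWeight_sub_one_left]
    ring
  have key := (hasDerivAt_integral_of_dominated_loc_of_deriv_le (𝕜 := ℝ) (x₀ := t) (μ := volume)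
    (s := Set.univ) univ_mem
    (F := fun t x => cauchyWeight α β x * Complex.exp (Complex.I * t * x))
    (F' := fun t x => cauchyWeight (α - 1) β x * Complex.exp (Complex.I * t * x)
        - cauchyWeight α β x * Complex.exp (Complex.I * t * x))
    (bound := fun x => ‖cauchyWeight (α - 1) β x‖ + ‖cauchyWeight α β x‖)
    (Eventually.of_forall fun t => (integrable_cauchyWeight_mul_exp h0 t).aestronglyMeasurable)
    (integrable_cauchyWeight_mul_exp h0 t)
    ((integrable_cauchyWeight_mul_exp h1 t).sub
      (integrable_cauchyWeight_mul_exp h0 t)).aestronglyMeasurable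
    (Eventually.of_forall fun x t _ => by
      refine (norm_sub_le _ _).trans ?_
      rw [norm_mul, norm_mul, norm_exp_I_mul_mul, mul_one, mul_one])
    ((integrable_cauchyWeight h1).norm.add (integrable_cauchyWeight h0).norm)
    (Eventually.of_forall fun x t _ => hd x t)).2
  rw [integral_sub (integrable_cauchyWeight_mul_exp h1 t)
    (integrable_cauchyWeight_mul_exp h0 t)] at key
  have he : HasDerivAt (fun t : ℝ => Complex.exp (t : ℂ)) (Complex.exp t) t := by
    simpa using (Complex.hasDerivAt_exp (t : ℂ)).comp_ofReal
  refine (he.mul key).congr_deriv ?_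
  simp only [expCauchyFourier, cauchyFourier]
  ring

lemma two_mul_expCauchyFourier {α β : ℂ} (h : 2 < (α + β).re) (t : ℝ) :
    2 * expCauchyFourier α β t = expCauchyFourier (α - 1) β t + expCauchyFourier α (β - 1) t := by
  simp only [expCauchyFourier]
  linear_combination Complex.exp t * two_mul_cauchyFourier h t

lemma mul_expCauchyFourier {α β : ℂ} (h : 1 < (α + β).re) (t : ℝ) :
    t * expCauchyFourier α β t =
      α * expCauchyFourier (α + 1) β t - β * expCauchyFourier α (β + 1) t := by
  simp only [expCauchyFourier]
  linear_combination Complex.exp t * mul_cauchyFourier h t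

/-- Under the weaker condition Re(α + β) > 1 the weight at (α - 1, β) need not be integrable. So t
times the transform is first expressed through (α + 1, β) and (α, β + 1), whose weights decay
faster, and the quotient by t is differentiated. -/
lemma hasDerivAt_expCauchyFourier_div {α β : ℂ} (h : 1 < (α + β).re) {t : ℝ} (ht : 0 < t) :
    HasDerivAt (expCauchyFourier α β)
      (((α - 1) * expCauchyFourier α β t - β * expCauchyFourier (α - 1) (β + 1) t) / t) t := by
  have h1 : 2 < (α + 1 + β).re := by simp at h ⊢; linarith
  have h2 : 2 < (α + (β + 1)).re := by simp at h ⊢; linarith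
  have ht' : (t : ℂ) ≠ 0 := by exact_mod_cast ht.ne'
  have d1 := hasDerivAt_expCauchyFourier h1 t
  have d2 := hasDerivAt_expCauchyFourier h2 t
  rw [add_sub_cancel_right] at d1
  have d3 : HasDerivAt (fun τ : ℝ => (τ : ℂ)) 1 t := Complex.ofRealCLM.hasDerivAt
  have d4 := ((d1.const_mul α).sub (d2.const_mul β)).div d3 ht'
  have d5 : HasDerivAt (expCauchyFourier α β) _ t := d4.congr_of_eventuallyEq (by
    filter_upwards [lt_mem_nhds ht] with τ hτ
    have hτ' : (τ : ℂ) ≠ 0 := by exact_mod_cast (ne_of_gt hτ)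
    simp only [Pi.div_apply, Pi.sub_apply]
    rw [← mul_expCauchyFourier h τ]
    field_simp)
  refine d5.congr_deriv ?_
  simp only [Pi.sub_apply]
  have := mul_expCauchyFourier h t
  field_simp
  linear_combination this

/-- Each differentiation moves (α, β) to (α - 1, β + 1) along a line of constant α + β. A relation
between three consecutive points of that line closes the system into a second-order equation. -/
lemma three_term_expCauchyFourier {α β : ℂ} (h : 1 < (α + β).re) (t : ℝ) :
    2 * t * expCauchyFourier (α - 1) (β + 1) t =
      (α - 1) * (expCauchyFourier (α - 1) (β + 1) t + expCauchyFourier α β t) -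
      (β + 1) * (expCauchyFourier (α - 2) (β + 2) t + expCauchyFourier (α - 1) (β + 1) t) := by
  have a1 := mul_expCauchyFourier (α := α - 1) (β := β + 1) (by simp at h ⊢; linarith) t
  have a2 := two_mul_expCauchyFourier (α := α) (β := β + 1) (by simp at h ⊢; linarith) t
  have a3 := two_mul_expCauchyFourier (α := α - 1) (β := β + 2) (by simp at h ⊢; linarith) t
  rw [show α - 1 + 1 = α by ring, show β + 1 + 1 = β + 2 by ring] at a1
  rw [show β + 1 - 1 = β by ring] at a2
  rw [show α - 1 - 1 = α - 2 by ring, show β + 2 - 1 = β + 1 by ring] at a3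
  linear_combination 2 * a1 + (α - 1) * a2 - (β + 1) * a3

/-- Up to scaling, `expCauchyFourier α β` solves Kummer's equation. -/
lemma kummer_equation_expCauchyFourier {α β : ℂ} (h : 1 < (α + β).re) (c : ℂ) :
    ∃ w₁ w₂ : ℝ → ℂ, ∀ x : ℝ, 0 < x →
      HasDerivAt (fun x => c * expCauchyFourier α β (x / 2)) (w₁ x) x ∧ HasDerivAt w₁ (w₂ x) x ∧
      (x : ℂ) * w₂ x + (2 - α - β - (x : ℂ)) * w₁ x
        - (1 - α) * (c * expCauchyFourier α β (x / 2)) = 0 := by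
  have h' : 1 < (α - 1 + (β + 1)).re := by simp at h ⊢; linarith
  set A := expCauchyFourier α β
  set B := expCauchyFourier (α - 1) (β + 1)
  set D := expCauchyFourier (α - 2) (β + 2)
  set A' : ℝ → ℂ := fun t => ((α - 1) * A t - β * B t) / t with hA'
  set B' : ℝ → ℂ := fun t => ((α - 2) * B t - (β + 1) * D t) / t with hB'
  have dA : ∀ t : ℝ, 0 < t → HasDerivAt A (A' t) t := fun t ht =>
    hasDerivAt_expCauchyFourier_div h ht
  have dB : ∀ t : ℝ, 0 < t → HasDerivAt B (B' t) t := fun t ht => by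
    have := hasDerivAt_expCauchyFourier_div h' ht
    rw [show α - 1 - 1 = α - 2 by ring, show β + 1 + 1 = β + 2 by ring] at this
    exact this
  have half : ∀ x : ℝ, HasDerivAt (fun x : ℝ => x / 2) (1 / 2) x := fun x =>
    (hasDerivAt_id x).div_const 2
  refine ⟨fun x => c * (A' (x / 2) / 2),
    fun x => c * ((((α - 1) * A' (x / 2) - β * B' (x / 2)) * (x / 2 : ℝ)
      - ((α - 1) * A (x / 2) - β * B (x / 2)) ) / (x / 2 : ℝ) ^ 2 / 4), fun x hx => ?_⟩
  have hx2 : 0 < x / 2 := by positivity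
  have hx' : (x : ℂ) ≠ 0 := by exact_mod_cast hx.ne'
  have hx2' : ((x / 2 : ℝ) : ℂ) ≠ 0 := by exact_mod_cast hx2.ne'
  refine ⟨?_, ?_, ?_⟩
  · refine (((dA _ hx2).scomp x (half x)).const_mul c).congr_deriv ?_
    simp only [Complex.real_smul]; push_cast; ring
  · have d3 : HasDerivAt (fun τ : ℝ => (τ : ℂ)) 1 (x / 2) := Complex.ofRealCLM.hasDerivAt
    have d4 := ((((dA _ hx2).const_mul (α - 1)).sub ((dB _ hx2).const_mul β)).div d3 hx2')
    refine (((d4.scomp x (half x)).div_const 2).const_mul c).congr_deriv ?_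
    simp only [Complex.real_smul, Pi.sub_apply]; push_cast; ring
  · have key := three_term_expCauchyFourier h (x / 2)
    change 2 * ((x / 2 : ℝ) : ℂ) * B (x / 2) = (α - 1) * (B (x / 2) + A (x / 2))
      - (β + 1) * (D (x / 2) + B (x / 2)) at key
    simp only [hA', hB']
    push_cast at key ⊢
    field_simp
    field_simp at key
    linear_combination (4 * c * β) * key

end

/-! ### Asymptotics of the transforms and identification with U -/

section

lemma continuousOn_ofReal_cpow (κ : ℂ) :
    ContinuousOn (fun v : ℝ => (v : ℂ) ^ κ) (Set.Ioi 0) := fun _ hv =>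
  (hasDerivAt_ofReal_cpow_pos κ hv).continuousAt.continuousWithinAt

/-- The function y^{α-1} e^{-y} on (0, ∞) has Fourier transform Γ(α)(1 + ix)^{-α}, and this is its
inversion. Re α > 1 makes the transform integrable. -/
lemma integral_one_add_I_mul_cpow {α : ℂ} (hα : 1 < α.re) {y : ℝ} (hy : 0 < y) :
    ∫ x : ℝ, Complex.exp (Complex.I * x * y) * (1 + Complex.I * x) ^ (-α) =
      2 * Real.pi / Complex.Gamma α * ((y : ℂ) ^ (α - 1) * Complex.exp (-y)) := by
  have hα0 : 0 < α.re := by linarith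
  have hΓ := Complex.Gamma_ne_zero_of_re_pos hα0
  set f : ℝ → ℂ := (Set.Ioi 0).indicator fun y : ℝ => (y : ℂ) ^ (α - 1) * Complex.exp (-y) with hf
  have hi : IntegrableOn (fun y : ℝ => (y : ℂ) ^ (α - 1) * Complex.exp (-y)) (Set.Ioi 0) := by
    simpa using integrableOn_cpow_mul_exp_neg_mul (r := 1) hα0 (by simp)
  have hw : ∀ x : ℝ, (1 + Complex.I * x) ^ (-α) = cauchyWeight α 0 x := fun x => by
    simp [cauchyWeight]
  have key := integral_exp_mul_fourier (f := f)
    (F := fun x => Complex.Gamma α * (1 + Complex.I * x) ^ (-α)) (y := y)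
    ((integrable_indicator_iff measurableSet_Ioi).mpr hi) (fun x => ?_) ?_ ?_
  · rw [hf, Set.indicator_of_mem (Set.mem_Ioi.mpr hy)] at key
    rw [div_mul_eq_mul_div, ← key, eq_div_iff hΓ, ← integral_mul_const]
    exact integral_congr_ae (Eventually.of_forall fun x => by simp only; ring)
  · have h1 : ∀ y : ℝ, Complex.exp (-(Complex.I * x * y)) * f y =
        (Set.Ioi 0).indicator (fun y : ℝ => (y : ℂ) ^ (α - 1)
          * Complex.exp (-((1 + Complex.I * x) * y))) y := by
      intro y
      by_cases hy : y ∈ Set.Ioi (0 : ℝ)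
      · rw [hf, Set.indicator_of_mem hy, Set.indicator_of_mem hy, mul_left_comm, ← Complex.exp_add]
        congr 2
        ring
      · rw [hf, Set.indicator_of_notMem hy, Set.indicator_of_notMem hy, mul_zero]
    simp_rw [h1]
    rw [integral_indicator measurableSet_Ioi,
      integral_cpow_mul_exp_neg_mul_Ioi_complex hα0 (by simp), mul_comm]
  · simp_rw [hw]
    exact (integrable_cauchyWeight (by simpa using hα)).const_mul _
  · have : f =ᶠ[𝓝 y] fun y : ℝ => (y : ℂ) ^ (α - 1) * Complex.exp (-y) := by
      filter_upwards [lt_mem_nhds hy] with z hz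
      rw [hf, Set.indicator_of_mem (Set.mem_Ioi.mpr hz)]
    refine ContinuousAt.congr ?_ this.symm
    exact (hasDerivAt_ofReal_cpow_pos _ hy).continuousAt.mul (by fun_prop)

/-- With (1 - ix)^{-β} written as a Gamma integral over v and the order of integration exchanged,
the x-integral is the preceding inversion at the point t + v. The resulting Laplace integral makes
the behaviour for large t visible. -/
lemma expCauchyFourier_eq_integral {α β : ℂ} (hα : 1 < α.re) (hβ : 0 < β.re) {t : ℝ} (ht : 0 < t) :
    expCauchyFourier α β t = 2 * Real.pi / (Complex.Gamma α * Complex.Gamma β) *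
      ∫ v in Set.Ioi (0 : ℝ), (v : ℂ) ^ (β - 1) * ((t + v : ℝ) : ℂ) ^ (α - 1)
        * Complex.exp (-(2 * v)) := by
  have hα0 : 0 < α.re := by linarith
  have hΓα := Complex.Gamma_ne_zero_of_re_pos hα0
  have hΓβ := Complex.Gamma_ne_zero_of_re_pos hβ
  set H : ℝ → ℝ → ℂ := fun x v => cauchyWeight α 0 x * ((v : ℂ) ^ (β - 1) * Complex.exp (-v)) *
    Complex.exp (Complex.I * ((t + v : ℝ) : ℂ) * x) with hH
  have hi : IntegrableOn (fun y : ℝ => (y : ℂ) ^ (β - 1) * Complex.exp (-y)) (Set.Ioi 0) := by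
    simpa using integrableOn_cpow_mul_exp_neg_mul (r := 1) hβ (by simp)
  have hHi : Integrable (Function.uncurry H) (volume.prod (volume.restrict (Set.Ioi 0))) := by
    refine ((integrable_cauchyWeight (α := α) (β := 0) (by simpa using hα)).mul_prod hi).mul_bdd
      (c := 1) (Continuous.aestronglyMeasurable (by fun_prop)) (Eventually.of_forall fun p => ?_)
    exact (norm_exp_I_mul_mul _ _).le
  have h1 : Complex.Gamma β * cauchyFourier α β t = ∫ x, ∫ v in Set.Ioi (0 : ℝ), H x v := by
    rw [cauchyFourier, ← integral_const_mul]
    refine integral_congr_ae (Eventually.of_forall fun x => ?_)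
    simp only
    have := integral_cpow_mul_exp_neg_mul_Ioi_complex (a := β) (r := 1 - Complex.I * x) hβ
      (by simp)
    rw [cauchyWeight, show Complex.Gamma β * ((1 + Complex.I * x) ^ (-α) *
      (1 - Complex.I * x) ^ (-β) * Complex.exp (Complex.I * t * x)) =
      ((1 + Complex.I * x) ^ (-α) * Complex.exp (Complex.I * t * x)) *
        ((1 - Complex.I * x) ^ (-β) * Complex.Gamma β) by ring, ← this, ← integral_const_mul]
    refine integral_congr_ae (Eventually.of_forall fun v => ?_)
    simp only [hH, cauchyWeight, neg_zero, Complex.cpow_zero, mul_one]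
    have : Complex.exp (-((1 - Complex.I * x) * v)) * Complex.exp (Complex.I * t * x) =
      Complex.exp (-v) * Complex.exp (Complex.I * ((t + v : ℝ) : ℂ) * x) := by
      rw [← Complex.exp_add, ← Complex.exp_add]
      congr 1
      push_cast
      ring
    linear_combination (1 + Complex.I * x) ^ (-α) * (v : ℂ) ^ (β - 1) * this
  have h2 : ∀ v ∈ Set.Ioi (0 : ℝ), ∫ x, H x v = 2 * Real.pi / Complex.Gamma α * Complex.exp (-t) *
      ((v : ℂ) ^ (β - 1) * ((t + v : ℝ) : ℂ) ^ (α - 1) * Complex.exp (-(2 * v))) := by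
    intro v hv
    have hv' : 0 < v := hv
    have := integral_one_add_I_mul_cpow hα (y := t + v) (by positivity)
    have h3 : ∫ x, H x v = ((v : ℂ) ^ (β - 1) * Complex.exp (-v)) *
        ∫ x : ℝ, Complex.exp (Complex.I * x * (t + v : ℝ)) * (1 + Complex.I * x) ^ (-α) := by
      rw [← integral_const_mul]
      refine integral_congr_ae (Eventually.of_forall fun x => ?_)
      simp only [hH, cauchyWeight, neg_zero, Complex.cpow_zero, mul_one]
      rw [show Complex.I * (t + v : ℝ) * x = Complex.I * x * (t + v : ℝ) by ring]
      ring
    rw [h3, this]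
    have h4 : Complex.exp (-(t + v : ℝ)) * Complex.exp (-v)
        = Complex.exp (-t) * Complex.exp (-(2 * v)) := by
      rw [← Complex.exp_add, ← Complex.exp_add]
      congr 1
      push_cast
      ring
    linear_combination (2 * Real.pi / Complex.Gamma α) * (v : ℂ) ^ (β - 1) *
      ((t + v : ℝ) : ℂ) ^ (α - 1) * h4
  rw [integral_integral_swap hHi, setIntegral_congr_fun measurableSet_Ioi h2,
    integral_const_mul] at h1
  rw [expCauchyFourier]
  have h5 : Complex.exp t * Complex.exp (-t) = 1 := by rw [← Complex.exp_add]; simp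
  refine mul_left_cancel₀ hΓβ ?_
  rw [mul_left_comm, h1]
  field_simp
  rw [h5, one_mul]

/-- The leading asymptotics of `expCauchyFourier α β` at `+∞`. -/
def CauchyFourierAsymptotics (α β : ℂ) : Prop :=
  Tendsto (fun t : ℝ => expCauchyFourier α β t * (t : ℂ) ^ (1 - α)) atTop
    (𝓝 (2 * Real.pi * 2 ^ (-β) / Complex.Gamma α))

lemma cauchyFourierAsymptotics_of_pos {α β : ℂ} (hα : 1 < α.re) (hβ : 0 < β.re) :
    CauchyFourierAsymptotics α β := by
  have hα0 : 0 < α.re := by linarith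
  have hΓα := Complex.Gamma_ne_zero_of_re_pos hα0
  have hΓβ := Complex.Gamma_ne_zero_of_re_pos hβ
  set c : ℝ := α.re - 1 with hc
  have hc0 : 0 < c := by simp only [hc]; linarith
  have hlim : Tendsto (fun t : ℝ => ∫ v in Set.Ioi (0 : ℝ), (v : ℂ) ^ (β - 1) *
      ((1 + v / t : ℝ) : ℂ) ^ (α - 1) * Complex.exp (-(2 * v))) atTop
      (𝓝 (∫ v in Set.Ioi (0 : ℝ), (v : ℂ) ^ (β - 1) * Complex.exp (-(2 * v)))) := by
    refine tendsto_integral_filter_of_dominated_convergence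
      (fun v => 2 ^ c * (v ^ (β.re - 1) * Real.exp (-2 * v ^ (1 : ℝ))
        + v ^ (β.re - 1 + c) * Real.exp (-2 * v ^ (1 : ℝ)))) ?_ ?_ ?_ ?_
    · filter_upwards [eventually_gt_atTop 0] with t ht
      refine (((continuousOn_ofReal_cpow _).mul (fun v hv => ?_)).mul
        (by fun_prop)).aestronglyMeasurable measurableSet_Ioi
      have hv' : (0 : ℝ) < v := hv
      have h1 := (hasDerivAt_ofReal_cpow_pos (α - 1) (x := 1 + v / t) (by positivity)).continuousAt
      exact (h1.comp (f := fun v : ℝ => 1 + v / t) (by fun_prop)).continuousWithinAt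
    · filter_upwards [eventually_ge_atTop 1] with t ht
      refine (ae_restrict_iff' measurableSet_Ioi).mpr (Eventually.of_forall fun v hv => ?_)
      have hv' : (0 : ℝ) < v := hv
      have ht0 : 0 < t := by linarith
      rw [norm_mul, norm_mul, Complex.norm_cpow_eq_rpow_re_of_pos hv',
        Complex.norm_cpow_eq_rpow_re_of_pos (by positivity), Complex.norm_exp]
      -- For t ≥ 1, (1 + v/t)^c ≤ (1 + v)^c ≤ 2^c max(1, v)^c, so a single integrable bound serves
      -- all large t.
      have h2 : (1 + v / t) ^ (α - 1).re ≤ 2 ^ c * (1 + v ^ c) := by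
        have h3 : v / t ≤ v := div_le_self hv'.le ht
        have h4 : (1 + v / t) ^ (α - 1).re ≤ (1 + v) ^ c := by
          simp only [Complex.sub_re, Complex.one_re, hc]
          gcongr
        refine h4.trans ?_
        have h5 : (0 : ℝ) < 2 ^ c := by positivity
        have h6 : 0 < v ^ c := by positivity
        rcases le_total v 1 with h | h
        · calc (1 + v) ^ c ≤ 2 ^ c := by gcongr; linarith
            _ ≤ _ := by nlinarith
        · calc (1 + v) ^ c ≤ (2 * v) ^ c := by gcongr; linarith
            _ = 2 ^ c * v ^ c := Real.mul_rpow (by norm_num) hv'.le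
            _ ≤ _ := by nlinarith
      rw [Real.rpow_add hv']
      simp only [Complex.sub_re, Complex.one_re, Real.rpow_one, Complex.neg_re]
      simp only [Complex.sub_re, Complex.one_re] at h2
      have h7 : (2 * (v : ℂ)).re = 2 * v := by simp
      rw [h7]
      calc v ^ (β.re - 1) * (1 + v / t) ^ (α.re - 1) * Real.exp (-(2 * v))
          ≤ v ^ (β.re - 1) * (2 ^ c * (1 + v ^ c)) * Real.exp (-(2 * v)) := by gcongr
        _ = _ := by rw [neg_mul]; ring
    · refine Integrable.const_mul (Integrable.add ?_ ?_) _
      · exact integrableOn_rpow_mul_exp_neg_mul_rpow (by linarith) one_pos two_pos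
      · exact integrableOn_rpow_mul_exp_neg_mul_rpow (by linarith) one_pos two_pos
    · refine Eventually.of_forall fun v => ?_
      have h1 : Tendsto (fun t : ℝ => 1 + v / t) atTop (𝓝 1) := by
        have := (tendsto_const_nhds (x := v)).div_atTop (tendsto_id (α := ℝ))
        simpa using this.const_add 1
      have h2 : Tendsto (fun t : ℝ => ((1 + v / t : ℝ) : ℂ) ^ (α - 1)) atTop (𝓝 1) := by
        have h3 := (hasDerivAt_ofReal_cpow_pos (α - 1) one_pos).continuousAt.tendsto.comp h1
        simpa [Function.comp_def] using h3
      simpa using (tendsto_const_nhds.mul h2).mul_const (Complex.exp (-(2 * v)))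
  have hval : ∫ v in Set.Ioi (0 : ℝ), (v : ℂ) ^ (β - 1) * Complex.exp (-(2 * v)) =
      2 ^ (-β) * Complex.Gamma β :=
    integral_cpow_mul_exp_neg_mul_Ioi_complex hβ (by simp)
  rw [hval] at hlim
  have := hlim.const_mul (2 * Real.pi / (Complex.Gamma α * Complex.Gamma β))
  rw [show 2 * Real.pi / (Complex.Gamma α * Complex.Gamma β) * (2 ^ (-β) * Complex.Gamma β) =
    2 * Real.pi * 2 ^ (-β) / Complex.Gamma α by field_simp] at this
  refine this.congr' ?_
  filter_upwards [eventually_gt_atTop 0] with t ht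
  have ht' : (t : ℂ) ≠ 0 := by exact_mod_cast ht.ne'
  rw [expCauchyFourier_eq_integral hα hβ ht, mul_assoc, ← integral_mul_const]
  congr 1
  refine setIntegral_congr_fun measurableSet_Ioi fun v hv => ?_
  have hv' : (0 : ℝ) < v := hv

  have h1 : ((t + v : ℝ) : ℂ) ^ (α - 1) = ((1 + v / t : ℝ) : ℂ) ^ (α - 1) * (t : ℂ) ^ (α - 1) := by
    rw [← Complex.mul_cpow_ofReal_nonneg (by positivity) ht.le, ← Complex.ofReal_mul]
    congr 2
    field_simp
  have h2 : (t : ℂ) ^ (α - 1) * (t : ℂ) ^ (1 - α) = 1 := by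
    rw [← Complex.cpow_add _ _ ht']; simp
  rw [h1]
  linear_combination (-(v : ℂ) ^ (β - 1) * ((1 + v / t : ℝ) : ℂ) ^ (α - 1) *
    Complex.exp (-(2 * v))) * h2

lemma tendsto_div_ofReal_atTop {g : ℝ → ℂ} {l : ℂ} (h : Tendsto g atTop (𝓝 l)) :
    Tendsto (fun t : ℝ => g t / t) atTop (𝓝 0) := by
  have h3 : Tendsto (fun x : ℝ => (((x⁻¹ : ℝ)) : ℂ)) atTop (𝓝 ((0 : ℝ) : ℂ)) :=
    (Complex.continuous_ofReal.tendsto 0).comp tendsto_inv_atTop_zero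
  have := h.mul h3
  simp only [Complex.ofReal_zero, mul_zero] at this
  exact this.congr fun x => by push_cast; rw [div_eq_mul_inv]

/-- The two contiguous relations combine to t F(α,β) = 2α F(α+1,β+1) - (α+β) F(α,β+1). After
multiplication by t^{-α} the last term is O(1/t), so the first alone gives the leading coefficient.
-/
lemma CauchyFourierAsymptotics.shift_right {α β : ℂ} (hα : α ≠ 0) (h : 1 < (α + β).re)
    (h1 : CauchyFourierAsymptotics (α + 1) (β + 1)) (h2 : CauchyFourierAsymptotics α (β + 1)) :
    CauchyFourierAsymptotics α β := by
  have key := (Tendsto.const_mul (2 * α) h1).sub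
    (Tendsto.const_mul (α + β) (tendsto_div_ofReal_atTop h2))
  rw [mul_zero, sub_zero, Complex.Gamma_add_one _ hα, show -(β + 1) = -β - 1 by ring,
    Complex.cpow_sub _ _ two_ne_zero, Complex.cpow_one,
    show 2 * α * (2 * Real.pi * (2 ^ (-β) / 2) / (α * Complex.Gamma α)) =
      2 * Real.pi * 2 ^ (-β) / Complex.Gamma α by
      rw [div_eq_mul_inv _ (α * _), mul_inv]; field_simp] at key
  refine key.congr' ?_
  filter_upwards [eventually_gt_atTop 0] with t ht
  have ht' : (t : ℂ) ≠ 0 := by exact_mod_cast ht.ne'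
  have e1 := mul_expCauchyFourier h t
  have e2 := two_mul_expCauchyFourier (α := α + 1) (β := β + 1) (by simp at h ⊢; linarith) t
  rw [add_sub_cancel_right, add_sub_cancel_right] at e2
  rw [show (1 : ℂ) - (α + 1) = -α by ring, show (1 : ℂ) - α = -α + 1 by ring,
    Complex.cpow_add _ _ ht', Complex.cpow_one]
  field_simp
  linear_combination (t : ℂ) ^ (-α) * (-e1 + α * e2)

/-- Here t F(α,β) = (α+β) F(α+1,β) - 2β F(α+1,β+1), and both terms contribute to leading order. -/
lemma CauchyFourierAsymptotics.shift_left {α β : ℂ} (hα : α ≠ 0) (h : 1 < (α + β).re)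
    (h1 : CauchyFourierAsymptotics (α + 1) β) (h2 : CauchyFourierAsymptotics (α + 1) (β + 1)) :
    CauchyFourierAsymptotics α β := by
  have key := (Tendsto.const_mul (α + β) h1).sub (Tendsto.const_mul (2 * β) h2)
  rw [Complex.Gamma_add_one _ hα, show -(β + 1) = -β - 1 by ring,
    Complex.cpow_sub _ _ two_ne_zero, Complex.cpow_one,
    show (α + β) * (2 * Real.pi * 2 ^ (-β) / (α * Complex.Gamma α)) -
      2 * β * (2 * Real.pi * (2 ^ (-β) / 2) / (α * Complex.Gamma α)) =
      2 * Real.pi * 2 ^ (-β) / Complex.Gamma α by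
      rw [div_eq_mul_inv _ (α * _), div_eq_mul_inv _ (α * _), mul_inv]; field_simp; ring] at key
  refine key.congr' ?_
  filter_upwards [eventually_gt_atTop 0] with t ht
  have ht' : (t : ℂ) ≠ 0 := by exact_mod_cast ht.ne'
  have e1 := mul_expCauchyFourier h t
  have e2 := two_mul_expCauchyFourier (α := α + 1) (β := β + 1) (by simp at h ⊢; linarith) t
  rw [add_sub_cancel_right, add_sub_cancel_right] at e2
  rw [show (1 : ℂ) - (α + 1) = -α by ring, show (1 : ℂ) - α = -α + 1 by ring,
    Complex.cpow_add _ _ ht', Complex.cpow_one]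
  linear_combination (t : ℂ) ^ (-α) * (-e1 - β * e2)

/-- The Laplace integral covers Re α > 1 and Re β > 0. For the Hankel entries Re α = Re s + N is
only known to exceed 1/2, and β = s + N - j - k may have negative real part. So β is lowered by
induction, and then α once. -/
lemma cauchyFourierAsymptotics {α β : ℂ} (hα : 0 < α.re) (h : 1 < (α + β).re) :
    CauchyFourierAsymptotics α β := by
  have ne0 : ∀ {α : ℂ}, 0 < α.re → α ≠ 0 := fun hα h0 => by simp [h0] at hα
  have key : ∀ (n : ℕ) (α β : ℂ), 1 < α.re → 1 < (α + β).re → -(n : ℝ) < β.re →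
      CauchyFourierAsymptotics α β := by
    intro n
    induction n with
    | zero => exact fun α β hα _ hβ => cauchyFourierAsymptotics_of_pos hα (by simpa using hβ)
    | succ n ih =>
      intro α β hα h hβ
      push_cast at hβ
      simp only [Complex.add_re] at h
      refine .shift_right (ne0 (by linarith)) (by simpa using h) (ih _ _ ?_ ?_ ?_) (ih _ _ hα ?_ ?_)
      all_goals simp only [Complex.add_re, Complex.one_re]; linarith
  simp only [Complex.add_re] at h
  obtain ⟨n, hn⟩ := exists_nat_gt (-β.re)
  refine .shift_left (ne0 hα) (by simpa using h) (key n _ _ ?_ ?_ ?_) (key n _ _ ?_ ?_ ?_)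
  all_goals (try simp only [Complex.add_re, Complex.one_re]); linarith

/-- Tricomi's function as the Fourier transform of a Cauchy-type weight. -/
theorem kummerU_two_mul {α β : ℂ} (hα : 0 < α.re) (h : 1 < (α + β).re) {t : ℝ} (ht : 0 < t) :
    kummerU (1 - α) (2 - α - β) (2 * t) =
      Complex.Gamma α * 2 ^ (α + β - 1) / (2 * Real.pi) * expCauchyFourier α β t := by
  have hΓ := Complex.Gamma_ne_zero_of_re_pos hα
  have hpi : (Real.pi : ℂ) ≠ 0 := by exact_mod_cast Real.pi_pos.ne'
  set c := Complex.Gamma α * 2 ^ (α + β - 1) / (2 * Real.pi) with hc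
  have hw : IsKummerU (1 - α) (2 - α - β) fun x => c * expCauchyFourier α β (x / 2) := by
    refine ⟨kummer_equation_expCauchyFourier h c, ?_⟩
    have h1 : Tendsto (fun x : ℝ => x / 2) atTop atTop := tendsto_id.atTop_div_const two_pos
    have h2 := (Tendsto.comp (cauchyFourierAsymptotics hα h) h1).const_mul (c * 2 ^ (1 - α))
    have h3 : c * 2 ^ (1 - α) * (2 * Real.pi * 2 ^ (-β) / Complex.Gamma α) = 1 := by
      have : (2 : ℂ) ^ (α + β - 1) * 2 ^ (1 - α) * 2 ^ (-β) = 1 := by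
        rw [← Complex.cpow_add _ _ two_ne_zero, ← Complex.cpow_add _ _ two_ne_zero]
        ring_nf
        simp
      rw [hc]
      field_simp
      linear_combination this
    rw [h3] at h2
    refine h2.congr' ?_
    filter_upwards [eventually_gt_atTop 0] with x hx
    simp only [Function.comp]
    have : (x : ℂ) ^ (1 - α) = ((x / 2 : ℝ) : ℂ) ^ (1 - α) * ((2 : ℝ) : ℂ) ^ (1 - α) := by
      rw [← Complex.mul_cpow_ofReal_nonneg (by positivity) (by norm_num), ← Complex.ofReal_mul]
      congr 2
      ring
    rw [this]
    push_cast
    ring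
  rw [hw.kummerU_eq (by positivity)]
  simp

end

/-! ### Formal power sums and the Schwinger-Dyson equations -/

section

/-- Polynomials in formal power sums `X k`, `k ∈ ℤ`. -/
abbrev PowerSumRing := MvPolynomial ℤ ℂ

namespace PowerSumRing
open MvPolynomial

/-- The derivation `X m ↦ m X (k + m)`. -/
noncomputable def shiftDeriv (k : ℤ) : Derivation ℂ PowerSumRing PowerSumRing :=
  mkDerivation ℂ fun m => (m : ℂ) • X (k + m)

/-- `∑_{l < k} X l X (k - l)`. -/
noncomputable def loopTerm (k : ℕ) : PowerSumRing :=
  ∑ l ∈ Finset.range k, X (l : ℤ) * X ((k : ℤ) - l)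

/-- The formal complex conjugation `X k ↦ X (-k)`. -/
noncomputable def conj : PowerSumRing →+* PowerSumRing :=
  eval₂Hom (C.comp (starRingEnd ℂ)) fun k => X (-k)

@[simp] lemma conj_X (k : ℤ) : conj (X k) = X (-k) := by simp [conj]

@[simp] lemma conj_C (a : ℂ) : conj (C a) = C (starRingEnd ℂ a) := by simp [conj]

@[simp] lemma conj_conj (r : PowerSumRing) : conj (conj r) = r := by
  induction r using MvPolynomial.induction_on with
  | C a => simp
  | add p q hp hq => simp [hp, hq]
  | mul_X p n hp => simp [hp]

/-- The zeroth order term of the Schwinger-Dyson operators, for all integers. -/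
noncomputable def loopTermInt (k : ℤ) : PowerSumRing :=
  if 0 ≤ k then loopTerm k.toNat else -conj (loopTerm (-k).toNat)

lemma shiftDeriv_X (k m : ℤ) : shiftDeriv k (X m) = (m : ℂ) • X (k + m) :=
  mkDerivation_X _ _ _

lemma conj_smul (a : ℂ) (r : PowerSumRing) : conj (a • r) = starRingEnd ℂ a • conj r := by
  rw [smul_eq_C_mul, smul_eq_C_mul, map_mul, conj_C]

/-- On the torus `shiftDeriv k` acts as the vector field ∑ z_j^k · z_j ∂/∂z_j. Conjugation is z ↦
1/z, which reverses both k and the sign of z ∂/∂z. -/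
lemma conj_shiftDeriv (k : ℤ) (r : PowerSumRing) :
    conj (shiftDeriv k r) = -shiftDeriv (-k) (conj r) := by
  induction r using MvPolynomial.induction_on with
  | C a => rw [conj_C, ← algebraMap_eq, Derivation.map_algebraMap, Derivation.map_algebraMap]; simp
  | add p q hp hq => simp only [map_add, hp, hq]; ring
  | mul_X p n hp =>
    rw [Derivation.leibniz, map_mul, Derivation.leibniz, map_add, smul_eq_mul, smul_eq_mul,
      map_mul, map_mul, hp, shiftDeriv_X, conj_smul, conj_X, conj_X, shiftDeriv_X, smul_eq_mul,
      smul_eq_mul, neg_add]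
    simp only [map_intCast, Int.cast_neg, neg_smul, smul_eq_C_mul]
    ring

lemma aeval_conj {p : ℤ → ℂ} (hp : ∀ m, p (-m) = starRingEnd ℂ (p m)) (r : PowerSumRing) :
    aeval p (conj r) = starRingEnd ℂ (aeval p r) := by
  induction r using MvPolynomial.induction_on with
  | C a => simp
  | add p q hp hq => simp only [map_add, hp, hq]
  | mul_X r n hr => simp only [map_mul, hr, conj_X, aeval_X, hp]

/-- The derivative of `r` at the point `p` in the direction `q`. -/
noncomputable def dirDeriv (p q : ℤ → ℂ) (r : PowerSumRing) : ℂ :=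
  (aeval (fun m => (TrivSqZeroExt.inl (p m) + TrivSqZeroExt.inr (q m) : DualNumber ℂ)) r).snd

lemma dirDeriv_fst (p q : ℤ → ℂ) (r : PowerSumRing) :
    (aeval (fun m => (TrivSqZeroExt.inl (p m) + TrivSqZeroExt.inr (q m) : DualNumber ℂ)) r).fst
      = aeval p r := by
  induction r using MvPolynomial.induction_on with
  | C a => simp [TrivSqZeroExt.algebraMap_eq_inl]
  | add p q hp hq => simp only [map_add, TrivSqZeroExt.fst_add, hp, hq]
  | mul_X r n hr =>
    simp only [map_mul, TrivSqZeroExt.fst_mul, hr, aeval_X, TrivSqZeroExt.fst_add,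
      TrivSqZeroExt.fst_inl, TrivSqZeroExt.fst_inr, add_zero]

@[simp] lemma dirDeriv_C (p q : ℤ → ℂ) (a : ℂ) : dirDeriv p q (C a) = 0 := by
  simp [dirDeriv, TrivSqZeroExt.algebraMap_eq_inl]

@[simp] lemma dirDeriv_X (p q : ℤ → ℂ) (k : ℤ) : dirDeriv p q (X k) = q k := by
  simp [dirDeriv]

lemma dirDeriv_add (p q : ℤ → ℂ) (r s : PowerSumRing) :
    dirDeriv p q (r + s) = dirDeriv p q r + dirDeriv p q s := by
  simp [dirDeriv]

lemma dirDeriv_mul (p q : ℤ → ℂ) (r s : PowerSumRing) :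
    dirDeriv p q (r * s) = aeval p r * dirDeriv p q s + aeval p s * dirDeriv p q r := by
  have := dirDeriv_fst p q
  simp only [dirDeriv, map_mul, TrivSqZeroExt.snd_mul, this, smul_eq_mul, MulOpposite.smul_eq_mul_unop,
    MulOpposite.unop_op]
  ring

lemma dirDeriv_mul_X (p q : ℤ → ℂ) (r : PowerSumRing) (k : ℤ) :
    dirDeriv p q (r * X k) = aeval p r * q k + p k * dirDeriv p q r := by
  rw [dirDeriv_mul]; simp

lemma dirDeriv_sum_smul {ι : Type*} (s : Finset ι) (a : ι → ℂ) (p : ℤ → ℂ) (q : ι → ℤ → ℂ)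
    (r : PowerSumRing) :
    dirDeriv p (fun m => ∑ i ∈ s, a i * q i m) r = ∑ i ∈ s, a i * dirDeriv p (q i) r := by
  induction r using MvPolynomial.induction_on with
  | C a => simp
  | add p q hp hq => simp only [dirDeriv_add, hp, hq, mul_add, Finset.sum_add_distrib]
  | mul_X r n hr =>
    simp only [dirDeriv_mul_X, hr, mul_add, Finset.sum_add_distrib, Finset.mul_sum]
    congr 1
    · exact Finset.sum_congr rfl fun _ _ => by ring
    · exact Finset.sum_congr rfl fun _ _ => by ring

lemma dirDeriv_const_mul (a : ℂ) (p q : ℤ → ℂ) (r : PowerSumRing) :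
    dirDeriv p (fun m => a * q m) r = a * dirDeriv p q r := by
  simpa using dirDeriv_sum_smul {()} (fun _ => a) p (fun _ => q) r

lemma aeval_shiftDeriv (k : ℤ) (p : ℤ → ℂ) (r : PowerSumRing) :
    aeval p (shiftDeriv k r) = dirDeriv p (fun m => m * p (k + m)) r := by
  induction r using MvPolynomial.induction_on with
  | C a => rw [← algebraMap_eq, Derivation.map_algebraMap, algebraMap_eq]; simp
  | add p q hp hq => simp only [map_add, hp, hq, dirDeriv_add]
  | mul_X r n hr =>
    rw [Derivation.leibniz, dirDeriv_mul_X, ← hr, shiftDeriv_X]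
    simp only [smul_eq_mul, map_add, map_mul, map_smul, aeval_X]

lemma hasDerivAt_aeval {p : ℝ → ℤ → ℂ} {q : ℤ → ℂ} {t : ℝ}
    (h : ∀ m, HasDerivAt (fun s => p s m) (q m) t) (r : PowerSumRing) :
    HasDerivAt (fun s => aeval (p s) r) (dirDeriv (p t) q r) t := by
  induction r using MvPolynomial.induction_on with
  | C a => simpa using hasDerivAt_const t a
  | add r s hr hs => simpa [dirDeriv_add] using hr.fun_add hs
  | mul_X r n hr =>
    simp only [map_mul, aeval_X]
    refine (hr.fun_mul (h n)).congr_deriv ?_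
    rw [dirDeriv_mul_X]
    ring

lemma continuous_aeval {T : Type*} [TopologicalSpace T] {p : T → ℤ → ℂ}
    (hp : ∀ m, Continuous fun x => p x m) (r : PowerSumRing) :
    Continuous fun x => aeval (p x) r := by
  induction r using MvPolynomial.induction_on with
  | C a => simpa using continuous_const
  | add r s hr hs => simpa using hr.fun_add hs
  | mul_X r n hr => simpa using hr.fun_mul (hp n)

lemma continuous_dirDeriv {T : Type*} [TopologicalSpace T] {p q : T → ℤ → ℂ}
    (hp : ∀ m, Continuous fun x => p x m) (hq : ∀ m, Continuous fun x => q x m)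
    (r : PowerSumRing) :
    Continuous fun x => dirDeriv (p x) (q x) r := by
  induction r using MvPolynomial.induction_on with
  | C a => simpa using continuous_const
  | add r s hr hs => simpa [dirDeriv_add] using hr.fun_add hs
  | mul_X r n hr =>
    simp only [dirDeriv_mul_X]
    exact ((continuous_aeval hp r).mul (hq n)).add ((hp n).mul hr)

/-- The Schwinger-Dyson equations for a linear functional on `PowerSumRing`. -/
def SchwingerDyson (Φ : PowerSumRing → ℂ) : Prop :=
  ∀ (k : ℤ) (r : PowerSumRing), Φ (shiftDeriv k r + loopTermInt k * r) = 0

/-- The equations for negative k are the complex conjugates of those for positive k. -/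
lemma schwingerDyson_of_nat {Φ : PowerSumRing →ₗ[ℂ] ℂ}
    (hconj : ∀ r, Φ (conj r) = starRingEnd ℂ (Φ r))
    (h : ∀ (k : ℕ) (r : PowerSumRing), Φ (shiftDeriv k r + loopTerm k * r) = 0) :
    SchwingerDyson Φ := by
  intro k r
  by_cases hk : 0 ≤ k
  · lift k to ℕ using hk
    simpa [loopTermInt] using h k r
  · obtain ⟨n, rfl⟩ : ∃ n : ℕ, k = -(n : ℤ) := ⟨(-k).toNat, by omega⟩
    have h1 := h n (conj r)
    rw [← map_eq_zero (starRingEnd ℂ), ← hconj, map_add, conj_shiftDeriv, map_mul, conj_conj] at h1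
    rw [loopTermInt, if_neg hk]
    rw [← neg_eq_zero, ← map_neg, ← h1]
    congr 1
    simp
    ring

/-- The operator `∑_{k ∈ K} k (δ_k + c_k) ∂_k`. -/
noncomputable def laplace (K : Finset ℤ) (r : PowerSumRing) : PowerSumRing :=
  ∑ k ∈ K, (k : ℂ) • (shiftDeriv k (pderiv k r) + loopTermInt k * pderiv k r)

lemma SchwingerDyson.map_laplace {Φ : PowerSumRing →ₗ[ℂ] ℂ} (h : SchwingerDyson Φ)
    (K : Finset ℤ) (r : PowerSumRing) : Φ (laplace K r) = 0 := by
  rw [laplace, map_sum]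
  exact Finset.sum_eq_zero fun k _ => by rw [map_smul, h, smul_zero]

/-- Green's formula: the Schwinger-Dyson equation for q ∂_k r, expanded by Leibniz, moves the
derivation onto q. -/
lemma SchwingerDyson.map_mul_laplace {Φ : PowerSumRing →ₗ[ℂ] ℂ} (h : SchwingerDyson Φ)
    (K : Finset ℤ) (q r : PowerSumRing) :
    Φ (q * laplace K r) = -Φ (∑ k ∈ K, (k : ℂ) • (pderiv k r * shiftDeriv k q)) := by
  rw [laplace, Finset.mul_sum, map_sum, map_sum, ← Finset.sum_neg_distrib]
  refine Finset.sum_congr rfl fun k _ => ?_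
  have h1 := h k (q * pderiv k r)
  rw [mul_smul_comm, map_smul, map_smul, ← smul_neg]
  congr 1
  rw [eq_neg_iff_add_eq_zero, ← map_add, ← h1, Derivation.leibniz]
  congr 1
  simp only [smul_eq_mul]
  ring

/-- The span of the products `X k₁ ⋯ X kₙ` with `∑ |kᵢ| ≤ a`. -/
noncomputable def filtration (a : ℤ) : Submodule ℂ PowerSumRing :=
  Submodule.span ℂ {r | ∃ l : List ℤ, (l.map fun k => |k|).sum ≤ a ∧ r = (l.map X).prod}

lemma prod_mem_filtration {a : ℤ} (l : List ℤ) (h : (l.map fun k => |k|).sum ≤ a) :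
    (l.map X).prod ∈ filtration a := Submodule.subset_span ⟨l, h, rfl⟩

lemma X_mem_filtration (k : ℤ) : X k ∈ filtration |k| := by
  simpa using prod_mem_filtration (a := |k|) [k] (by simp)

lemma one_mem_filtration {a : ℤ} (ha : 0 ≤ a) : 1 ∈ filtration a := by
  simpa using prod_mem_filtration (a := a) [] (by simpa)

lemma filtration_mono {a b : ℤ} (h : a ≤ b) : filtration a ≤ filtration b :=
  Submodule.span_mono fun _ ⟨l, hl, e⟩ => ⟨l, hl.trans h, e⟩

lemma mul_mem_filtration {a b : ℤ} {r s : PowerSumRing} (hr : r ∈ filtration a)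
    (hs : s ∈ filtration b) : r * s ∈ filtration (a + b) := by
  have : filtration a * filtration b ≤ filtration (a + b) := by
    rw [filtration, filtration, Submodule.span_mul_span]
    refine Submodule.span_mono ?_
    rintro _ ⟨_, ⟨l, hl, rfl⟩, _, ⟨m, hm, rfl⟩, rfl⟩
    exact ⟨l ++ m, by simp; omega, by simp⟩
  exact this (Submodule.mul_mem_mul hr hs)

lemma mem_filtration_of_linear {a b : ℤ} (D : PowerSumRing →ₗ[ℂ] PowerSumRing)
    (h : ∀ l : List ℤ, (l.map fun k => |k|).sum ≤ a → D (l.map X).prod ∈ filtration b)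
    {r : PowerSumRing} (hr : r ∈ filtration a) : D r ∈ filtration b := by
  have : filtration a ≤ (filtration b).comap D := Submodule.span_le.mpr (by
    rintro _ ⟨l, hl, rfl⟩
    exact h l hl)
  exact this hr

lemma pderiv_mem_filtration (k : ℤ) {a : ℤ} {r : PowerSumRing} (hr : r ∈ filtration a) :
    pderiv k r ∈ filtration (a - |k|) := by
  refine mem_filtration_of_linear (pderiv k : Derivation ℂ _ _).toLinearMap (fun l => ?_) hr
  simp only [Derivation.coeFn_coe]
  clear hr r
  induction l generalizing a with
  | nil => intro _; simp
  | cons m l ih =>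
    intro hl
    simp only [List.map_cons, List.sum_cons] at hl
    rw [List.map_cons, List.prod_cons, Derivation.leibniz, smul_eq_mul, smul_eq_mul]
    refine Submodule.add_mem _ ?_ ?_
    · have := mul_mem_filtration (X_mem_filtration m) (ih (a := a - |m|) (by omega))
      rwa [show |m| + (a - |m| - |k|) = a - |k| by ring] at this
    · by_cases hmk : m = k
      · subst hmk
        rw [pderiv_X_self, mul_one]
        exact prod_mem_filtration _ (by omega)
      · rw [pderiv_X_of_ne hmk, mul_zero]
        exact Submodule.zero_mem _

lemma shiftDeriv_mem_filtration (k : ℤ) {a : ℤ} {r : PowerSumRing} (hr : r ∈ filtration a) :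
    shiftDeriv k r ∈ filtration (a + |k|) := by
  refine mem_filtration_of_linear (shiftDeriv k : Derivation ℂ _ _).toLinearMap (fun l => ?_) hr
  simp only [Derivation.coeFn_coe]
  clear hr r
  induction l generalizing a with
  | nil => intro _; simp
  | cons m l ih =>
    intro hl
    simp only [List.map_cons, List.sum_cons] at hl
    rw [List.map_cons, List.prod_cons, Derivation.leibniz, smul_eq_mul, smul_eq_mul]
    refine Submodule.add_mem _ ?_ ?_
    · have := mul_mem_filtration (X_mem_filtration m) (ih (a := a - |m|) (by omega))
      rwa [show |m| + (a - |m| + |k|) = a + |k| by ring] at this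
    · rw [shiftDeriv_X, mul_smul_comm]
      refine Submodule.smul_mem _ _ ?_
      have := mul_mem_filtration (prod_mem_filtration (a := a - |m|) l (by omega))
        (X_mem_filtration (k + m))
      exact filtration_mono (by have := abs_add_le k m; omega) this

lemma loopTerm_mem_filtration (k : ℕ) : loopTerm k ∈ filtration k := by
  refine Submodule.sum_mem _ fun l hl => ?_
  have hl' := Finset.mem_range.mp hl
  refine filtration_mono ?_ (mul_mem_filtration (X_mem_filtration _) (X_mem_filtration _))
  rw [abs_of_nonneg (by omega), abs_of_nonneg (by omega)]
  omega

lemma loopTermInt_mem_filtration (k : ℤ) : loopTermInt k ∈ filtration |k| := by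
  rw [loopTermInt]
  split_ifs with hk
  · exact filtration_mono (by rw [abs_of_nonneg hk]; omega) (loopTerm_mem_filtration _)
  · refine Submodule.neg_mem _ ?_
    rw [loopTerm, map_sum]
    refine Submodule.sum_mem _ fun l hl => ?_
    have hl' := Finset.mem_range.mp hl
    rw [map_mul, conj_X, conj_X]
    refine filtration_mono ?_ (mul_mem_filtration (X_mem_filtration _) (X_mem_filtration _))
    rw [abs_neg, abs_neg, abs_of_nonneg (by omega), abs_of_nonneg (by omega),
      abs_of_neg (by omega)]
    omega

/-- ∂_k lowers the weight by |k|, while the shift and the loop term raise it by at most |k|. So the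
operator acts within each level, and the decomposition below becomes a finite-dimensional problem.
-/
lemma laplace_mem_filtration (K : Finset ℤ) {a : ℤ} {r : PowerSumRing} (hr : r ∈ filtration a) :
    laplace K r ∈ filtration a := by
  refine Submodule.sum_mem _ fun k _ => Submodule.smul_mem _ _ (Submodule.add_mem _ ?_ ?_)
  · have := shiftDeriv_mem_filtration k (pderiv_mem_filtration k hr)
    rwa [sub_add_cancel] at this
  · have := mul_mem_filtration (loopTermInt_mem_filtration k) (pderiv_mem_filtration k hr)
    rwa [add_sub_cancel] at this

lemma exists_mem_filtration (r : PowerSumRing) : ∃ n : ℕ, r ∈ filtration n := by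
  induction r using MvPolynomial.induction_on with
  | C a =>
    refine ⟨0, ?_⟩
    rw [← mul_one (C a), ← smul_eq_C_mul]
    exact Submodule.smul_mem _ _ (one_mem_filtration (by simp))
  | add p q hp hq =>
    obtain ⟨n, hn⟩ := hp
    obtain ⟨m, hm⟩ := hq
    exact ⟨n + m, Submodule.add_mem _ (filtration_mono (by simp) hn)
      (filtration_mono (by simp) hm)⟩
  | mul_X p k hp =>
    obtain ⟨n, hn⟩ := hp
    exact ⟨n + k.natAbs, by simpa using mul_mem_filtration hn (X_mem_filtration k)⟩

/-- The gradient formula `q(p) ↦ ∑_k k p_k' ∂_k q` for `dirDeriv`. -/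
lemma dirDeriv_eq_sum_pderiv {K : Finset ℤ} (p d : ℤ → ℂ) {r : PowerSumRing} (hr : r.vars ⊆ K) :
    dirDeriv p d r = ∑ k ∈ K, d k * aeval p (pderiv k r) := by
  have hmem : r ∈ supported ℂ (K : Set ℤ) := mem_supported.mpr (by exact_mod_cast hr)
  rw [supported] at hmem
  refine Algebra.adjoin_induction (p := fun r _ =>
    dirDeriv p d r = ∑ k ∈ K, d k * aeval p (pderiv k r)) ?_ ?_ ?_ ?_ hmem
  · rintro _ ⟨m, hm, rfl⟩
    rw [dirDeriv_X, Finset.sum_eq_single_of_mem m hm]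
    · simp
    · intro k _ hk
      rw [pderiv_X_of_ne hk.symm]; simp
  · intro a
    simp [algebraMap_eq]
  · intro a b _ _ ha hb
    rw [dirDeriv_add, ha, hb, ← Finset.sum_add_distrib]
    exact Finset.sum_congr rfl fun k _ => by simp [mul_add]
  · intro a b _ _ ha hb
    rw [dirDeriv_mul, ha, hb, Finset.mul_sum, Finset.mul_sum, ← Finset.sum_add_distrib]
    refine Finset.sum_congr rfl fun k _ => ?_
    rw [Derivation.leibniz]
    simp
    ring

end PowerSumRing

end

/-! ### Derivatives along translations in the unitary group -/

section

lemma continuous_integrable_of_compact {G : Type*} [TopologicalSpace G] [CompactSpace G]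
    [MeasurableSpace G] [BorelSpace G] {μ : Measure G} [IsFiniteMeasure μ] {f : G → ℂ}
    (hf : Continuous f) : Integrable f μ := by
  obtain ⟨C, hC⟩ := isCompact_univ.exists_bound_of_continuousOn hf.continuousOn
  exact Integrable.of_bound hf.aestronglyMeasurable C (Eventually.of_forall fun x => hC x trivial)

/-- On a compact group, derivatives along one-parameter translations integrate to zero. -/
lemma integral_eq_zero_of_hasDerivAt_translate {G : Type*} [Group G] [TopologicalSpace G]
    [IsTopologicalGroup G] [CompactSpace G] [MeasurableSpace G] [BorelSpace G] {μ : Measure G}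
    [IsFiniteMeasure μ] [μ.IsMulLeftInvariant] {f f' : G → ℂ} (hf : Continuous f)
    (hf' : Continuous f') (γ : ℝ → G) (hγ0 : γ 0 = 1)
    (hγ : ∀ x ε, HasDerivAt (fun ε => f (γ ε * x)) (f' (γ ε * x)) ε) :
    ∫ x, f' x ∂μ = 0 := by
  obtain ⟨C, hC⟩ := isCompact_univ.exists_bound_of_continuousOn hf'.continuousOn
  have key := (hasDerivAt_integral_of_dominated_loc_of_deriv_le (𝕜 := ℝ) (x₀ := 0) (μ := μ)
    (s := Set.univ) univ_mem (F := fun ε x => f (γ ε * x)) (F' := fun ε x => f' (γ ε * x))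
    (bound := fun _ => C)
    (Eventually.of_forall fun ε => (hf.comp (continuous_const_mul (γ ε))).aestronglyMeasurable)
    (continuous_integrable_of_compact (hf.comp (continuous_const_mul (γ 0))))
    (hf'.comp (continuous_const_mul (γ 0))).aestronglyMeasurable
    (Eventually.of_forall fun x ε _ => hC _ trivial) (integrable_const C)
    (Eventually.of_forall fun x ε _ => hγ x ε)).2
  -- By left invariance the integral of f(γ(ε) x) does not depend on ε, so its derivative at 0,
  -- which is ∫ f', is zero.
  simp only [integral_mul_left_eq_self f, hγ0, one_mul] at key
  exact key.unique (hasDerivAt_const 0 _)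

lemma hasDerivAt_matrix_mul {n : Type*} [Fintype n] {M L : ℝ → Matrix n n ℂ} {M' L' : Matrix n n ℂ}
    {t : ℝ} (hM : ∀ i j, HasDerivAt (fun s => M s i j) (M' i j) t)
    (hL : ∀ i j, HasDerivAt (fun s => L s i j) (L' i j) t) (i j : n) :
    HasDerivAt (fun s => (M s * L s) i j) ((M' * L t + M t * L') i j) t := by
  simp only [Matrix.mul_apply, Matrix.add_apply, ← Finset.sum_add_distrib]
  exact HasDerivAt.fun_sum fun k _ => (hM i k).fun_mul (hL k j)

section MatrixCalculus
variable {n : Type*} [Fintype n] [DecidableEq n]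

lemma hasDerivAt_matrix_pow {M : ℝ → Matrix n n ℂ} {Y : Matrix n n ℂ} {t : ℝ}
    (hM : ∀ i j, HasDerivAt (fun s => M s i j) ((Y * M t) i j) t) (k : ℕ) (i j : n) :
    HasDerivAt (fun s => (M s ^ k) i j)
      ((∑ l ∈ Finset.range k, M t ^ l * Y * M t ^ (k - l)) i j) t := by
  induction k generalizing i j with
  | zero => simpa using hasDerivAt_const t _
  | succ k ih =>
    simp only [pow_succ']
    refine (hasDerivAt_matrix_mul hM ih i j).congr_deriv ?_
    refine congrFun (congrFun ?_ i) j
    rw [Finset.sum_range_succ', Finset.mul_sum, add_comm]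
    refine congrArg₂ (· + ·) (Finset.sum_congr rfl fun l _ => ?_) ?_
    · rw [Nat.add_sub_add_right, pow_succ']
      simp only [mul_assoc]
    · rw [pow_zero, one_mul, Nat.sub_zero, pow_succ', mul_assoc]

lemma hasDerivAt_trace_mul_pow {M : ℝ → Matrix n n ℂ} {Y : Matrix n n ℂ} {t : ℝ}
    (hM : ∀ i j, HasDerivAt (fun s => M s i j) ((Y * M t) i j) t) (W : Matrix n n ℂ) (k : ℕ) :
    HasDerivAt (fun s => (W * M s ^ k).trace)
      (∑ l ∈ Finset.range k, (W * M t ^ l * Y * M t ^ (k - l)).trace) t := by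
  have h := HasDerivAt.fun_sum (u := Finset.univ) fun i _ =>
    hasDerivAt_matrix_mul (M' := 0) (fun i j => hasDerivAt_const t (W i j))
      (hasDerivAt_matrix_pow hM k) i i
  refine h.congr_deriv ?_
  rw [← Matrix.trace_sum]
  simp only [Matrix.trace, Matrix.diag_apply]
  refine Finset.sum_congr rfl fun i _ => ?_
  rw [zero_mul, zero_add, Finset.mul_sum]
  simp only [mul_assoc]

end MatrixCalculus

instance (N : ℕ) : (unitaryHaar N).IsMulLeftInvariant := by
  unfold unitaryHaar; infer_instance

instance (N : ℕ) : IsProbabilityMeasure (unitaryHaar N) :=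
  ⟨by
    have := Measure.haarMeasure_self (K₀ := (⊤ : TopologicalSpace.PositiveCompacts
      (Matrix.unitaryGroup (Fin N) ℂ)))
    simpa [unitaryHaar] using this⟩

section Unitary
variable {N : ℕ}

/-- `tr A ^ m` for `m ∈ ℤ`. -/
noncomputable def powerTrace (A : Matrix.unitaryGroup (Fin N) ℂ) (m : ℤ) : ℂ :=
  ((A ^ m : Matrix.unitaryGroup (Fin N) ℂ) : Matrix (Fin N) (Fin N) ℂ).trace

lemma coe_unitary_zpow_neg (A : Matrix.unitaryGroup (Fin N) ℂ) (m : ℤ) :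
    ((A ^ (-m) : Matrix.unitaryGroup (Fin N) ℂ) : Matrix (Fin N) (Fin N) ℂ) =
      ((A ^ m : Matrix.unitaryGroup (Fin N) ℂ) : Matrix (Fin N) (Fin N) ℂ).conjTranspose := by
  rw [zpow_neg, Matrix.UnitaryGroup.inv_val, Matrix.star_eq_conjTranspose]

lemma powerTrace_neg (A : Matrix.unitaryGroup (Fin N) ℂ) (m : ℤ) :
    powerTrace A (-m) = starRingEnd ℂ (powerTrace A m) := by
  rw [powerTrace, coe_unitary_zpow_neg, Matrix.trace_conjTranspose]
  rfl

lemma coe_unitary_zpow_natCast (A : Matrix.unitaryGroup (Fin N) ℂ) (k : ℕ) :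
    ((A ^ (k : ℤ) : Matrix.unitaryGroup (Fin N) ℂ) : Matrix (Fin N) (Fin N) ℂ) =
      (A : Matrix (Fin N) (Fin N) ℂ) ^ k := by
  rw [zpow_natCast]; rfl

lemma powerTrace_natCast (A : Matrix.unitaryGroup (Fin N) ℂ) (k : ℕ) :
    powerTrace A k = ((A : Matrix (Fin N) (Fin N) ℂ) ^ k).trace := by
  rw [powerTrace, coe_unitary_zpow_natCast]

lemma continuous_coe_unitary_zpow (m : ℤ) :
    Continuous fun A : Matrix.unitaryGroup (Fin N) ℂ =>
      ((A ^ m : Matrix.unitaryGroup (Fin N) ℂ) : Matrix (Fin N) (Fin N) ℂ) :=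
  continuous_subtype_val.comp (continuous_zpow m)

lemma continuous_powerTrace (m : ℤ) :
    Continuous fun A : Matrix.unitaryGroup (Fin N) ℂ => powerTrace A m :=
  (continuous_coe_unitary_zpow m).matrix_trace

/-- The one-parameter group `1 + (e^{iε} - 1) P` for an orthogonal projection `P`. -/
noncomputable def projRotation (P : Matrix (Fin N) (Fin N) ℂ) (h1 : P.conjTranspose = P)
    (h2 : P * P = P) (ε : ℝ) : Matrix.unitaryGroup (Fin N) ℂ :=
  ⟨1 + (Complex.exp (Complex.I * ε) - 1) • P, by
    rw [Matrix.mem_unitaryGroup_iff, Matrix.star_eq_conjTranspose, Matrix.conjTranspose_add,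
      Matrix.conjTranspose_smul, Matrix.conjTranspose_one, h1, add_mul, mul_add, mul_add, mul_one,
      mul_one, one_mul, smul_mul_smul_comm, h2, add_assoc, ← add_smul, ← add_smul]
    have h : Complex.exp (Complex.I * ε) * star (Complex.exp (Complex.I * ε)) = 1 := by
      change _ * (starRingEnd ℂ) _ = 1
      rw [Complex.mul_conj, Complex.normSq_eq_norm_sq, Complex.norm_exp]
      simp
    rw [show star (Complex.exp (Complex.I * ε) - 1) + ((Complex.exp (Complex.I * ε) - 1) +
      (Complex.exp (Complex.I * ε) - 1) * star (Complex.exp (Complex.I * ε) - 1)) =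
      0 by rw [star_sub, star_one]; linear_combination h]
    simp⟩

lemma projRotation_zero {P : Matrix (Fin N) (Fin N) ℂ} (h1 : P.conjTranspose = P) (h2 : P * P = P) : projRotation P h1 h2 0 = 1 := by
  ext1
  simp [projRotation]

lemma hasDerivAt_projRotation_mul {P : Matrix (Fin N) (Fin N) ℂ} (h1 : P.conjTranspose = P) (h2 : P * P = P)
    (A : Matrix.unitaryGroup (Fin N) ℂ) (ε : ℝ) (i j : Fin N) :
    HasDerivAt (fun ε => ((projRotation P h1 h2 ε * A : Matrix.unitaryGroup (Fin N) ℂ) :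
        Matrix (Fin N) (Fin N) ℂ) i j)
      (((Complex.I • P) * ((projRotation P h1 h2 ε * A : Matrix.unitaryGroup (Fin N) ℂ) :
        Matrix (Fin N) (Fin N) ℂ)) i j) ε := by
  have he : HasDerivAt (fun ε : ℝ => Complex.exp (Complex.I * ε))
      (Complex.exp (Complex.I * ε) * Complex.I) ε := by
    have := (((hasDerivAt_id (ε : ℂ)).const_mul Complex.I).cexp).comp_ofReal
    simpa using this
  have e1 : ∀ ε : ℝ, ((projRotation P h1 h2 ε * A : Matrix.unitaryGroup (Fin N) ℂ) :
      Matrix (Fin N) (Fin N) ℂ) i j = (A : Matrix (Fin N) (Fin N) ℂ) i j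
        + (Complex.exp (Complex.I * ε) - 1) * (P * (A : Matrix (Fin N) (Fin N) ℂ)) i j := by
    intro ε
    simp [projRotation, add_mul]
  simp only [e1]
  refine (((he.sub_const 1).mul_const _).const_add _).congr_deriv ?_
  have e2 : (Complex.I • P) * ((projRotation P h1 h2 ε * A : Matrix.unitaryGroup (Fin N) ℂ) :
      Matrix (Fin N) (Fin N) ℂ) =
      (Complex.exp (Complex.I * ε) * Complex.I) • (P * (A : Matrix (Fin N) (Fin N) ℂ)) := by
    rw [Matrix.UnitaryGroup.mul_val, ← mul_assoc, projRotation, smul_mul_assoc, mul_add, mul_one,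
      mul_smul_comm, h2, smul_mul_assoc, add_mul, smul_mul_assoc, smul_add, smul_smul, ← add_smul]
    congr 1
    ring
  rw [e2]
  simp

/-- For m ≥ 0 cyclicity of the trace makes all m terms of the product rule equal. Negative m follow
by conjugation. -/
lemma hasDerivAt_powerTrace_projRotation_mul {P : Matrix (Fin N) (Fin N) ℂ} (h1 : P.conjTranspose = P) (h2 : P * P = P)
    (A : Matrix.unitaryGroup (Fin N) ℂ) (ε : ℝ) (m : ℤ) :
    HasDerivAt (fun ε => powerTrace (projRotation P h1 h2 ε * A) m)
      (m * (((Complex.I • P) * (((projRotation P h1 h2 ε * A) ^ m : Matrix.unitaryGroup (Fin N) ℂ) :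
        Matrix (Fin N) (Fin N) ℂ)).trace)) ε := by
  have hnat : ∀ k : ℕ, HasDerivAt (fun ε => powerTrace (projRotation P h1 h2 ε * A) k)
      (k * (((Complex.I • P) * (((projRotation P h1 h2 ε * A) ^ (k : ℤ) :
        Matrix.unitaryGroup (Fin N) ℂ) : Matrix (Fin N) (Fin N) ℂ)).trace)) ε := by
    intro k
    simp only [powerTrace_natCast, coe_unitary_zpow_natCast]
    have := hasDerivAt_trace_mul_pow (hasDerivAt_projRotation_mul h1 h2 A ε) 1 k
    simp only [one_mul] at this
    refine this.congr_deriv ?_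
    rw [Finset.sum_congr rfl (g := fun _ => ((Complex.I • P) * ((projRotation P h1 h2 ε * A :
      Matrix.unitaryGroup (Fin N) ℂ) : Matrix (Fin N) (Fin N) ℂ) ^ k).trace)]
    · simp
    · intro l hl
      rw [mul_assoc, Matrix.trace_mul_comm, mul_assoc, ← pow_add]
      congr 3
      have := Finset.mem_range.mp hl
      omega
  obtain ⟨k, rfl | rfl⟩ := m.eq_nat_or_neg
  · exact_mod_cast hnat k
  · have h := (hnat k).star
    simp only [powerTrace_neg]
    refine h.congr_deriv ?_
    rw [coe_unitary_zpow_neg, star_mul', ← Matrix.trace_conjTranspose, Matrix.conjTranspose_mul,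
      Matrix.trace_mul_comm, Matrix.conjTranspose_smul, h1]
    simp

end Unitary

end

/-! ### Schwinger-Dyson equations for Haar measure -/

section

open PowerSumRing MvPolynomial

section HaarSchwingerDyson
variable {N : ℕ}

/-- The derivative at `A`, in the direction `Y`, of `tr (W A ^ k) r(A)`. -/
noncomputable def loopDeriv (k : ℕ) (r : PowerSumRing) (Y W : Matrix (Fin N) (Fin N) ℂ)
    (A : Matrix.unitaryGroup (Fin N) ℂ) : ℂ :=
  (∑ l ∈ Finset.range k, (W * (A : Matrix (Fin N) (Fin N) ℂ) ^ l * Y *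
      (A : Matrix (Fin N) (Fin N) ℂ) ^ (k - l)).trace) * aeval (powerTrace A) r +
    (W * (A : Matrix (Fin N) (Fin N) ℂ) ^ k).trace *
      dirDeriv (powerTrace A) (fun m => m * (Y * ((A ^ m : Matrix.unitaryGroup (Fin N) ℂ) :
        Matrix (Fin N) (Fin N) ℂ)).trace) r

lemma continuous_trace_mul_pow (W : Matrix (Fin N) (Fin N) ℂ) (k : ℕ) :
    Continuous fun A : Matrix.unitaryGroup (Fin N) ℂ =>
      (W * (A : Matrix (Fin N) (Fin N) ℂ) ^ k).trace :=
  (continuous_const.mul (continuous_subtype_val.pow k)).matrix_trace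

lemma continuous_loopDeriv (k : ℕ) (r : PowerSumRing) (Y W : Matrix (Fin N) (Fin N) ℂ) :
    Continuous (loopDeriv k r Y W) := by
  refine Continuous.add (Continuous.mul (continuous_finsetSum _ fun l _ => ?_)
    (continuous_aeval continuous_powerTrace r)) (Continuous.mul (continuous_trace_mul_pow W k)
    (continuous_dirDeriv continuous_powerTrace (fun m => continuous_const.mul
      (continuous_const.mul (continuous_coe_unitary_zpow m)).matrix_trace) r))
  exact Continuous.matrix_trace (((continuous_const.mul (continuous_subtype_val.pow l)).mul
    continuous_const).mul (continuous_subtype_val.pow _))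

lemma loopDeriv_linear_combination (k : ℕ) (r : PowerSumRing) (a b : ℂ)
    (Y Y' W : Matrix (Fin N) (Fin N) ℂ) (A : Matrix.unitaryGroup (Fin N) ℂ) :
    loopDeriv k r (a • Y + b • Y') W A = a * loopDeriv k r Y W A + b * loopDeriv k r Y' W A := by
  have h := dirDeriv_sum_smul (Finset.univ : Finset (Fin 2)) ![a, b] (powerTrace A)
    ![fun m => m * (Y * ((A ^ m : Matrix.unitaryGroup (Fin N) ℂ) :
        Matrix (Fin N) (Fin N) ℂ)).trace, fun m => m * (Y' * ((A ^ m :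
        Matrix.unitaryGroup (Fin N) ℂ) : Matrix (Fin N) (Fin N) ℂ)).trace] r
  simp only [Fin.sum_univ_two, Matrix.cons_val_zero, Matrix.cons_val_one] at h
  simp only [loopDeriv, add_mul, mul_add, smul_mul_assoc, mul_smul_comm, Matrix.trace_add,
    Matrix.trace_smul, smul_eq_mul, Finset.sum_add_distrib, ← Finset.mul_sum]
  rw [show (fun m : ℤ => (m : ℂ) * (a * (Y * ((A ^ m : Matrix.unitaryGroup (Fin N) ℂ) :
      Matrix (Fin N) (Fin N) ℂ)).trace) + m * (b * (Y' * ((A ^ m :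
      Matrix.unitaryGroup (Fin N) ℂ) : Matrix (Fin N) (Fin N) ℂ)).trace)) =
      fun m : ℤ => a * (m * (Y * ((A ^ m : Matrix.unitaryGroup (Fin N) ℂ) :
      Matrix (Fin N) (Fin N) ℂ)).trace) + b * (m * (Y' * ((A ^ m :
      Matrix.unitaryGroup (Fin N) ℂ) : Matrix (Fin N) (Fin N) ℂ)).trace) by
      funext m; ring, h]
  ring

lemma integral_loopDeriv_linear_combination {k : ℕ} {r : PowerSumRing} (a b : ℂ)
    {Y Y' W : Matrix (Fin N) (Fin N) ℂ} (h : ∫ A, loopDeriv k r Y W A ∂(unitaryHaar N) = 0)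
    (h' : ∫ A, loopDeriv k r Y' W A ∂(unitaryHaar N) = 0) :
    ∫ A, loopDeriv k r (a • Y + b • Y') W A ∂(unitaryHaar N) = 0 := by
  simp only [loopDeriv_linear_combination]
  rw [integral_add, integral_const_mul, integral_const_mul, h, h']
  · simp
  · exact (continuous_integrable_of_compact (continuous_loopDeriv k r Y W)).const_mul _
  · exact (continuous_integrable_of_compact (continuous_loopDeriv k r Y' W)).const_mul _

/-- The curve 1 + (e^{iε} - 1)P = exp(iεP) stays in the group and has tangent iP. The derivative is
complex linear in the direction, so the factor i can be removed. -/
lemma integral_loopDeriv_proj {P : Matrix (Fin N) (Fin N) ℂ} (h1 : P.conjTranspose = P)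
    (h2 : P * P = P) (k : ℕ) (r : PowerSumRing) (W : Matrix (Fin N) (Fin N) ℂ) :
    ∫ A, loopDeriv k r P W A ∂(unitaryHaar N) = 0 := by
  have key : ∫ A, loopDeriv k r (Complex.I • P) W A ∂(unitaryHaar N) = 0 := by
    refine integral_eq_zero_of_hasDerivAt_translate (f := fun A : Matrix.unitaryGroup (Fin N) ℂ =>
      (W * (A : Matrix (Fin N) (Fin N) ℂ) ^ k).trace * aeval (powerTrace A) r)
      ((continuous_trace_mul_pow W k).mul (continuous_aeval continuous_powerTrace r))
      (continuous_loopDeriv k r _ W) (projRotation P h1 h2) (projRotation_zero h1 h2)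
      fun A ε => ?_
    exact ((hasDerivAt_trace_mul_pow (hasDerivAt_projRotation_mul h1 h2 A ε) W k).mul
      (hasDerivAt_aeval (hasDerivAt_powerTrace_projRotation_mul h1 h2 A ε) r))
  have := integral_loopDeriv_linear_combination (-Complex.I) 0 key key
  simpa [smul_smul] using this

/-- Polarisation: the orthogonal projections P₁ = (E_aa + E_bb + E_ab + E_ba)/2 and P₂ = (E_aa +
E_bb - iE_ab + iE_ba)/2 satisfy E_ab = P₁ + iP₂ - (1 + i)/2 · (E_aa + E_bb). Linear combinations of
projections thus reach every matrix unit. -/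
lemma integral_loopDeriv_single (a b : Fin N) (k : ℕ) (r : PowerSumRing)
    (W : Matrix (Fin N) (Fin N) ℂ) :
    ∫ A, loopDeriv k r (Matrix.single a b 1) W A ∂(unitaryHaar N) = 0 := by
  have hd : ∀ a : Fin N, ∫ A, loopDeriv k r (Matrix.single a a 1) W A ∂(unitaryHaar N) = 0 :=
    fun a => integral_loopDeriv_proj (by simp) (by simp) k r W
  by_cases hab : a = b
  · subst hab; exact hd a
  set E : Fin N → Fin N → Matrix (Fin N) (Fin N) ℂ := fun i j => Matrix.single i j 1
  have hc : ∀ i j, (E i j).conjTranspose = E j i := fun i j => by simp [E]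
  have hm : ∀ i j l, E i j * E j l = E i l := fun i j l => by simp [E]
  have hm0 : ∀ i j l m, j ≠ l → E i j * E l m = 0 := fun i j l m h => by simp [E, h]
  have p1 := integral_loopDeriv_proj
    (P := (1 / 2 : ℂ) • (E a a + E b b + E a b + E b a))
    (by simp [Matrix.conjTranspose_smul, Matrix.conjTranspose_add, hc]; abel_nf)
    (by
      simp only [smul_mul_smul_comm, mul_add, add_mul, hm, hm0 _ _ _ _ hab,
        hm0 _ _ _ _ (Ne.symm hab)]
      module) k r W
  have p2 := integral_loopDeriv_proj
    (P := (1 / 2 : ℂ) • E a a + (1 / 2 : ℂ) • E b b + (-(Complex.I / 2)) • E a b +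
      (Complex.I / 2) • E b a)
    (by
      simp only [Matrix.conjTranspose_smul, Matrix.conjTranspose_add, hc]
      have e1 : star (-(Complex.I / 2)) = Complex.I / 2 := by simp; ring
      have e2 : star (Complex.I / 2) = -(Complex.I / 2) := by simp [neg_div]
      have e3 : star (1 / 2 : ℂ) = 1 / 2 := by simp
      rw [e1, e2, e3]
      module)
    (by
      simp only [mul_add, add_mul, hm, hm0 _ _ _ _ hab,
        hm0 _ _ _ _ (Ne.symm hab), smul_mul_assoc, mul_smul_comm]
      match_scalars <;> ring_nf <;> (try rw [Complex.I_sq]) <;> norm_num) k r W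
  have p3 := integral_loopDeriv_linear_combination 1 Complex.I p1 p2
  have p4 := integral_loopDeriv_linear_combination 1 1 (hd a) (hd b)
  have p5 := integral_loopDeriv_linear_combination 1 (-(1 + Complex.I) / 2) p3 p4
  convert p5 using 4
  change E a b = (1 : ℂ) • ((1 : ℂ) • (1 / 2 : ℂ) • (E a a + E b b + E a b + E b a) +
    Complex.I • ((1 / 2 : ℂ) • E a a + (1 / 2 : ℂ) • E b b + (-(Complex.I / 2)) • E a b +
      (Complex.I / 2) • E b a)) +
    (-(1 + Complex.I) / 2) • ((1 : ℂ) • E a a + (1 : ℂ) • E b b)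
  match_scalars <;> ring_nf <;> (try rw [Complex.I_sq]) <;> norm_num

lemma trace_single_mul' (i j : Fin N) (S : Matrix (Fin N) (Fin N) ℂ) :
    (Matrix.single i j 1 * S).trace = S j i := by
  rw [Matrix.trace_single_mul]; simp

/-- Since tr(E_ba S E_ab T) = S_aa T_bb, summing over a and b splits the trace of A^k into products
of two traces: the loop term. In the derivative of r the same sum merges A^k with A^m into tr
A^{k+m}: the shift. -/
lemma sum_loopDeriv_single (k : ℕ) (r : PowerSumRing) (A : Matrix.unitaryGroup (Fin N) ℂ) :
    ∑ a, ∑ b, loopDeriv k r (Matrix.single a b 1) (Matrix.single b a 1) A =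
      aeval (powerTrace A) (shiftDeriv k r + loopTerm k * r) := by
  have h1 : ∀ (a b : Fin N) (S T : Matrix (Fin N) (Fin N) ℂ),
      (Matrix.single b a 1 * S * Matrix.single a b 1 * T).trace = S a a * T b b := by
    intro a b S T
    rw [mul_assoc, mul_assoc, trace_single_mul', Matrix.mul_apply,
      Finset.sum_eq_single_of_mem a (Finset.mem_univ _)]
    · simp
    · intro c _ hc
      simp [Matrix.single_mul_apply_of_ne, hc]
  simp only [loopDeriv, h1, trace_single_mul', Finset.sum_add_distrib]
  rw [map_add, add_comm, map_mul]
  congr 1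
  · rw [aeval_shiftDeriv]
    have h := dirDeriv_sum_smul (Finset.univ : Finset (Fin N × Fin N))
      (fun ab => ((A : Matrix (Fin N) (Fin N) ℂ) ^ k) ab.1 ab.2) (powerTrace A)
      (fun ab m => m * ((A ^ m : Matrix.unitaryGroup (Fin N) ℂ) :
        Matrix (Fin N) (Fin N) ℂ) ab.2 ab.1) r
    rw [Fintype.sum_prod_type] at h
    rw [← h]
    congr 1
    funext m
    rw [powerTrace, zpow_add, Matrix.UnitaryGroup.mul_val, coe_unitary_zpow_natCast,
      Fintype.sum_prod_type, Matrix.trace]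
    simp only [Matrix.diag_apply, Matrix.mul_apply, Finset.mul_sum]
    exact Finset.sum_congr rfl fun _ _ => Finset.sum_congr rfl fun _ _ => by ring
  · simp only [← Finset.sum_mul]
    congr 1
    rw [loopTerm, map_sum]
    simp only [map_mul, aeval_X]
    have h2 : ∀ l ∈ Finset.range k, powerTrace A l * powerTrace A (k - l) =
        ∑ a, ∑ b, ((A : Matrix (Fin N) (Fin N) ℂ) ^ l) a a *
          ((A : Matrix (Fin N) (Fin N) ℂ) ^ (k - l)) b b := by
      intro l hl
      have hl' := Finset.mem_range.mp hl
      rw [show (k : ℤ) - l = ((k - l : ℕ) : ℤ) by omega, powerTrace_natCast, powerTrace_natCast,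
        Matrix.trace, Matrix.trace, Finset.sum_mul_sum]
      rfl
    rw [Finset.sum_congr rfl h2, Finset.sum_comm (s := Finset.range k)]
    exact Finset.sum_congr rfl fun a _ => Finset.sum_comm

/-- Integration of the class function attached to `r` against Haar measure. -/
noncomputable def haarFunctional (N : ℕ) : PowerSumRing →ₗ[ℂ] ℂ where
  toFun r := ∫ A, aeval (powerTrace A) r ∂(unitaryHaar N)
  map_add' r s := by
    simp only [map_add]
    exact integral_add (continuous_integrable_of_compact (continuous_aeval continuous_powerTrace r))
      (continuous_integrable_of_compact (continuous_aeval continuous_powerTrace s))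
  map_smul' a r := by
    simp only [map_smul, smul_eq_mul, RingHom.id_apply]
    exact integral_const_mul _ _

lemma haarFunctional_apply (r : PowerSumRing) :
    haarFunctional N r = ∫ A, aeval (powerTrace A) r ∂(unitaryHaar N) := rfl

theorem schwingerDyson_haarFunctional (N : ℕ) : SchwingerDyson (haarFunctional N) := by
  refine schwingerDyson_of_nat (fun r => ?_) fun k r => ?_
  · simp only [haarFunctional_apply, aeval_conj (powerTrace_neg _)]
    exact integral_conj
  · simp only [haarFunctional_apply, ← sum_loopDeriv_single]
    rw [integral_finsetSum _ fun a _ => integrable_finsetSum _ fun b _ =>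
      continuous_integrable_of_compact (continuous_loopDeriv k r _ _)]
    refine Finset.sum_eq_zero fun a _ => ?_
    rw [integral_finsetSum _ fun b _ =>
      continuous_integrable_of_compact (continuous_loopDeriv k r _ _)]
    exact Finset.sum_eq_zero fun b _ => integral_loopDeriv_single a b k r _

end HaarSchwingerDyson

end

/-! ### Schwinger-Dyson equations for Weyl's density on the torus -/

section

open PowerSumRing MvPolynomial

noncomputable instance circleMeasurableSpace : MeasurableSpace Circle := borel _

instance circleBorelSpace : BorelSpace Circle := ⟨rfl⟩

/-- Normalised Haar measure on the circle. -/
noncomputable def circleHaar : Measure Circle := Measure.haarMeasure ⊤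

instance : circleHaar.IsMulLeftInvariant := by unfold circleHaar; infer_instance

instance : circleHaar.IsHaarMeasure := by unfold circleHaar; infer_instance

instance : IsProbabilityMeasure circleHaar :=
  ⟨by
    have := Measure.haarMeasure_self (K₀ := (⊤ : TopologicalSpace.PositiveCompacts Circle))
    simpa [circleHaar] using this⟩

/-- Normalised Haar measure on the torus. -/
noncomputable def torusHaar (N : ℕ) : Measure (Fin N → Circle) := Measure.pi fun _ => circleHaar

instance (N : ℕ) : IsProbabilityMeasure (torusHaar N) := by unfold torusHaar; infer_instance

instance (N : ℕ) : (torusHaar N).IsMulLeftInvariant := by unfold torusHaar; infer_instance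

instance (N : ℕ) : (torusHaar N).IsOpenPosMeasure := by unfold torusHaar; infer_instance

lemma continuous_coe_circle : Continuous fun z : Circle => (z : ℂ) := continuous_subtype_val

section TorusSchwingerDyson
variable {N : ℕ}

/-- The power sums `∑_j z_j ^ m`. -/
noncomputable def torusTrace (z : Fin N → Circle) (m : ℤ) : ℂ := ∑ j, (z j : ℂ) ^ m

lemma circle_coe_zpow_neg (z : Circle) (m : ℤ) :
    (z : ℂ) ^ (-m) = starRingEnd ℂ ((z : ℂ) ^ m) := by
  rw [← Circle.coe_zpow, ← Circle.coe_zpow, zpow_neg, Circle.coe_inv_eq_conj]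

lemma torusTrace_neg (z : Fin N → Circle) (m : ℤ) :
    torusTrace z (-m) = starRingEnd ℂ (torusTrace z m) := by
  simp only [torusTrace, map_sum, circle_coe_zpow_neg]

lemma continuous_circle_coe_zpow (j : Fin N) (m : ℤ) :
    Continuous fun z : Fin N → Circle => (z j : ℂ) ^ m := by
  simp only [← Circle.coe_zpow]
  exact continuous_coe_circle.comp ((continuous_zpow m).comp (continuous_apply j))

lemma continuous_torusTrace (m : ℤ) : Continuous fun z : Fin N → Circle => torusTrace z m :=
  continuous_finsetSum _ fun j _ => continuous_circle_coe_zpow j m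

/-- The squared modulus of the Vandermonde determinant, as a product over ordered pairs. -/
noncomputable def torusWeight (z : Fin N → Circle) : ℂ :=
  ∏ p ∈ Finset.univ.sigma fun i : Fin N => ({i}ᶜ : Finset (Fin N)), (1 - (z p.2 : ℂ) / z p.1)

lemma torusWeight_eq (z : Fin N → Circle) :
    torusWeight z = ((∏ i, ∏ j ∈ Finset.Ioi i, ‖(z j : ℂ) - z i‖ ^ 2 : ℝ) : ℂ) := by
  rw [torusWeight, Finset.prod_sigma]
  have := Finset.prod_prod_Ioi_mul_eq_prod_prod_off_diag fun j i : Fin N => 1 - (z j : ℂ) / z i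
  rw [← this]
  push_cast
  refine Finset.prod_congr rfl fun i _ => Finset.prod_congr rfl fun j _ => ?_
  have hi : (z i : ℂ) ≠ 0 := Circle.coe_ne_zero _
  have hj : (z j : ℂ) ≠ 0 := Circle.coe_ne_zero _
  rw [← Complex.mul_conj', map_sub, ← Circle.coe_inv_eq_conj, ← Circle.coe_inv_eq_conj,
    Circle.coe_inv, Circle.coe_inv]
  field_simp

lemma torusWeight_re (z : Fin N → Circle) : torusWeight z = ((torusWeight z).re : ℂ) := by
  rw [torusWeight_eq, Complex.ofReal_re]

lemma torusWeight_re_nonneg (z : Fin N → Circle) : 0 ≤ (torusWeight z).re := by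
  rw [torusWeight_eq, Complex.ofReal_re]
  exact Finset.prod_nonneg fun i _ => Finset.prod_nonneg fun j _ => by positivity

lemma continuous_circle_coe (j : Fin N) : Continuous fun z : Fin N → Circle => (z j : ℂ) :=
  continuous_coe_circle.comp (continuous_apply j)

lemma continuous_torusWeight : Continuous (torusWeight (N := N)) :=
  continuous_finsetProd _ fun p _ => continuous_const.sub
    ((continuous_circle_coe p.2).div (continuous_circle_coe p.1) fun _ => Circle.coe_ne_zero _)

/-- The derivative of `torusWeight` along the `j`-th coordinate. -/
noncomputable def torusWeightDeriv (j : Fin N) (z : Fin N → Circle) : ℂ :=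
  ∑ p ∈ Finset.univ.sigma fun i : Fin N => ({i}ᶜ : Finset (Fin N)),
    (∏ q ∈ (Finset.univ.sigma fun i : Fin N => ({i}ᶜ : Finset (Fin N))).erase p,
      (1 - (z q.2 : ℂ) / z q.1)) *
      (-((z p.2 : ℂ) / z p.1) * ((if p.2 = j then 1 else 0) - if p.1 = j then 1 else 0))

lemma continuous_torusWeightDeriv (j : Fin N) : Continuous (torusWeightDeriv j) :=
  continuous_finsetSum _ fun p _ => (continuous_finsetProd _ fun p _ => continuous_const.sub
    ((continuous_circle_coe p.2).div (continuous_circle_coe p.1) fun _ =>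
      Circle.coe_ne_zero _)).mul (((continuous_circle_coe p.2).div (continuous_circle_coe p.1)
      fun _ => Circle.coe_ne_zero _).neg.mul continuous_const)

/-- Rotation of the `j`-th coordinate. -/
noncomputable def coordRotation (j : Fin N) (ε : ℝ) : Fin N → Circle :=
  Pi.mulSingle j (Circle.exp ε)

lemma hasDerivAt_coordRotation_mul (j : Fin N) (z : Fin N → Circle) (ε : ℝ) (a : Fin N) :
    HasDerivAt (fun ε => (((coordRotation j ε * z) a : Circle) : ℂ))
      (Complex.I * ((if a = j then 1 else 0) * (((coordRotation j ε * z) a : Circle) : ℂ))) ε := by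
  by_cases h : a = j
  · subst h
    have he : HasDerivAt (fun ε : ℝ => Complex.exp (ε * Complex.I))
        (Complex.exp (ε * Complex.I) * Complex.I) ε := by
      have := (((hasDerivAt_id (ε : ℂ)).mul_const Complex.I).cexp).comp_ofReal
      simpa using this
    simp only [coordRotation, Pi.mul_apply, Pi.mulSingle_eq_same, Circle.coe_mul, Circle.coe_exp]
    refine (he.mul_const _).congr_deriv ?_
    simp
    ring
  · simp only [coordRotation, Pi.mul_apply, Pi.mulSingle_eq_of_ne h, one_mul, if_neg h, zero_mul,
      mul_zero]
    exact hasDerivAt_const _ _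

lemma hasDerivAt_coordRotation_mul_zpow (j : Fin N) (z : Fin N → Circle) (ε : ℝ) (a : Fin N)
    (m : ℤ) :
    HasDerivAt (fun ε => (((coordRotation j ε * z) a : Circle) : ℂ) ^ m)
      (Complex.I * (m * ((if a = j then 1 else 0) *
        (((coordRotation j ε * z) a : Circle) : ℂ) ^ m))) ε := by
  have hne : (((coordRotation j ε * z) a : Circle) : ℂ) ≠ 0 := Circle.coe_ne_zero _
  have h := (hasDerivAt_zpow m _ (Or.inl hne)).comp ε (hasDerivAt_coordRotation_mul j z ε a)
  refine h.congr_deriv ?_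
  rw [zpow_sub_one₀ hne]
  field_simp

lemma hasDerivAt_torusTrace (j : Fin N) (z : Fin N → Circle) (ε : ℝ) (m : ℤ) :
    HasDerivAt (fun ε => torusTrace (coordRotation j ε * z) m)
      (Complex.I * (m * (((coordRotation j ε * z) j : Circle) : ℂ) ^ m)) ε := by
  refine (HasDerivAt.fun_sum (u := Finset.univ)
    fun a _ => hasDerivAt_coordRotation_mul_zpow j z ε a m).congr_deriv ?_
  rw [← Finset.mul_sum, ← Finset.mul_sum]
  simp

lemma hasDerivAt_torusWeight (j : Fin N) (z : Fin N → Circle) (ε : ℝ) :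
    HasDerivAt (fun ε => torusWeight (coordRotation j ε * z))
      (Complex.I * torusWeightDeriv j (coordRotation j ε * z)) ε := by
  have h := HasDerivAt.fun_finsetProd (u := Finset.univ.sigma fun i : Fin N =>
    ({i}ᶜ : Finset (Fin N))) (fun p _ =>
      ((hasDerivAt_coordRotation_mul j z ε p.2).fun_div (hasDerivAt_coordRotation_mul j z ε p.1)
        (Circle.coe_ne_zero _)).const_sub 1)
  refine h.congr_deriv ?_
  rw [torusWeightDeriv, Finset.mul_sum]
  refine Finset.sum_congr rfl fun p _ => ?_
  rw [smul_eq_mul, mul_left_comm]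
  generalize ∏ q ∈ (Finset.univ.sigma fun i : Fin N => ({i}ᶜ : Finset (Fin N))).erase p,
    (1 - (((coordRotation j ε * z) q.2 : Circle) : ℂ) / ((coordRotation j ε * z) q.1 : Circle)) = Q
  have hne : (((coordRotation j ε * z) p.1 : Circle) : ℂ) ≠ 0 := Circle.coe_ne_zero _
  field_simp

/-- Along the field with speeds z_j^k, the factor 1 - z_j/z_i has logarithmic derivative z_j (z_i^k
- z_j^k)/(z_i - z_j), a geometric sum in z_i and z_j. These are the off-diagonal terms of the loop
term. The diagonal ones add up to k ∑ z_i^k, which is what differentiating the speeds themselves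
contributes. Erased products are used so that nothing is divided by z_i - z_j. -/
lemma sum_pow_mul_torusWeightDeriv (k : ℕ) (z : Fin N → Circle) :
    ∑ j, (z j : ℂ) ^ k * torusWeightDeriv j z + k * torusTrace z k * torusWeight z =
      aeval (torusTrace z) (loopTerm k) * torusWeight z := by
  have h1 : ∑ j, (z j : ℂ) ^ k * torusWeightDeriv j z =
      (∑ i, ∑ j ∈ ({i}ᶜ : Finset (Fin N)), ∑ l ∈ Finset.range k,
        (z i : ℂ) ^ l * (z j : ℂ) ^ (k - l)) * torusWeight z := by
    simp only [torusWeightDeriv, Finset.mul_sum]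
    rw [Finset.sum_comm, ← Finset.sum_sigma (Finset.univ) (fun i : Fin N => ({i}ᶜ : Finset (Fin N)))
      (fun p => ∑ l ∈ Finset.range k, (z p.1 : ℂ) ^ l * (z p.2 : ℂ) ^ (k - l)), Finset.sum_mul]
    refine Finset.sum_congr rfl fun p hp => ?_
    have h2 : ∀ j : Fin N, (z j : ℂ) ^ k * ((∏ q ∈ (Finset.univ.sigma fun i : Fin N =>
        ({i}ᶜ : Finset (Fin N))).erase p, (1 - (z q.2 : ℂ) / z q.1)) *
        (-((z p.2 : ℂ) / z p.1) * ((if p.2 = j then 1 else 0) - if p.1 = j then 1 else 0))) =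
        (∏ q ∈ (Finset.univ.sigma fun i : Fin N =>
        ({i}ᶜ : Finset (Fin N))).erase p, (1 - (z q.2 : ℂ) / z q.1)) * (-((z p.2 : ℂ) / z p.1)) *
        ((if p.2 = j then (z j : ℂ) ^ k else 0) - if p.1 = j then (z j : ℂ) ^ k else 0) := by
      intro j
      split_ifs <;> ring
    simp only [h2]
    rw [← Finset.mul_sum, Finset.sum_sub_distrib, Finset.sum_ite_eq, Finset.sum_ite_eq,
      torusWeight, ← Finset.mul_prod_erase _ _ hp]
    simp only [Finset.mem_univ, if_true]
    have hne : (z p.1 : ℂ) ≠ 0 := Circle.coe_ne_zero _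
    have h3 : ∑ l ∈ Finset.range k, (z p.1 : ℂ) ^ l * (z p.2 : ℂ) ^ (k - l) =
        z p.2 * ∑ l ∈ Finset.range k, (z p.1 : ℂ) ^ l * (z p.2 : ℂ) ^ (k - 1 - l) := by
      rw [Finset.mul_sum]
      refine Finset.sum_congr rfl fun l hl => ?_
      have := Finset.mem_range.mp hl
      rw [show k - l = k - 1 - l + 1 by omega, pow_succ]
      ring
    have h4 := (Commute.all (z p.1 : ℂ) (z p.2 : ℂ)).mul_geom_sum₂ k
    rw [h3]
    generalize ∏ q ∈ (Finset.univ.sigma fun i : Fin N => ({i}ᶜ : Finset (Fin N))).erase p,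
      (1 - (z q.2 : ℂ) / z q.1) = Q
    field_simp
    linear_combination (-Q) * h4
  have h5 : aeval (torusTrace z) (loopTerm k) = ∑ i, ∑ j, ∑ l ∈ Finset.range k,
      (z i : ℂ) ^ l * (z j : ℂ) ^ (k - l) := by
    rw [loopTerm, map_sum]
    have h6 : ∀ l ∈ Finset.range k, aeval (torusTrace z) (X (l : ℤ) * X ((k : ℤ) - l) : PowerSumRing) =
        ∑ i, ∑ j, (z i : ℂ) ^ l * (z j : ℂ) ^ (k - l) := by
      intro l hl
      have := Finset.mem_range.mp hl
      rw [map_mul, aeval_X, aeval_X, show (k : ℤ) - l = ((k - l : ℕ) : ℤ) by omega, torusTrace,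
        torusTrace, Finset.sum_mul_sum]
      simp only [zpow_natCast]
    rw [Finset.sum_congr rfl h6, Finset.sum_comm]
    exact Finset.sum_congr rfl fun a _ => Finset.sum_comm
  rw [h1, h5, ← add_mul]
  congr 1
  rw [torusTrace, Finset.mul_sum, ← Finset.sum_add_distrib]
  refine Finset.sum_congr rfl fun i _ => ?_
  rw [Fintype.sum_eq_add_sum_compl i (fun j => ∑ l ∈ Finset.range k,
      (z i : ℂ) ^ l * (z j : ℂ) ^ (k - l)), add_comm]
  congr 1
  rw [Finset.sum_congr rfl (g := fun _ => (z i : ℂ) ^ k)]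
  · simp
  · intro l hl
    have := Finset.mem_range.mp hl
    rw [← pow_add]
    congr 1
    omega

/-- Integration against the Weyl density on the torus. -/
noncomputable def torusFunctional (N : ℕ) : PowerSumRing →ₗ[ℂ] ℂ where
  toFun r := ∫ z, aeval (torusTrace z) r * torusWeight z ∂(torusHaar N)
  map_add' r s := by
    simp only [map_add, add_mul]
    exact integral_add (continuous_integrable_of_compact
      ((continuous_aeval continuous_torusTrace r).mul continuous_torusWeight))
      (continuous_integrable_of_compact
      ((continuous_aeval continuous_torusTrace s).mul continuous_torusWeight))
  map_smul' a r := by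
    simp only [map_smul, smul_eq_mul, RingHom.id_apply, mul_assoc]
    exact integral_const_mul _ _

lemma torusFunctional_apply (r : PowerSumRing) :
    torusFunctional N r = ∫ z, aeval (torusTrace z) r * torusWeight z ∂(torusHaar N) := rfl

theorem schwingerDyson_torusFunctional (N : ℕ) : SchwingerDyson (torusFunctional N) := by
  refine schwingerDyson_of_nat (fun r => ?_) fun k r => ?_
  · simp only [torusFunctional_apply, aeval_conj (torusTrace_neg _)]
    rw [← integral_conj]
    refine integral_congr_ae (Eventually.of_forall fun z => ?_)
    simp only
    rw [map_mul, torusWeight_re, Complex.conj_ofReal]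
  -- D j is, up to the factor i, the derivative of z_j^k · r · weight under rotation of the j-th
  -- coordinate. Each integrates to zero, and their sum over j is the k-th equation.
  · set D : Fin N → (Fin N → Circle) → ℂ := fun j z =>
      ((k * (z j : ℂ) ^ (k : ℤ)) * aeval (torusTrace z) r + (z j : ℂ) ^ (k : ℤ) *
        dirDeriv (torusTrace z) (fun m => m * (z j : ℂ) ^ m) r) * torusWeight z +
        (z j : ℂ) ^ (k : ℤ) * aeval (torusTrace z) r * torusWeightDeriv j z with hD
    have hcr := continuous_aeval continuous_torusTrace r (T := Fin N → Circle)
    have hc : ∀ j, Continuous (D j) := fun j =>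
      ((((continuous_const.mul (continuous_circle_coe_zpow j k)).mul hcr).add
        ((continuous_circle_coe_zpow j k).mul (continuous_dirDeriv continuous_torusTrace
        (fun m => continuous_const.mul (continuous_circle_coe_zpow j m)) r))).mul
        continuous_torusWeight).add (((continuous_circle_coe_zpow j k).mul hcr).mul
        (continuous_torusWeightDeriv j))
    have h0 : ∀ j, ∫ z, D j z ∂(torusHaar N) = 0 := by
      intro j
      have h1 : ∫ z, Complex.I * D j z ∂(torusHaar N) = 0 := by
        refine integral_eq_zero_of_hasDerivAt_translate (f := fun z : Fin N → Circle =>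
          (z j : ℂ) ^ (k : ℤ) * aeval (torusTrace z) r * torusWeight z)
          (((continuous_circle_coe_zpow j k).mul hcr).mul continuous_torusWeight)
          (continuous_const.mul (hc j)) (coordRotation j) (by simp [coordRotation]) fun z ε => ?_
        refine (((hasDerivAt_coordRotation_mul_zpow j z ε j k).fun_mul
          (hasDerivAt_aeval (hasDerivAt_torusTrace j z ε) r)).fun_mul
          (hasDerivAt_torusWeight j z ε)).congr_deriv ?_
        simp only [dirDeriv_const_mul, hD, if_true]
        push_cast
        ring
      rw [integral_const_mul] at h1
      exact (mul_eq_zero.mp h1).resolve_left Complex.I_ne_zero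
    have h2 : ∀ z, aeval (torusTrace z) (shiftDeriv k r + loopTerm k * r) * torusWeight z =
        ∑ j, D j z := by
      intro z
      have h3 := sum_pow_mul_torusWeightDeriv k z
      have h4 := dirDeriv_sum_smul (Finset.univ : Finset (Fin N))
        (fun j => (z j : ℂ) ^ (k : ℤ)) (torusTrace z) (fun j m => m * (z j : ℂ) ^ m) r
      have h5 : aeval (torusTrace z) (shiftDeriv k r) = ∑ j, (z j : ℂ) ^ (k : ℤ) *
          dirDeriv (torusTrace z) (fun m => m * (z j : ℂ) ^ m) r := by
        rw [aeval_shiftDeriv, ← h4]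
        congr 1
        funext m
        rw [torusTrace, Finset.mul_sum]
        refine Finset.sum_congr rfl fun j _ => ?_
        rw [zpow_add₀ (Circle.coe_ne_zero _)]
        ring
      have h6 : ∑ j, D j z = (∑ j, (z j : ℂ) ^ (k : ℤ) *
          dirDeriv (torusTrace z) (fun m => m * (z j : ℂ) ^ m) r) * torusWeight z +
          aeval (torusTrace z) r * (∑ j, (z j : ℂ) ^ k * torusWeightDeriv j z +
            k * torusTrace z k * torusWeight z) := by
        simp only [hD, torusTrace, Finset.mul_sum, Finset.sum_mul, mul_add, add_mul,
          ← Finset.sum_add_distrib, zpow_natCast]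
        exact Finset.sum_congr rfl fun j _ => by ring
      rw [h6, h3, map_add, map_mul, h5]
      ring
    rw [torusFunctional_apply]
    simp only [h2]
    rw [integral_finsetSum _ fun j _ => continuous_integrable_of_compact (hc j)]
    exact Finset.sum_eq_zero fun j _ => h0 j

end TorusSchwingerDyson

end

/-! ### Unitary diagonalisation -/

section

open PowerSumRing MvPolynomial

section Diagonalization
variable {N : ℕ}

/-- Diagonal unitary matrices. -/
noncomputable def diagUnitary (N : ℕ) : (Fin N → Circle) →* Matrix.unitaryGroup (Fin N) ℂ where
  toFun z := ⟨Matrix.diagonal fun j => (z j : ℂ), by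
    rw [Matrix.mem_unitaryGroup_iff, Matrix.star_eq_conjTranspose, Matrix.diagonal_conjTranspose,
      Matrix.diagonal_mul_diagonal, ← Matrix.diagonal_one]
    congr 1
    funext j
    change (z j : ℂ) * (starRingEnd ℂ) (z j : ℂ) = 1
    rw [Complex.mul_conj, Circle.normSq_coe, Complex.ofReal_one]⟩
  map_one' := by ext1; simp
  map_mul' z w := by
    ext1
    simp [Matrix.diagonal_mul_diagonal]

lemma coe_diagUnitary (z : Fin N → Circle) :
    (diagUnitary N z : Matrix (Fin N) (Fin N) ℂ) = Matrix.diagonal fun j => (z j : ℂ) := rfl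

lemma powerTrace_diagUnitary (z : Fin N → Circle) : powerTrace (diagUnitary N z) = torusTrace z := by
  funext m
  rw [powerTrace, ← map_zpow, coe_diagUnitary, Matrix.trace_diagonal, torusTrace]
  simp [Circle.coe_zpow]

lemma powerTrace_conj (V A : Matrix.unitaryGroup (Fin N) ℂ) :
    powerTrace (V * A * V⁻¹) = powerTrace A := by
  funext m
  rw [powerTrace, conj_zpow, Matrix.UnitaryGroup.mul_val, Matrix.trace_mul_comm,
    ← Matrix.UnitaryGroup.mul_val, ← mul_assoc, inv_mul_cancel, one_mul, powerTrace]

lemma charpoly_conj (V A : Matrix.unitaryGroup (Fin N) ℂ) :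
    ((V * A * V⁻¹ : Matrix.unitaryGroup (Fin N) ℂ) : Matrix (Fin N) (Fin N) ℂ).charpoly =
      (A : Matrix (Fin N) (Fin N) ℂ).charpoly := by
  rw [Matrix.UnitaryGroup.mul_val, Matrix.charpoly_mul_comm, ← Matrix.UnitaryGroup.mul_val,
    ← mul_assoc, inv_mul_cancel, one_mul]

instance : Infinite Circle := by
  refine Infinite.of_injective (fun n : ℕ => Circle.exp (1 / (n + 1))) fun m n h => ?_
  have hle : ∀ n : ℕ, -Real.pi < 1 / ((n : ℝ) + 1) ∧ 1 / ((n : ℝ) + 1) ≤ Real.pi := by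
    intro n
    have h0 : 0 < 1 / ((n : ℝ) + 1) := by positivity
    have h1 : 1 / ((n : ℝ) + 1) ≤ 1 := by
      rw [div_le_one (by positivity)]; linarith [n.cast_nonneg (α := ℝ)]
    have := Real.pi_gt_three
    constructor <;> linarith
  have h2 := congrArg (fun z : Circle => Complex.arg z) h
  simp only [Circle.arg_exp (hle m).1 (hle m).2, Circle.arg_exp (hle n).1 (hle n).2] at h2
  field_simp at h2
  exact_mod_cast (add_right_cancel h2).symm

lemma exists_circle_not_root {p : Polynomial ℂ} (hp : p ≠ 0) : ∃ w : Circle, p.eval (w : ℂ) ≠ 0 := by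
  by_contra! h
  have h1 : (Set.range fun w : Circle => (w : ℂ)).Infinite :=
    Set.infinite_range_of_injective Subtype.coe_injective
  refine h1 ((p.rootSet_finite ℂ).subset ?_)
  rintro _ ⟨w, rfl⟩
  rw [Polynomial.mem_rootSet]
  exact ⟨hp, by simpa using h w⟩

/-- Unitary matrices without eigenvalue `1` are unitarily diagonalizable (Cayley transform). -/
lemma exists_diagonalization_of_isUnit (B : Matrix.unitaryGroup (Fin N) ℂ)
    (hB : IsUnit (1 - (B : Matrix (Fin N) (Fin N) ℂ)).det) :
    ∃ (V : Matrix.unitaryGroup (Fin N) ℂ) (z : Fin N → Circle), B = V * diagUnitary N z * V⁻¹ := by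
  set b : Matrix (Fin N) (Fin N) ℂ := B.1 with hb
  have hbs : b.conjTranspose * b = 1 := Matrix.mem_unitaryGroup_iff'.mp B.2
  have hD : IsUnit (1 - b) := (Matrix.isUnit_iff_isUnit_det _).mpr hB
  -- Unitarity of B makes H = i(1 + B)(1 - B)⁻¹ Hermitian, and (H + i)B = H - i recovers B. So an
  -- orthonormal eigenbasis of H diagonalises B.
  set H : Matrix (Fin N) (Fin N) ℂ := Complex.I • ((1 + b) * (1 - b)⁻¹) with hH
  have hHD : H * (1 - b) = Complex.I • (1 + b) := by
    rw [hH, smul_mul_assoc, mul_assoc, Matrix.nonsing_inv_mul _ hB, mul_one]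
  clear_value H
  have hDs : IsUnit (1 - b).conjTranspose := by
    rw [Matrix.isUnit_iff_isUnit_det, Matrix.det_conjTranspose]
    exact hB.star
  have hherm : H.IsHermitian := by
    have h1 : (1 - b).conjTranspose * (H.conjTranspose * (1 - b)) =
        (1 - b).conjTranspose * (H * (1 - b)) := by
      have h2 : (1 - b).conjTranspose * H.conjTranspose =
          (-Complex.I) • (1 + b).conjTranspose := by
        rw [← Matrix.conjTranspose_mul, hHD, Matrix.conjTranspose_smul]
        simp
      rw [← mul_assoc, h2, hHD]
      simp only [Matrix.conjTranspose_add, Matrix.conjTranspose_sub, Matrix.conjTranspose_one,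
        mul_smul_comm, smul_mul_assoc, add_mul, sub_mul, mul_add, mul_sub, one_mul, mul_one, hbs]
      module
    have h3 := hDs.mul_left_cancel h1
    exact hD.mul_right_cancel h3
  have hrel : (H + Complex.I • 1) * b = H - Complex.I • 1 := by
    rw [mul_sub, mul_one, smul_add] at hHD
    rw [add_mul, smul_mul_assoc, one_mul]
    have : H = H * b + (Complex.I • (1 : Matrix (Fin N) (Fin N) ℂ) + Complex.I • b) := by
      rw [← hHD]; abel
    conv_rhs => rw [this]
    abel
  set U := hherm.eigenvectorUnitary with hU
  set d : Fin N → ℝ := hherm.eigenvalues with hd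
  have hspec : H = (U : Matrix (Fin N) (Fin N) ℂ) * Matrix.diagonal (fun j => (d j : ℂ)) *
      ((U⁻¹ : Matrix.unitaryGroup (Fin N) ℂ) : Matrix (Fin N) (Fin N) ℂ) := by
    have := hherm.spectral_theorem
    rw [Unitary.conjStarAlgAut_apply] at this
    exact this
  have hUU : ((U⁻¹ : Matrix.unitaryGroup (Fin N) ℂ) : Matrix (Fin N) (Fin N) ℂ) * U = 1 := by
    rw [← Matrix.UnitaryGroup.mul_val, inv_mul_cancel, Matrix.UnitaryGroup.one_val]
  have hUU' : (U : Matrix (Fin N) (Fin N) ℂ) * ((U⁻¹ : Matrix.unitaryGroup (Fin N) ℂ) :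
      Matrix (Fin N) (Fin N) ℂ) = 1 := by
    rw [← Matrix.UnitaryGroup.mul_val, mul_inv_cancel, Matrix.UnitaryGroup.one_val]
  set u : Matrix (Fin N) (Fin N) ℂ := U.1 with hu
  set v : Matrix (Fin N) (Fin N) ℂ := (U⁻¹ : Matrix.unitaryGroup (Fin N) ℂ).1 with hv
  set c : Matrix (Fin N) (Fin N) ℂ := v * b * u with hc
  have hdH : v * H * u = Matrix.diagonal (fun j => (d j : ℂ)) := by
    rw [hspec, mul_assoc, mul_assoc, mul_assoc, hUU, mul_one, ← mul_assoc, hUU, one_mul]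
  have hcrel : (Matrix.diagonal (fun j => (d j : ℂ)) + Complex.I • 1) * c =
      Matrix.diagonal (fun j => (d j : ℂ)) - Complex.I • 1 := by
    rw [← hdH, hc]
    have e1 : v * H * u + Complex.I • 1 = v * (H + Complex.I • 1) * u := by
      rw [mul_add, add_mul, mul_smul_comm, mul_one, smul_mul_assoc, hUU]
    have e2 : v * H * u - Complex.I • 1 = v * (H - Complex.I • 1) * u := by
      rw [mul_sub, sub_mul, mul_smul_comm, mul_one, smul_mul_assoc, hUU]
    rw [e1, e2, ← hrel]
    calc v * (H + Complex.I • 1) * u * (v * b * u)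
        = v * (H + Complex.I • 1) * (u * v) * b * u := by simp only [mul_assoc]
      _ = _ := by rw [hUU', mul_one]; simp only [mul_assoc]
  have hne : ∀ j, (d j : ℂ) + Complex.I ≠ 0 := fun j h => by
    have := congrArg Complex.im h
    simp at this
  have hcd : c = Matrix.diagonal fun j => ((d j : ℂ) - Complex.I) / (d j + Complex.I) := by
    ext i j
    have := congrFun (congrFun hcrel i) j
    rw [← Matrix.diagonal_one, ← Matrix.diagonal_smul, Matrix.diagonal_add, Matrix.diagonal_sub,
      Matrix.diagonal_mul] at this
    by_cases hij : i = j
    · subst hij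
      simp at this ⊢
      rw [eq_div_iff (hne i), mul_comm]
      exact this
    · rw [Matrix.diagonal_apply_ne _ hij] at this ⊢
      refine (mul_eq_zero.mp this).resolve_left ?_
      simpa using hne i
  have hnorm : ∀ j, ‖((d j : ℂ) - Complex.I) / (d j + Complex.I)‖ = 1 := fun j => by
    rw [norm_div, div_eq_one_iff_eq (norm_ne_zero_iff.mpr (hne j)), ← Complex.norm_conj]
    congr 1
    simp
  refine ⟨U, fun j => ⟨((d j : ℂ) - Complex.I) / (d j + Complex.I),
    mem_sphere_zero_iff_norm.mpr (hnorm j)⟩, ?_⟩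
  refine Subtype.ext ?_
  change b = u * Matrix.diagonal (fun j => ((d j : ℂ) - Complex.I) / (d j + Complex.I)) * v
  rw [← hcd, hc]
  calc b = (u * v) * b * (u * v) := by rw [hUU', one_mul, mul_one]
    _ = _ := by simp only [mul_assoc]

/-- Dividing by a unimodular scalar w that is not an eigenvalue removes the eigenvalue 1. Such w
exists because the circle is infinite and the spectrum is finite. -/
theorem exists_diagonalization (A : Matrix.unitaryGroup (Fin N) ℂ) :
    ∃ (V : Matrix.unitaryGroup (Fin N) ℂ) (z : Fin N → Circle), A = V * diagUnitary N z * V⁻¹ := by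
  obtain ⟨w, hw⟩ := exists_circle_not_root (A : Matrix (Fin N) (Fin N) ℂ).charpoly_monic.ne_zero
  set W := diagUnitary N fun _ => w
  have hWc : ∀ V : Matrix.unitaryGroup (Fin N) ℂ, W * V = V * W := fun V => by
    ext i j
    rw [Matrix.UnitaryGroup.mul_val, Matrix.UnitaryGroup.mul_val, coe_diagUnitary,
      Matrix.diagonal_mul, Matrix.mul_diagonal, mul_comm]
  obtain ⟨V, z, h⟩ := exists_diagonalization_of_isUnit (W⁻¹ * A) (by
    rw [isUnit_iff_ne_zero]
    rw [Matrix.eval_charpoly] at hw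
    intro h0
    apply hw
    have : Matrix.scalar (Fin N) (w : ℂ) - (A : Matrix (Fin N) (Fin N) ℂ) =
        (W : Matrix (Fin N) (Fin N) ℂ) * (1 - ((W⁻¹ * A : Matrix.unitaryGroup (Fin N) ℂ) :
          Matrix (Fin N) (Fin N) ℂ)) := by
      rw [mul_sub, mul_one, ← Matrix.UnitaryGroup.mul_val, mul_inv_cancel_left]
      rfl
    rw [this, Matrix.det_mul, h0, mul_zero])
  refine ⟨V, fun j => w * z j, ?_⟩
  have h2 : diagUnitary N (fun j => w * z j) = W * diagUnitary N z := by
    rw [← map_mul]; rfl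
  rw [h2, ← mul_assoc, ← hWc, mul_assoc, mul_assoc, ← mul_assoc V, ← h, mul_inv_cancel_left]

lemma exists_torusTrace_eq (A : Matrix.unitaryGroup (Fin N) ℂ) :
    ∃ z : Fin N → Circle, powerTrace A = torusTrace z := by
  obtain ⟨V, z, rfl⟩ := exists_diagonalization A
  exact ⟨z, by rw [powerTrace_conj, powerTrace_diagUnitary]⟩

end Diagonalization

end

/-! ### Haar moments and Weyl moments agree up to normalisation -/

section

open PowerSumRing MvPolynomial

section Decomposition
variable {N : ℕ}

lemma vars_subset_of_mem_filtration {n : ℕ} {r : PowerSumRing} (hr : r ∈ filtration n) :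
    r.vars ⊆ Finset.Icc (-n : ℤ) n := by
  have : filtration n ≤ (supported ℂ (Finset.Icc (-n : ℤ) n : Set ℤ)).toSubmodule := by
    refine Submodule.span_le.mpr ?_
    rintro _ ⟨l, hl, rfl⟩
    change _ ∈ supported ℂ (Finset.Icc (-n : ℤ) n : Set ℤ)
    have : ∀ a : ℤ, (l.map fun k => |k|).sum ≤ a → (l.map X).prod ∈
        supported ℂ (Finset.Icc (-a : ℤ) a : Set ℤ) := by
      induction l with
      | nil => intro a _; simp
      | cons k l ih =>
        intro a ha
        simp only [List.map_cons, List.sum_cons] at ha hl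
        have h0 : 0 ≤ (l.map fun k => |k|).sum := List.sum_nonneg (by simp)
        rw [List.map_cons, List.prod_cons]
        refine Subalgebra.mul_mem _ (X_mem_supported.mpr ?_) (ih (by
          linarith [abs_nonneg k]) a (by linarith [abs_nonneg k]))
        rw [Finset.coe_Icc, Set.mem_Icc]
        exact abs_le.mp (by linarith)
    exact this n hl
  have := mem_supported.mp (this hr)
  exact_mod_cast this

/-- Evaluation of a polynomial at the power sums, as a continuous function on the torus. -/
noncomputable def torusEval (N : ℕ) : PowerSumRing →ₐ[ℂ] C(Fin N → Circle, ℂ) :=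
  aeval fun m => ⟨fun z => torusTrace z m, continuous_torusTrace m⟩

lemma torusEval_apply (r : PowerSumRing) (z : Fin N → Circle) :
    torusEval N r z = aeval (torusTrace z) r := by
  induction r using MvPolynomial.induction_on with
  | C a => simp [torusEval]
  | add p q hp hq => simp only [map_add, ContinuousMap.add_apply, hp, hq]
  | mul_X r n hr =>
    simp only [map_mul, ContinuousMap.mul_apply, hr, aeval_X]
    simp [torusEval]

/-- A level of the filtration is itself infinite-dimensional, because X 0 has weight zero. On the
torus X 0 is the scalar N, which leaves words of length at most n in finitely many letters. -/
lemma finiteDimensional_map_torusEval (n : ℕ) :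
    FiniteDimensional ℂ ((filtration n).map (torusEval N).toLinearMap) := by
  set α := Finset.Icc (-n : ℤ) n
  set m : List α → C(Fin N → Circle, ℂ) := fun l => (l.map fun k => torusEval N (X k.1)).prod
  have hfin : (m '' {l | l.length ≤ n}).Finite := (List.finite_length_le α n).image m
  have key : ∀ l : List ℤ, (l.map fun k => |k|).sum ≤ n →
      ∃ (c : ℂ) (l' : List α), (l'.length : ℤ) ≤ (l.map fun k => |k|).sum ∧
        torusEval N (l.map X).prod = c • m l' := by
    intro l
    induction l with
    | nil => intro _; exact ⟨1, [], by simp, by simp [m]⟩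
    | cons k l ih =>
      intro hl
      simp only [List.map_cons, List.sum_cons] at hl
      have h0 : 0 ≤ (l.map fun k => |k|).sum := List.sum_nonneg (by simp)
      obtain ⟨c, l', hl', h⟩ := ih (by linarith [abs_nonneg k])
      by_cases hk : k = 0
      · refine ⟨N * c, l', by simpa [hk] using hl', ?_⟩
        rw [List.map_cons, List.prod_cons, map_mul, h, hk]
        ext z
        simp [torusEval, torusTrace]
        ring
      · refine ⟨c, ⟨k, Finset.mem_Icc.mpr (abs_le.mp (by linarith))⟩ :: l', ?_, ?_⟩
        · have := Int.one_le_abs hk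
          simp only [List.length_cons, List.map_cons, List.sum_cons]
          push_cast
          linarith
        · rw [List.map_cons, List.prod_cons, map_mul, h, mul_smul_comm]
          simp [m]
  have hle : (filtration n).map (torusEval N).toLinearMap ≤
      Submodule.span ℂ (m '' {l | l.length ≤ n}) := by
    rw [filtration, Submodule.map_span_le]
    rintro _ ⟨l, hl, rfl⟩
    obtain ⟨c, l', hl', h⟩ := key l hl
    rw [AlgHom.toLinearMap_apply, h]
    exact Submodule.smul_mem _ _ (Submodule.subset_span ⟨l', by
      have := hl'.trans hl; exact_mod_cast this, rfl⟩)
  have := FiniteDimensional.span_of_finite ℂ hfin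
  exact Submodule.finiteDimensional_of_le hle

/-- The set is a finite intersection of the open conditions z_i ≠ z_j. Each is dense since a small
rotation of one coordinate undoes a collision. -/
lemma dense_torusWeight_ne_zero : Dense {z : Fin N → Circle | torusWeight z ≠ 0} := by
  have h1 : {z : Fin N → Circle | torusWeight z ≠ 0} =
      ⋂ p : Fin N × Fin N, {z | p.1 ≠ p.2 → z p.1 ≠ z p.2} := by
    ext z
    simp only [torusWeight, ne_eq, Set.mem_ofPred_eq, Finset.prod_eq_zero_iff, not_exists, not_and,
      Set.mem_iInter, Prod.forall, Finset.mem_sigma, Finset.mem_univ, true_and, Finset.mem_compl,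
      Finset.mem_singleton, Sigma.forall]
    refine forall_congr' fun i => forall_congr' fun j => ?_
    rw [eq_comm (a := j), sub_eq_zero, eq_div_iff (Circle.coe_ne_zero _), one_mul]
    exact imp_congr_right fun _ => not_congr Circle.ext_iff.symm
  rw [h1]
  refine dense_iInter_of_isOpen (fun p => ?_) fun p => ?_
  · by_cases h : p.1 = p.2
    · simp [h]
    · simp only [ne_eq, h, not_false_eq_true, true_implies]
      exact isOpen_ne_fun (continuous_apply _) (continuous_apply _)
  · by_cases h : p.1 = p.2
    · simp [h]
    · simp only [ne_eq, h, not_false_eq_true, true_implies]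
      intro z
      by_cases hz : z p.1 = z p.2
      swap
      · exact subset_closure hz
      have hc : Tendsto (fun ε : ℝ => coordRotation p.1 ε * z) (𝓝[≠] 0) (𝓝 z) := by
        have : Continuous fun ε : ℝ => coordRotation p.1 ε * z := by
          refine Continuous.mul ?_ continuous_const
          exact (continuous_mulSingle p.1).comp Circle.exp.continuous
        have h2 := this.tendsto 0
        simp only [coordRotation, Circle.exp_zero, Pi.mulSingle_one, one_mul] at h2
        exact h2.mono_left nhdsWithin_le_nhds
      refine mem_closure_of_tendsto hc ?_
      have h3 : ∀ᶠ ε : ℝ in 𝓝[≠] 0, ε ∈ Set.Ioo (-Real.pi) Real.pi :=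
        mem_nhdsWithin_of_mem_nhds (Ioo_mem_nhds (by linarith [Real.pi_pos]) Real.pi_pos)
      filter_upwards [h3, self_mem_nhdsWithin] with ε hε hε0
      rw [Pi.mul_apply, Pi.mul_apply, coordRotation, Pi.mulSingle_eq_same,
        Pi.mulSingle_eq_of_ne (Ne.symm h), hz, mul_left_inj]
      intro he
      have h4 := congrArg (fun z : Circle => Complex.arg z) he
      simp only [Circle.arg_exp hε.1 hε.2.le] at h4
      simp at h4
      exact hε0 h4

/-- `∑_k k z_j ^ k ∂_k r`, the logarithmic derivative in the `j`-th coordinate. -/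
noncomputable def coordDeriv (j : Fin N) (r : PowerSumRing) (z : Fin N → Circle) : ℂ :=
  dirDeriv (torusTrace z) (fun m => m * (z j : ℂ) ^ m) r

lemma continuous_coordDeriv (j : Fin N) (r : PowerSumRing) : Continuous (coordDeriv j r) :=
  continuous_dirDeriv continuous_torusTrace
    (fun m => continuous_const.mul (continuous_circle_coe_zpow j m)) r

/-- Green's formula with first factor the conjugate of q: the pairing of q with its Laplacian is its
Dirichlet energy, hence nonnegative. -/
lemma torusFunctional_conj_mul_laplace {n : ℕ} {q : PowerSumRing} (hq : q ∈ filtration n) :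
    torusFunctional N (conj q * laplace (Finset.Icc (-n : ℤ) n) q) =
      ((∫ z, (∑ j, ‖coordDeriv j q z‖ ^ 2) * (torusWeight z).re ∂(torusHaar N) : ℝ) : ℂ) := by
  rw [(schwingerDyson_torusFunctional N).map_mul_laplace, torusFunctional_apply, ← integral_neg,
    ← integral_complex_ofReal]
  refine integral_congr_ae (Eventually.of_forall fun z => ?_)
  simp only
  rw [← neg_mul]
  push_cast
  rw [← torusWeight_re]
  congr 1
  have h1 : ∀ k : ℤ, aeval (torusTrace z) (shiftDeriv k (conj q)) =
      -∑ j, (z j : ℂ) ^ k * starRingEnd ℂ (coordDeriv j q z) := by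
    intro k
    have := conj_shiftDeriv (-k) q
    rw [neg_neg] at this
    rw [← neg_eq_iff_eq_neg, ← map_neg, ← this, aeval_conj (torusTrace_neg z), aeval_shiftDeriv]
    have h2 : (fun m : ℤ => (m : ℂ) * torusTrace z (-k + m)) =
        fun m : ℤ => ∑ j, (z j : ℂ) ^ (-k) * ((m : ℂ) * (z j : ℂ) ^ m) := by
      funext m
      rw [torusTrace, Finset.mul_sum]
      refine Finset.sum_congr rfl fun j _ => ?_
      rw [zpow_add₀ (Circle.coe_ne_zero _)]
      ring
    rw [h2, dirDeriv_sum_smul, map_sum]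
    refine Finset.sum_congr rfl fun j _ => ?_
    rw [map_mul, ← circle_coe_zpow_neg, neg_neg]
    rfl
  simp only [map_sum, map_smul, map_mul, h1, smul_eq_mul]
  have h3 : ∀ j, ((‖coordDeriv j q z‖ : ℂ)) ^ 2 = starRingEnd ℂ (coordDeriv j q z) *
      ∑ k ∈ Finset.Icc (-n : ℤ) n, (k * (z j : ℂ) ^ k) * aeval (torusTrace z) (pderiv k q) := by
    intro j
    rw [← dirDeriv_eq_sum_pderiv _ _ (vars_subset_of_mem_filtration hq), ← coordDeriv,
      Complex.conj_mul']
  simp only [h3, Finset.mul_sum, ← Finset.sum_neg_distrib]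
  rw [Finset.sum_comm]
  refine Finset.sum_congr rfl fun j _ => ?_
  refine Finset.sum_congr rfl fun k _ => ?_
  ring

/-- Any point is joined to 1 by a path (e^{i s θ_j})_j, along which the derivative of q is a linear
combination of the `coordDeriv j q`. -/
lemma torusEval_eq_const {q : PowerSumRing} (h : ∀ (j : Fin N) z, coordDeriv j q z = 0)
    (z : Fin N → Circle) : aeval (torusTrace z) q = aeval (torusTrace (1 : Fin N → Circle)) q := by
  obtain ⟨θ, rfl⟩ : ∃ θ : Fin N → ℝ, z = fun j => Circle.exp (θ j) :=
    ⟨fun j => Complex.arg (z j), funext fun j => (Circle.exp_arg _).symm⟩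
  set p : ℝ → Fin N → Circle := fun s j => Circle.exp (s * θ j)
  have hd : ∀ s, HasDerivAt (fun s => aeval (torusTrace (p s)) q) 0 s := by
    intro s
    have h1 : ∀ m : ℤ, HasDerivAt (fun s => torusTrace (p s) m)
        (∑ j, (Complex.I * θ j) * (m * (p s j : ℂ) ^ m)) s := by
      intro m
      refine HasDerivAt.fun_sum fun j _ => ?_
      have e : ∀ s : ℝ, ((p s j : Circle) : ℂ) ^ m = Complex.exp (m * (s * θ j * Complex.I)) := by
        intro s
        rw [Circle.coe_exp, ← Complex.exp_int_mul]
        push_cast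
        rfl
      simp only [e]
      have h2 := ((((hasDerivAt_id (s : ℂ)).mul_const ((θ j : ℂ))).mul_const
        Complex.I).const_mul (m : ℂ)).cexp.comp_ofReal
      refine h2.congr_deriv ?_
      simp
      ring
    refine (hasDerivAt_aeval h1 q).congr_deriv ?_
    rw [dirDeriv_sum_smul]
    refine Finset.sum_eq_zero fun j _ => ?_
    have := h j (p s)
    rw [coordDeriv] at this
    rw [this, mul_zero]
  have hc := is_const_of_deriv_eq_zero (fun s => (hd s).differentiableAt) (fun s => (hd s).deriv) 1 0
  have e1 : p 1 = fun j => Circle.exp (θ j) := by simp [p]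
  have e0 : p 0 = 1 := by funext j; simp [p]
  rwa [e1, e0] at hc

/-- A continuous nonnegative integrand with integral zero vanishes identically, as Haar measure
charges open sets. The derivatives then vanish wherever the weight does not, a dense set. -/
lemma coordDeriv_eq_zero {q : PowerSumRing}
    (h : ∫ z, (∑ j, ‖coordDeriv j q z‖ ^ 2) * (torusWeight z).re ∂(torusHaar N) = 0)
    (j : Fin N) (z : Fin N → Circle) : coordDeriv j q z = 0 := by
  have hcont : Continuous fun z : Fin N → Circle =>
      (∑ j, ‖coordDeriv j q z‖ ^ 2) * (torusWeight z).re :=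
    (continuous_finsetSum _ fun j _ => (continuous_coordDeriv j q).norm.pow 2).mul
      (Complex.continuous_re.comp continuous_torusWeight)
  have hnn : ∀ z : Fin N → Circle, 0 ≤ (∑ j, ‖coordDeriv j q z‖ ^ 2) * (torusWeight z).re :=
    fun z => mul_nonneg (Finset.sum_nonneg fun _ _ => by positivity) (torusWeight_re_nonneg z)
  rw [integral_eq_zero_iff_of_nonneg hnn
    (hcont.integrable_of_hasCompactSupport (HasCompactSupport.of_compactSpace _))] at h
  have h0 := (Continuous.ae_eq_iff_eq _ hcont continuous_zero).mp h
  have heq : Set.EqOn (coordDeriv j q) 0 {z : Fin N → Circle | torusWeight z ≠ 0} := by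
    intro z hz
    have h1 := congrFun h0 z
    have h2 : (torusWeight z).re ≠ 0 := fun h3 => hz (by rw [torusWeight_re, h3]; simp)
    have h4 := (mul_eq_zero.mp h1).resolve_right h2
    have h5 := (Finset.sum_eq_zero_iff_of_nonneg fun _ _ => by positivity).mp h4 j
      (Finset.mem_univ _)
    simpa using h5
  exact congrFun (Continuous.ext_on dense_torusWeight_ne_zero (continuous_coordDeriv j q)
    continuous_zero heq) z

/-- Every polynomial in the power sums agrees, on the torus, with a constant up to the image of
`laplace`. -/
theorem exists_laplace_add_const (M : PowerSumRing) :
    ∃ (K : Finset ℤ) (r : PowerSumRing) (c : ℂ), ∀ z : Fin N → Circle,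
      aeval (torusTrace z) M = aeval (torusTrace z) (laplace K r) + c := by
  obtain ⟨n, hM⟩ := exists_mem_filtration M
  set K := Finset.Icc (-n : ℤ) n
  set sq : C(Fin N → Circle, ℂ) := ⟨fun z => (Real.sqrt (torusWeight z).re : ℂ),
    Complex.continuous_ofReal.comp (Real.continuous_sqrt.comp
      (Complex.continuous_re.comp continuous_torusWeight))⟩ with hsq
  -- Multiplying by the square root of the weight makes the L² inner product the one given by Weyl's
  -- density.
  set ι : C(Fin N → Circle, ℂ) →ₗ[ℂ] Lp ℂ 2 (torusHaar N) :=
    (ContinuousMap.toLp 2 (torusHaar N) ℂ).toLinearMap ∘ₗ LinearMap.mulLeft ℂ sq with hι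
  set Λ : PowerSumRing →ₗ[ℂ] PowerSumRing :=
    ∑ k ∈ K, (k : ℂ) • ((shiftDeriv k).toLinearMap ∘ₗ (pderiv k : Derivation ℂ _ _).toLinearMap +
      LinearMap.mulLeft ℂ (loopTermInt k) ∘ₗ (pderiv k : Derivation ℂ _ _).toLinearMap) with hΛ
  have hΛa : ∀ r, Λ r = laplace K r := fun r => by
    simp [hΛ, laplace, LinearMap.sum_apply]
  have hle : ((filtration n).map Λ).map (torusEval N).toLinearMap ≤
      (filtration n).map (torusEval N).toLinearMap := by
    refine Submodule.map_mono ?_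
    rintro _ ⟨r, hr, rfl⟩
    rw [hΛa]
    exact laplace_mem_filtration K hr
  have := finiteDimensional_map_torusEval (N := N) n
  have := Submodule.finiteDimensional_of_le hle
  set S := (((filtration n).map Λ).map (torusEval N).toLinearMap).map ι
  obtain ⟨y, hy, w, hw, hyw⟩ := S.exists_add_mem_mem_orthogonal (ι (torusEval N M))
  obtain ⟨_, ⟨_, ⟨r, hr, rfl⟩, rfl⟩, rfl⟩ := hy
  rw [hΛa, AlgHom.toLinearMap_apply] at hyw
  -- q represents the component of M orthogonal to the Laplacians of the level. As q lies in the
  -- same level, it is orthogonal to its own Laplacian, so its energy is zero and it is constant on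
  -- the torus.
  set q := M - laplace K r with hqd
  have hq : q ∈ filtration n := Submodule.sub_mem _ hM (laplace_mem_filtration K hr)
  have hwq : w = ι (torusEval N q) := by
    rw [hqd, map_sub, map_sub, hyw]
    abel
  have h0 := (Submodule.mem_orthogonal' _ _).mp hw (ι (torusEval N (laplace K q)))
    ⟨_, ⟨_, ⟨q, hq, rfl⟩, rfl⟩, by rw [hΛa]; rfl⟩
  have h1 : torusFunctional N (conj q * laplace K q) = 0 := by
    rw [← h0, hwq, hι, LinearMap.comp_apply, LinearMap.comp_apply,
      ContinuousLinearMap.coe_coe, ContinuousMap.inner_toLp, torusFunctional_apply]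
    refine integral_congr_ae (Eventually.of_forall fun z => ?_)
    simp only [LinearMap.mulLeft_apply, ContinuousMap.mul_apply, torusEval_apply, map_mul]
    rw [aeval_conj (torusTrace_neg z)]
    simp only [hsq, ContinuousMap.coe_mk, Complex.conj_ofReal]
    rw [torusWeight_re z]
    have : ((torusWeight z).re : ℂ) =
        (Real.sqrt (torusWeight z).re : ℂ) * (Real.sqrt (torusWeight z).re : ℂ) := by
      rw [← Complex.ofReal_mul, Real.mul_self_sqrt (torusWeight_re_nonneg z)]
    simp only [Complex.ofReal_re]
    rw [this]
    ring
  rw [torusFunctional_conj_mul_laplace hq, Complex.ofReal_eq_zero] at h1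
  refine ⟨K, r, aeval (torusTrace (1 : Fin N → Circle)) q, fun z => ?_⟩
  rw [← torusEval_eq_const (coordDeriv_eq_zero h1) z, ← map_add, hqd, add_sub_cancel]

/-- Haar moments of the power traces are given by Weyl's density on the torus. -/
theorem torusFunctional_eq_haarFunctional_mul (M : PowerSumRing) :
    torusFunctional N M = haarFunctional N M * torusFunctional N 1 := by
  obtain ⟨K, r, c, h⟩ := exists_laplace_add_const (N := N) M
  have h1 : haarFunctional N M = c := by
    -- The decomposition is known only on the torus. It passes to the group because the power traces
    -- of every A are those of some torus point.
    have e : ∀ A : Matrix.unitaryGroup (Fin N) ℂ, aeval (powerTrace A) M =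
        aeval (powerTrace A) (laplace K r + C c) := fun A => by
      obtain ⟨z, hz⟩ := exists_torusTrace_eq A
      rw [hz, h, map_add]
      simp
    have : haarFunctional N M = haarFunctional N (laplace K r + C c) := by
      rw [haarFunctional_apply, haarFunctional_apply]
      simp only [e]
    rw [this, map_add, (schwingerDyson_haarFunctional N).map_laplace, zero_add,
      haarFunctional_apply]
    simp
  have h2 : torusFunctional N M = torusFunctional N (laplace K r + c • 1) := by
    rw [torusFunctional_apply, torusFunctional_apply]
    simp only [h, map_add, map_smul, map_one]
    simp
  rw [h2, h1, map_add, (schwingerDyson_torusFunctional N).map_laplace, zero_add, map_smul,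
    smul_eq_mul]

end Decomposition

end

/-! ### Weyl's integration formula for the law of the power traces -/

section

open PowerSumRing MvPolynomial

section MeasureExt

open BoundedContinuousFunction in
/-- Finite measures on a compact space are determined by the integrals of polynomials in a
point-separating family of functions that is stable under conjugation. -/
lemma measure_eq_of_integral_aeval_eq {Y : Type*} [TopologicalSpace Y] [CompactSpace Y]
    [PolishSpace Y] [MeasurableSpace Y] [BorelSpace Y] {p : Y → ℤ → ℂ}
    (hp : ∀ m, Continuous fun y => p y m) (hinj : Function.Injective p)
    (hconj : ∀ y m, p y (-m) = starRingEnd ℂ (p y m)) {μ ν : Measure Y} [IsFiniteMeasure μ]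
    [IsFiniteMeasure ν] (h : ∀ r : PowerSumRing, ∫ y, aeval (p y) r ∂μ = ∫ y, aeval (p y) r ∂ν) :
    μ = ν := by
  let f : PowerSumRing →ₐ[ℂ] (Y →ᵇ ℂ) :=
    aeval fun m => BoundedContinuousFunction.mkOfCompact ⟨fun y => p y m, hp m⟩
  have hfa : ∀ r y, f r y = aeval (p y) r := by
    intro r y
    induction r using MvPolynomial.induction_on with
    | C a => rw [← algebraMap_eq, AlgHom.commutes, AlgHom.commutes]; rfl
    | add p q hp hq => simp only [map_add, BoundedContinuousFunction.add_apply, hp, hq]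
    | mul_X r n hr =>
      rw [map_mul, BoundedContinuousFunction.mul_apply, hr, map_mul, aeval_X, aeval_X]
      rfl
  let A : StarSubalgebra ℂ (Y →ᵇ ℂ) :=
    { f.range with
      star_mem' := by
        rintro _ ⟨r, rfl⟩
        refine ⟨conj r, ?_⟩
        ext y
        change f (conj r) y = star (f r y)
        rw [hfa, hfa, aeval_conj (hconj y)]
        rfl }
  refine ext_of_forall_mem_subalgebra_integral_eq_of_polish (A := A) ?_ ?_
  · intro x y hxy
    obtain ⟨m, hm⟩ := Function.ne_iff.mp (hinj.ne hxy)
    refine ⟨_, ⟨toContinuousMapStarₐ ℂ (f (X m)), ⟨f (X m), ⟨X m, rfl⟩, rfl⟩, rfl⟩, ?_⟩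
    change f (X m) x ≠ f (X m) y
    rwa [hfa, hfa, aeval_X, aeval_X]
  · rintro _ ⟨r, rfl⟩
    change ∫ y, f r y ∂μ = ∫ y, f r y ∂ν
    simpa only [hfa] using h r

end MeasureExt

section WeylMeasure
variable {N : ℕ}

lemma measurable_powerTrace : Measurable (powerTrace (N := N)) :=
  measurable_pi_lambda _ fun m => (continuous_powerTrace m).measurable

lemma measurable_torusTrace : Measurable (torusTrace (N := N)) :=
  measurable_pi_lambda _ fun m => (continuous_torusTrace m).measurable

lemma torusFunctional_one :
    torusFunctional N 1 = ((∫ z, (torusWeight z).re ∂(torusHaar N) : ℝ) : ℂ) := by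
  rw [torusFunctional_apply, ← integral_complex_ofReal]
  simp only [map_one, one_mul, ← torusWeight_re]

lemma integrable_torusWeight_re :
    Integrable (fun z => (torusWeight z).re) (torusHaar N) :=
  (Complex.continuous_re.comp continuous_torusWeight).integrable_of_hasCompactSupport
    (HasCompactSupport.of_compactSpace _)

instance : IsFiniteMeasure
    ((torusHaar N).withDensity fun z => ENNReal.ofReal (torusWeight z).re) :=
  isFiniteMeasure_withDensity_ofReal integrable_torusWeight_re.2

/-- Weyl's integration formula for the joint distribution of the power traces. -/
theorem map_torusTrace_eq :
    ((torusHaar N).withDensity fun z => ENNReal.ofReal (torusWeight z).re).map torusTrace =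
      ENNReal.ofReal (∫ z, (torusWeight z).re ∂(torusHaar N)) •
        (unitaryHaar N).map powerTrace := by
  -- Both laws are carried by the compact set of power sums of torus points, where polynomials in
  -- the coordinates determine finite measures.
  set Y := Set.range (torusTrace (N := N))
  have hYc : IsCompact Y := isCompact_range (continuous_pi continuous_torusTrace)
  have : CompactSpace Y := isCompact_iff_compactSpace.mp hYc
  have : PolishSpace Y := hYc.isClosed.polishSpace
  have hc0 : 0 ≤ ∫ z, (torusWeight z).re ∂(torusHaar N) := integral_nonneg torusWeight_re_nonneg
  set c := ∫ z, (torusWeight z).re ∂(torusHaar N)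
  set pT : (Fin N → Circle) → Y := fun z => ⟨torusTrace z, z, rfl⟩
  set pU : Matrix.unitaryGroup (Fin N) ℂ → Y := fun A =>
    ⟨powerTrace A, by obtain ⟨z, hz⟩ := exists_torusTrace_eq A; exact ⟨z, hz.symm⟩⟩
  have hpT : Measurable pT := measurable_torusTrace.subtype_mk
  have hpU : Measurable pU := measurable_powerTrace.subtype_mk
  have key : ((torusHaar N).withDensity fun z => ENNReal.ofReal (torusWeight z).re).map pT =
      ENNReal.ofReal c • (unitaryHaar N).map pU := by
    have := Measure.isFiniteMeasure_map (unitaryHaar N) pU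
    have : IsFiniteMeasure (ENNReal.ofReal c • (unitaryHaar N).map pU) :=
      Measure.smul_finite _ ENNReal.ofReal_ne_top
    have hcont : ∀ m : ℤ, Continuous fun y : Y => (y : ℤ → ℂ) m := fun m =>
      (continuous_apply m).comp continuous_subtype_val
    refine measure_eq_of_integral_aeval_eq (p := fun y : Y => (y : ℤ → ℂ)) hcont
      Subtype.coe_injective ?_ fun r => ?_
    · rintro ⟨_, z, rfl⟩ m
      exact torusTrace_neg z m
    · have hr := (continuous_aeval hcont r)
      have hwm : Measurable fun z : Fin N → Circle => ENNReal.ofReal (torusWeight z).re :=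
        (Complex.continuous_re.comp continuous_torusWeight).measurable.ennreal_ofReal
      rw [integral_map hpT.aemeasurable hr.aestronglyMeasurable, integral_smul_measure,
        integral_map hpU.aemeasurable hr.aestronglyMeasurable,
        integral_withDensity_eq_integral_toReal_smul hwm
          (Eventually.of_forall fun _ => ENNReal.ofReal_lt_top), ENNReal.toReal_ofReal hc0]
      have h := torusFunctional_eq_haarFunctional_mul (N := N) r
      rw [torusFunctional_one, torusFunctional_apply, haarFunctional_apply, mul_comm] at h
      rw [Complex.real_smul, ← h]
      refine integral_congr_ae (Eventually.of_forall fun z => ?_)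
      simp only
      rw [ENNReal.toReal_ofReal (torusWeight_re_nonneg z), Complex.real_smul, ← torusWeight_re,
        mul_comm]
  have h := congrArg (Measure.map (Subtype.val : Y → ℤ → ℂ)) key
  rw [Measure.map_map measurable_subtype_coe hpT, Measure.map_smul,
    Measure.map_map measurable_subtype_coe hpU] at h
  exact h

end WeylMeasure

/-! ### The Cayley map and the Cauchy distribution -/

section CayleyCircle

/-- The Cayley map `x ↦ (x + i) / (x - i)` from the line to the circle. -/
noncomputable def cayley (x : ℝ) : Circle :=
  ⟨((x : ℂ) + Complex.I) / (x - Complex.I), by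
    have hne : (x : ℂ) - Complex.I ≠ 0 := fun h => by simpa using congrArg Complex.im h
    refine mem_sphere_zero_iff_norm.mpr ?_
    rw [norm_div, div_eq_one_iff_eq (norm_ne_zero_iff.mpr hne),
      ← Complex.norm_conj]
    congr 1
    simp [sub_eq_add_neg]⟩

lemma coe_cayley (x : ℝ) : (cayley x : ℂ) = ((x : ℂ) + Complex.I) / (x - Complex.I) := rfl

lemma ofReal_sub_I_ne_zero (x : ℝ) : (x : ℂ) - Complex.I ≠ 0 := fun h => by
  simpa using congrArg Complex.im h

lemma ofReal_add_I_ne_zero (x : ℝ) : (x : ℂ) + Complex.I ≠ 0 := fun h => by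
  simpa using congrArg Complex.im h

lemma continuous_cayley : Continuous cayley := by
  refine Continuous.subtype_mk ?_ _
  exact (Complex.continuous_ofReal.add continuous_const).div
    (Complex.continuous_ofReal.sub continuous_const) ofReal_sub_I_ne_zero

lemma hasDerivAt_cayley (x : ℝ) :
    HasDerivAt (fun x => (cayley x : ℂ)) (-2 * Complex.I / (1 + x ^ 2) * cayley x) x := by
  have h1 : HasDerivAt (fun x : ℝ => (x : ℂ)) 1 x := Complex.ofRealCLM.hasDerivAt
  have h := (h1.add_const Complex.I).fun_div (h1.sub_const Complex.I) (ofReal_sub_I_ne_zero x)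
  refine h.congr_deriv ?_
  have h2 : (1 + (x : ℂ) ^ 2) = (x + Complex.I) * (x - Complex.I) := by
    linear_combination Complex.I_sq
  rw [coe_cayley, h2]
  have := ofReal_sub_I_ne_zero x
  have := ofReal_add_I_ne_zero x
  field_simp
  ring

lemma tendsto_cayley {l : Filter ℝ} (hl : Tendsto (fun x : ℝ => |x|) l atTop) :
    Tendsto (fun x => (cayley x : ℂ)) l (𝓝 1) := by
  have e : ∀ x : ℝ, (cayley x : ℂ) = 1 + 2 * Complex.I * ((x : ℂ) - Complex.I)⁻¹ := fun x => by
    have := ofReal_sub_I_ne_zero x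
    rw [coe_cayley]
    field_simp
    ring
  simp only [e]
  have h : Tendsto (fun x : ℝ => ((x : ℂ) - Complex.I)⁻¹) l (𝓝 0) := by
    refine tendsto_inv₀_cobounded.comp ?_
    rw [← tendsto_norm_atTop_iff_cobounded]
    refine tendsto_atTop_mono (fun x => ?_) hl
    simpa using Complex.abs_re_le_norm ((x : ℂ) - Complex.I)
  simpa using (h.const_mul (2 * Complex.I)).const_add 1

lemma integral_cauchyMeasure (f : ℝ → ℂ) :
    ∫ x, f x ∂(ProbabilityTheory.cauchyMeasure 0 1) =
      ∫ x : ℝ, (((Real.pi * (1 + x ^ 2))⁻¹ : ℝ) : ℂ) * f x := by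
  rw [ProbabilityTheory.cauchyMeasure_of_scale_ne_zero _ one_ne_zero,
    integral_withDensity_eq_integral_toReal_smul
      (ProbabilityTheory.measurable_cauchyPDF 0 1)
      (Eventually.of_forall fun x => by rw [ProbabilityTheory.cauchyPDF]; exact ENNReal.ofReal_lt_top)]
  refine integral_congr_ae (Eventually.of_forall fun x => ?_)
  simp only
  rw [ProbabilityTheory.cauchyPDF, ENNReal.toReal_ofReal
    (ProbabilityTheory.cauchyPDF_pos 0 one_ne_zero x).le,
    ProbabilityTheory.cauchyPDFReal_def, Complex.real_smul]
  congr 2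
  simp [mul_comm, add_comm]

lemma integrable_cauchyMeasure_iff {f : ℝ → ℂ} :
    Integrable f (ProbabilityTheory.cauchyMeasure 0 1) ↔
      Integrable fun x : ℝ => (((Real.pi * (1 + x ^ 2))⁻¹ : ℝ) : ℂ) * f x := by
  rw [ProbabilityTheory.cauchyMeasure_of_scale_ne_zero _ one_ne_zero,
    integrable_withDensity_iff_integrable_smul'
      (ProbabilityTheory.measurable_cauchyPDF 0 1)
      (Eventually.of_forall fun x => by rw [ProbabilityTheory.cauchyPDF]; exact ENNReal.ofReal_lt_top)]
  refine integrable_congr (Eventually.of_forall fun x => ?_)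
  simp only
  rw [ProbabilityTheory.cauchyPDF, ENNReal.toReal_ofReal
    (ProbabilityTheory.cauchyPDF_pos 0 one_ne_zero x).le,
    ProbabilityTheory.cauchyPDFReal_def, Complex.real_smul]
  congr 2
  simp [mul_comm, add_comm]

/-- A multiple of the k-th power of the Cayley map is an antiderivative of the integrand, and it has
the same limit at both ends of the line. -/
lemma integral_cayley_zpow {k : ℤ} (hk : k ≠ 0) :
    ∫ x, (cayley x : ℂ) ^ k ∂(ProbabilityTheory.cauchyMeasure 0 1) = 0 := by
  have hkC : (k : ℂ) ≠ 0 := Int.cast_ne_zero.mpr hk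
  have hint : Integrable fun x : ℝ => (((Real.pi * (1 + x ^ 2))⁻¹ : ℝ) : ℂ) * (cayley x : ℂ) ^ k := by
    rw [← integrable_cauchyMeasure_iff]
    refine Integrable.of_bound (C := 1) ?_ (Eventually.of_forall fun x => ?_)
    · have : Continuous fun x => (((cayley x) ^ k : Circle) : ℂ) :=
        continuous_coe_circle.comp (continuous_cayley.zpow k)
      simpa only [Circle.coe_zpow] using this.aestronglyMeasurable
    · rw [← Circle.coe_zpow, Circle.norm_coe]
  rw [integral_cauchyMeasure]
  have hd : ∀ x : ℝ, HasDerivAt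
      (fun x => Complex.I / (2 * k * Real.pi) * (cayley x : ℂ) ^ k)
      ((((Real.pi * (1 + x ^ 2))⁻¹ : ℝ) : ℂ) * (cayley x : ℂ) ^ k) x := by
    intro x
    have hne : (cayley x : ℂ) ≠ 0 := Circle.coe_ne_zero _
    have h := ((hasDerivAt_zpow k _ (Or.inl hne)).comp x (hasDerivAt_cayley x)).const_mul
      (Complex.I / (2 * k * Real.pi))
    refine h.congr_deriv ?_
    have h1 : (1 + (x : ℂ) ^ 2) ≠ 0 := by
      have : (1 + x ^ 2 : ℝ) ≠ 0 := by positivity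
      exact_mod_cast this
    have hpi : (Real.pi : ℂ) ≠ 0 := Complex.ofReal_ne_zero.mpr Real.pi_ne_zero
    rw [zpow_sub_one₀ hne]
    push_cast
    generalize (cayley x : ℂ) ^ k = w
    field_simp
    linear_combination (-w : ℂ) * Complex.I_sq
  have hlim : ∀ {l : Filter ℝ}, Tendsto (fun x : ℝ => |x|) l atTop →
      Tendsto (fun x => Complex.I / (2 * k * Real.pi) * (cayley x : ℂ) ^ k) l
        (𝓝 (Complex.I / (2 * k * Real.pi) * 1)) := by
    intro l hl
    have h := ((continuousAt_zpow₀ (1 : ℂ) k (Or.inl one_ne_zero)).tendsto.comp (tendsto_cayley hl))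
    rw [one_zpow] at h
    exact h.const_mul _
  rw [integral_of_hasDerivAt_of_tendsto hd hint (hlim tendsto_abs_atBot_atTop)
    (hlim tendsto_abs_atTop_atTop), sub_self]

/-- Invariance under a rotation w with w^k ≠ 1, here w = e^{iπ/k}. -/
lemma integral_circleHaar_zpow {k : ℤ} (hk : k ≠ 0) : ∫ z : Circle, (z : ℂ) ^ k ∂circleHaar = 0 := by
  obtain ⟨w, hw⟩ : ∃ w : Circle, ((w : ℂ)) ^ k ≠ 1 := by
    refine ⟨Circle.exp (Real.pi / k), ?_⟩
    rw [Circle.coe_exp, ← Complex.exp_int_mul]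
    have hkC : (k : ℂ) ≠ 0 := Int.cast_ne_zero.mpr hk
    push_cast
    rw [show (k : ℂ) * (Real.pi / k * Complex.I) = Real.pi * Complex.I by field_simp,
      Complex.exp_pi_mul_I]
    norm_num
  have h := integral_mul_left_eq_self (μ := circleHaar) (fun z : Circle => (z : ℂ) ^ k) w
  simp only [Circle.coe_mul, mul_zpow] at h
  rw [integral_const_mul] at h
  have h2 : ((w : ℂ) ^ k - 1) * ∫ z : Circle, (z : ℂ) ^ k ∂circleHaar = 0 := by
    rw [sub_mul, h, one_mul, sub_self]
  exact (mul_eq_zero.mp h2).resolve_left (sub_ne_zero.mpr hw)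

/-- The Cayley map pushes the Cauchy distribution to the Haar measure of the circle. -/
theorem map_cayley : (ProbabilityTheory.cauchyMeasure 0 1).map cayley = circleHaar := by
  have hm := continuous_cayley.measurable
  have := Measure.isProbabilityMeasure_map (μ := ProbabilityTheory.cauchyMeasure 0 1) hm.aemeasurable
  have hcont : ∀ m : ℤ, Continuous fun z : Circle => (z : ℂ) ^ m := fun m => by
    simp only [← Circle.coe_zpow]
    exact continuous_coe_circle.comp (continuous_zpow m)
  refine measure_eq_of_integral_aeval_eq (p := fun z : Circle => fun m : ℤ => (z : ℂ) ^ m) hcont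
    (fun z w h => Circle.ext (by simpa using congrFun h 1)) circle_coe_zpow_neg fun r => ?_
  have hbd : ∀ (μ : Measure Circle) [IsFiniteMeasure μ] (r : PowerSumRing),
      Integrable (fun z : Circle => aeval (fun m : ℤ => (z : ℂ) ^ m) r) μ := fun μ _ r =>
    (continuous_aeval hcont r).integrable_of_hasCompactSupport (HasCompactSupport.of_compactSpace _)
  induction r using MvPolynomial.induction_on' with
  | monomial s a =>
    -- A monomial in the powers of z is again a single power of z, so only the moments of z^n have
    -- to be compared.
    have e : ∀ z : Circle, aeval (fun m : ℤ => (z : ℂ) ^ m) (monomial s a) =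
        a * (z : ℂ) ^ (∑ m ∈ s.support, m * (s m : ℤ)) := by
      intro z
      rw [aeval_monomial, Finsupp.prod]
      simp only [← zpow_natCast, ← zpow_mul]
      have : ∀ S : Finset ℤ, ∏ m ∈ S, (z : ℂ) ^ (m * (s m : ℤ)) =
          (z : ℂ) ^ (∑ m ∈ S, m * (s m : ℤ)) := fun S => by
        induction S using Finset.induction_on with
        | empty => simp
        | insert m S hm ih =>
          rw [Finset.prod_insert hm, Finset.sum_insert hm, ih, zpow_add₀ (Circle.coe_ne_zero _)]
      rw [this]
      rfl
    simp only [e, integral_const_mul]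
    congr 1
    by_cases h0 : ∑ m ∈ s.support, m * (s m : ℤ) = 0
    · simp [h0]
    · rw [integral_circleHaar_zpow h0, integral_map hm.aemeasurable (hcont _).aestronglyMeasurable,
        integral_cayley_zpow h0]
  | add p q hp hq =>
    simp only [map_add]
    rw [integral_add (hbd _ _) (hbd _ _), integral_add (hbd _ _) (hbd _ _), hp, hq]

end CayleyCircle

end

/-! ### Andréief's identity and Weyl's formula in Cayley coordinates -/

section

open PowerSumRing

section Andreief
variable {N : ℕ}

lemma det_mul_det_eq_sum {X : Type*} (f g : Fin N → X → ℂ) (x : Fin N → X) :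
    (Matrix.of fun j k => f j (x k)).det * (Matrix.of fun j k => g j (x k)).det =
      ∑ σ : Equiv.Perm (Fin N), ∑ τ : Equiv.Perm (Fin N),
        ((Equiv.Perm.sign σ : ℤ) : ℂ) * ((Equiv.Perm.sign τ : ℤ) : ℂ) *
          ∏ k, f (σ k) (x k) * g (τ k) (x k) := by
  rw [Matrix.det_apply', Matrix.det_apply', Finset.sum_mul_sum]
  refine Finset.sum_congr rfl fun σ _ => Finset.sum_congr rfl fun τ _ => ?_
  simp only [Matrix.of_apply, Finset.prod_mul_distrib]
  ring

variable {X : Type*} [MeasurableSpace X] {μ : Measure X} [SigmaFinite μ]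

/-- Andréief's identity. -/
theorem integral_det_mul_det {f g : Fin N → X → ℂ}
    (h : ∀ j k, Integrable (fun x => f j x * g k x) μ) :
    ∫ x : Fin N → X, (Matrix.of fun j k => f j (x k)).det * (Matrix.of fun j k => g j (x k)).det
      ∂(Measure.pi fun _ => μ) =
      N.factorial * (Matrix.of fun j k => ∫ x, f j x * g k x ∂μ).det := by
  have hi : ∀ σ τ : Equiv.Perm (Fin N), Integrable (fun x : Fin N → X =>
      ((Equiv.Perm.sign σ : ℤ) : ℂ) * ((Equiv.Perm.sign τ : ℤ) : ℂ) *
          ∏ k, f (σ k) (x k) * g (τ k) (x k)) (Measure.pi fun _ => μ) := fun σ τ =>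
    (Integrable.fintype_prod (f := fun k x => f (σ k) x * g (τ k) x) fun k => h _ _).const_mul _
  simp only [det_mul_det_eq_sum]
  rw [integral_finsetSum _ fun σ _ => integrable_finsetSum _ fun τ _ => hi σ τ]
  have hσ : ∀ σ : Equiv.Perm (Fin N), ∫ x : Fin N → X, ∑ τ : Equiv.Perm (Fin N),
      ((Equiv.Perm.sign σ : ℤ) : ℂ) * ((Equiv.Perm.sign τ : ℤ) : ℂ) *
          ∏ k, f (σ k) (x k) * g (τ k) (x k) ∂(Measure.pi fun _ => μ) =
      (Matrix.of fun j k => ∫ x, f j x * g k x ∂μ).det := by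
    intro σ
    rw [integral_finsetSum _ fun τ _ => hi σ τ, ← Matrix.det_transpose, Matrix.det_apply']
    -- For fixed σ, replacing τ by τσ⁻¹ and reindexing the product by σ turns the sum over τ into
    -- the determinant. Every σ contributes the same amount, whence N!.
    refine Fintype.sum_equiv (Equiv.mulRight σ⁻¹) _ _ fun τ => ?_
    rw [integral_const_mul, integral_fintype_prod_eq_prod (fun k x => f (σ k) x * g (τ k) x),
      Equiv.coe_mulRight, map_mul, Equiv.Perm.sign_inv]
    congr 1
    · push_cast; ring
    · refine Fintype.prod_equiv σ _ _ fun k => ?_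
      simp
  simp only [hσ]
  simp [Fintype.card_perm]

end Andreief

section WeylCauchy
variable {N : ℕ}

lemma torusWeight_eq_det_mul_det (z : Fin N → Circle) :
    torusWeight z = (Matrix.of fun j k : Fin N => (z k : ℂ) ^ ((j : ℕ) : ℤ)).det *
      (Matrix.of fun j k : Fin N => (z k : ℂ) ^ (-((j : ℕ) : ℤ))).det := by
  have h1 : (Matrix.of fun j k : Fin N => (z k : ℂ) ^ ((j : ℕ) : ℤ)).det =
      ∏ i, ∏ j ∈ Finset.Ioi i, ((z j : ℂ) - z i) := by
    rw [← Matrix.det_vandermonde, ← Matrix.det_transpose]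
    rfl
  have h2 : (Matrix.of fun j k : Fin N => (z k : ℂ) ^ (-((j : ℕ) : ℤ))).det =
      starRingEnd ℂ (Matrix.of fun j k : Fin N => (z k : ℂ) ^ ((j : ℕ) : ℤ)).det := by
    rw [RingHom.map_det]
    congr 1
    ext j k
    exact circle_coe_zpow_neg _ _
  rw [h2, Complex.mul_conj', h1, torusWeight_eq]
  simp only [norm_prod, Finset.prod_pow]
  push_cast
  rfl

/-- The powers z^j are orthonormal on the circle, so the Gram matrix in Andréief's identity is the
identity. -/
lemma integral_torusWeight_re : ∫ z, (torusWeight z).re ∂(torusHaar N) = N.factorial := by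
  have h := integral_det_mul_det (μ := circleHaar) (N := N)
    (f := fun j z => (z : ℂ) ^ ((j : ℕ) : ℤ)) (g := fun j z => (z : ℂ) ^ (-((j : ℕ) : ℤ))) (by
      intro j k
      refine Continuous.integrable_of_hasCompactSupport ?_ (HasCompactSupport.of_compactSpace _)
      simp only [← Circle.coe_zpow]
      exact (continuous_coe_circle.comp (continuous_zpow _)).mul
        (continuous_coe_circle.comp (continuous_zpow _)))
  have h2 : (Matrix.of fun j k : Fin N => ∫ z : Circle, (z : ℂ) ^ ((j : ℕ) : ℤ) *
      (z : ℂ) ^ (-((k : ℕ) : ℤ)) ∂circleHaar) = 1 := by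
    ext j k
    simp only [Matrix.of_apply, ← zpow_add₀ (Circle.coe_ne_zero _)]
    by_cases hjk : j = k
    · subst hjk; simp
    · rw [Matrix.one_apply_ne hjk, integral_circleHaar_zpow]
      intro h0
      exact hjk (Fin.ext (by omega))
  rw [h2, Matrix.det_one, mul_one] at h
  have h3 := torusFunctional_one (N := N)
  rw [torusFunctional_apply] at h3
  simp only [map_one, one_mul, torusWeight_eq_det_mul_det] at h3
  rw [torusHaar] at h3 ⊢
  rw [h] at h3
  simp only [← torusWeight_eq_det_mul_det] at h3
  exact_mod_cast h3.symm

/-- The product of `N` standard Cauchy distributions. -/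
noncomputable def cauchyPi (N : ℕ) : Measure (Fin N → ℝ) :=
  Measure.pi fun _ => ProbabilityTheory.cauchyMeasure 0 1

instance : IsProbabilityMeasure (cauchyPi N) := by unfold cauchyPi; infer_instance

/-- The Cayley map in each coordinate. -/
noncomputable def cayleyPi (x : Fin N → ℝ) : Fin N → Circle := fun j => cayley (x j)

lemma continuous_cayleyPi : Continuous (cayleyPi (N := N)) :=
  continuous_pi fun j => continuous_cayley.comp (continuous_apply j)

lemma map_cayleyPi : (cauchyPi N).map cayleyPi = torusHaar N := by
  have : SigmaFinite ((ProbabilityTheory.cauchyMeasure 0 1).map cayley) := by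
    rw [map_cayley]; infer_instance
  have h := Measure.pi_map_pi (ι := Fin N)
    (μ := fun _ => ProbabilityTheory.cauchyMeasure 0 1) (f := fun _ => cayley)
    (fun _ => continuous_cayley.measurable.aemeasurable)
  rw [cauchyPi, torusHaar]
  simp only [map_cayley] at h
  exact h

/-- Weyl's integration formula for functions of the power traces, in Cayley coordinates. -/
theorem integral_comp_powerTrace {G : (ℤ → ℂ) → ℂ} (hG : Measurable G) :
    ∫ A, G (powerTrace A) ∂(unitaryHaar N) = (N.factorial : ℂ)⁻¹ *
      ∫ x, torusWeight (cayleyPi x) * G (torusTrace (cayleyPi x)) ∂(cauchyPi N) := by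
  have hwm : Measurable fun z : Fin N → Circle => ENNReal.ofReal (torusWeight z).re :=
    (Complex.continuous_re.comp continuous_torusWeight).measurable.ennreal_ofReal
  have h : ∫ p, G p ∂((torusHaar N).withDensity fun z =>
      ENNReal.ofReal (torusWeight z).re).map torusTrace = ∫ p, G p ∂(ENNReal.ofReal
      (∫ z, (torusWeight z).re ∂(torusHaar N)) • (unitaryHaar N).map powerTrace) := by
    rw [map_torusTrace_eq]
  rw [integral_smul_measure, integral_map measurable_powerTrace.aemeasurable
    hG.aestronglyMeasurable, integral_map measurable_torusTrace.aemeasurable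
    hG.aestronglyMeasurable, integral_withDensity_eq_integral_toReal_smul hwm
    (Eventually.of_forall fun _ => ENNReal.ofReal_lt_top), integral_torusWeight_re,
    ENNReal.toReal_ofReal (Nat.cast_nonneg _), ← map_cayleyPi,
    integral_map continuous_cayleyPi.measurable.aemeasurable] at h
  · have hN : (N.factorial : ℂ) ≠ 0 := Nat.cast_ne_zero.mpr N.factorial_ne_zero
    rw [eq_inv_mul_iff_mul_eq₀ hN]
    rw [Complex.real_smul, Complex.ofReal_natCast] at h
    rw [← h]
    refine integral_congr_ae (Eventually.of_forall fun x => ?_)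
    simp only
    rw [ENNReal.toReal_ofReal (torusWeight_re_nonneg _), Complex.real_smul, ← torusWeight_re]
  · exact (hwm.ennreal_toReal.smul (hG.comp measurable_torusTrace)).aestronglyMeasurable

theorem integrable_comp_powerTrace {G : (ℤ → ℂ) → ℂ} (hG : Measurable G)
    (hi : Integrable (fun x => torusWeight (cayleyPi x) * G (torusTrace (cayleyPi x)))
      (cauchyPi N)) :
    Integrable (fun A => G (powerTrace A)) (unitaryHaar N) := by
  have hwm : Measurable fun z : Fin N → Circle => ENNReal.ofReal (torusWeight z).re :=
    (Complex.continuous_re.comp continuous_torusWeight).measurable.ennreal_ofReal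
  have h1 : Integrable (fun z => torusWeight z * G (torusTrace z)) (torusHaar N) := by
    rw [← map_cayleyPi, integrable_map_measure ?_ continuous_cayleyPi.measurable.aemeasurable]
    · exact hi
    · exact (continuous_torusWeight.measurable.mul
        (hG.comp measurable_torusTrace)).aestronglyMeasurable
  have h2 : Integrable (fun z => G (torusTrace z))
      ((torusHaar N).withDensity fun z => ENNReal.ofReal (torusWeight z).re) := by
    rw [integrable_withDensity_iff_integrable_smul' hwm
      (Eventually.of_forall fun _ => ENNReal.ofReal_lt_top)]
    refine h1.congr (Eventually.of_forall fun z => ?_)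
    simp only
    rw [ENNReal.toReal_ofReal (torusWeight_re_nonneg _), Complex.real_smul, ← torusWeight_re]
  have h3 : Integrable G (((torusHaar N).withDensity fun z =>
      ENNReal.ofReal (torusWeight z).re).map torusTrace) :=
    (integrable_map_measure hG.aestronglyMeasurable measurable_torusTrace.aemeasurable).mpr h2
  rw [map_torusTrace_eq, integral_torusWeight_re, integrable_smul_measure (by
    rw [ne_eq, ENNReal.ofReal_eq_zero, not_le]
    exact_mod_cast N.factorial_pos) ENNReal.ofReal_ne_top] at h3
  exact (integrable_map_measure hG.aestronglyMeasurable
    measurable_powerTrace.aemeasurable).mp h3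

end WeylCauchy

end

/-! ### The joint-moment integrand as a function of the power traces -/

section

open PowerSumRing

section ClassFunctions
variable {N : ℕ}

/-- Newton's identities, solved recursively for the elementary symmetric functions, which is
possible because k is invertible in ℂ. -/
lemma exists_aeval_eq_esymm (N k : ℕ) : ∃ E : PowerSumRing, ∀ z : Fin N → Circle,
    MvPolynomial.aeval (torusTrace z) E =
      MvPolynomial.aeval (fun j => (z j : ℂ)) (MvPolynomial.esymm (Fin N) ℂ k) := by
  induction k using Nat.strong_induction_on with
  | _ k ih =>
    rcases Nat.eq_zero_or_pos k with rfl | hk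
    · exact ⟨1, fun z => by simp⟩
    choose! E hE using ih
    refine ⟨MvPolynomial.C (k : ℂ)⁻¹ * ((-1) ^ (k + 1) *
      ∑ a ∈ Finset.HasAntidiagonal.antidiagonal k with a.1 < k, (-1) ^ a.1 * E a.1 * MvPolynomial.X (a.2 : ℤ)),
      fun z => ?_⟩
    have hk0 : (k : ℂ) ≠ 0 := Nat.cast_ne_zero.mpr hk.ne'
    have h := congrArg (MvPolynomial.aeval fun j => (z j : ℂ))
      (MvPolynomial.mul_esymm_eq_sum (Fin N) ℂ k)
    rw [map_mul, map_natCast] at h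
    rw [map_mul, MvPolynomial.aeval_C, ← mul_right_inj' hk0, h, Algebra.algebraMap_self,
      RingHom.id_apply, mul_inv_cancel_left₀ hk0]
    simp only [map_mul, map_sum, map_pow, map_neg, map_one, MvPolynomial.aeval_X]
    congr 1
    refine Finset.sum_congr rfl fun a ha => ?_
    rw [hE a.1 (Finset.mem_filter.mp ha).2]
    congr 1
    simp [MvPolynomial.psum, torusTrace]

/-- The characteristic polynomial of `diagUnitary N z`. -/
noncomputable def torusCharpoly (z : Fin N → Circle) : Polynomial ℂ :=
  ∏ j, (Polynomial.X - Polynomial.C (z j : ℂ))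

lemma torusCharpoly_eq_sum (z : Fin N → Circle) :
    torusCharpoly z = ∑ k ∈ Finset.range (N + 1), (-1) ^ k *
      (Polynomial.C (MvPolynomial.aeval (fun j => (z j : ℂ)) (MvPolynomial.esymm (Fin N) ℂ k)) *
        Polynomial.X ^ (N - k)) := by
  have h := Multiset.prod_X_sub_X_eq_sum_esymm (Finset.univ.val.map fun j => (z j : ℂ))
  rw [Multiset.map_map, Multiset.card_map, Finset.card_val, Finset.card_univ, Fintype.card_fin] at h
  simp only [MvPolynomial.aeval_esymm_eq_multiset_esymm]
  exact h

lemma exists_aeval_eq_torusCharpoly (N : ℕ) : ∃ E E' : PowerSumRing, ∀ z : Fin N → Circle,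
    MvPolynomial.aeval (torusTrace z) E = (torusCharpoly z).eval 1 ∧
      MvPolynomial.aeval (torusTrace z) E' = (torusCharpoly z).derivative.eval 1 := by
  choose E hE using exists_aeval_eq_esymm N
  refine ⟨∑ k ∈ Finset.range (N + 1), (-1) ^ k * E k,
    ∑ k ∈ Finset.range (N + 1), (-1) ^ k * (E k * MvPolynomial.C ((N - k : ℕ) : ℂ)),
    fun z => ⟨?_, ?_⟩⟩
  · rw [torusCharpoly_eq_sum, Polynomial.eval_finsetSum, map_sum]
    refine Finset.sum_congr rfl fun k _ => ?_
    rw [map_mul, hE]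
    simp
  · rw [torusCharpoly_eq_sum, Polynomial.derivative_sum, Polynomial.eval_finsetSum, map_sum]
    refine Finset.sum_congr rfl fun k _ => ?_
    rw [show ((-1 : Polynomial ℂ) ^ k) = Polynomial.C ((-1) ^ k) by simp, Polynomial.derivative_C_mul,
      Polynomial.derivative_C_mul, Polynomial.derivative_X_pow]
    simp only [map_mul, hE, map_pow, map_neg, map_one, MvPolynomial.aeval_C]
    simp

lemma torusCharpoly_eval_one (z : Fin N → Circle) :
    (torusCharpoly z).eval 1 = ∏ j, (1 - (z j : ℂ)) := by
  simp [torusCharpoly, Polynomial.eval_prod]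

lemma torusCharpoly_derivative_eval_one (z : Fin N → Circle) :
    (torusCharpoly z).derivative.eval 1 =
      ∑ j, ∏ i ∈ Finset.univ.erase j, (1 - (z i : ℂ)) := by
  rw [torusCharpoly, Polynomial.derivative_prod_finset, Polynomial.eval_finsetSum]
  simp [Polynomial.eval_prod]

lemma eigenangles_conj_diagUnitary (V : Matrix.unitaryGroup (Fin N) ℂ) (z : Fin N → Circle) :
    eigenangles (V * diagUnitary N z * V⁻¹) =
      Finset.univ.val.map fun j => toIcoMod Real.two_pi_pos 0 (Complex.arg (z j)) := by
  have h : (torusCharpoly z).roots = Finset.univ.val.map fun j => (z j : ℂ) := by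
    have := Polynomial.roots_multiset_prod_X_sub_C (Finset.univ.val.map fun j => (z j : ℂ))
    rw [Multiset.map_map] at this
    exact this
  rw [eigenangles, charpoly_conj, coe_diagUnitary, Matrix.charpoly_diagonal]
  change ((torusCharpoly z).roots).map _ = _
  rw [h, Multiset.map_map]
  rfl

lemma exp_toIcoMod_arg (z : Circle) :
    Complex.exp (Complex.I * (toIcoMod Real.two_pi_pos 0 (Complex.arg z) : ℝ)) = z := by
  have h1 : toIcoMod Real.two_pi_pos 0 (Complex.arg z) = Complex.arg z -
      toIcoDiv Real.two_pi_pos 0 (Complex.arg z) • (2 * Real.pi) := rfl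
  rw [h1]
  push_cast
  rw [mul_sub, Complex.exp_sub]
  have h2 : Complex.exp (Complex.I * (toIcoDiv Real.two_pi_pos 0 (Complex.arg z) • (2 * Real.pi) : ℝ))
      = 1 := by
    rw [zsmul_eq_mul]
    push_cast
    rw [← Complex.exp_int_mul_two_pi_mul_I (toIcoDiv Real.two_pi_pos 0 (Complex.arg z))]
    congr 1
    ring
  have h3 : Complex.exp (Complex.I * Complex.arg (z : ℂ)) = z := by
    have := congrArg (fun w : Circle => (w : ℂ)) (Circle.exp_arg z)
    simp only [Circle.coe_exp] at this
    rw [mul_comm]; exact this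
  rw [h3]
  push_cast at h2
  rw [h2, div_one]

lemma charZ_conj_diagUnitary (V : Matrix.unitaryGroup (Fin N) ℂ) (z : Fin N → Circle) (θ : ℝ) :
    charZ (V * diagUnitary N z * V⁻¹) θ = ∏ j, (1 - Complex.exp (-(Complex.I * θ)) * z j) := by
  rw [charZ, eigenangles_conj_diagUnitary, Multiset.map_map, Finset.prod]
  congr 1
  refine Multiset.map_congr rfl fun j _ => ?_
  simp only [Function.comp_apply]
  have (a : ℂ) : Complex.exp (Complex.I * (a - θ)) =
      Complex.exp (-(Complex.I * θ)) * Complex.exp (Complex.I * a) := by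
    rw [← Complex.exp_add]
    ring_nf
  rw [this, exp_toIcoMod_arg]

lemma norm_charV_zero (V : Matrix.unitaryGroup (Fin N) ℂ) (z : Fin N → Circle) :
    ‖charV (V * diagUnitary N z * V⁻¹) 0‖ = ‖(torusCharpoly z).eval 1‖ := by
  rw [charV, charZ_conj_diagUnitary, torusCharpoly_eval_one, norm_mul, Complex.norm_exp]
  simp

/-- The phase contributes (iN/2)χ(1), and the product contributes i ∑_j z_j ∏_{i≠j}(1 - z_i).
Writing z_j = 1 - (1 - z_j) turns the latter into i(χ'(1) - Nχ(1)). The common factor is unimodular.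
-/
lemma norm_deriv_charV_zero (V : Matrix.unitaryGroup (Fin N) ℂ) (z : Fin N → Circle) :
    ‖deriv (charV (V * diagUnitary N z * V⁻¹)) 0‖ =
      ‖(torusCharpoly z).derivative.eval 1 - N / 2 * (torusCharpoly z).eval 1‖ := by
  set S := (eigenangles (V * diagUnitary N z * V⁻¹)).sum
  have hid : HasDerivAt (fun θ : ℝ => (θ : ℂ)) 1 0 := Complex.ofRealCLM.hasDerivAt
  have h1 : HasDerivAt (fun θ : ℝ => Complex.exp (Complex.I * (N : ℂ) / 2 *
      ((θ : ℂ) + (Real.pi : ℂ)) - Complex.I / 2 * (S : ℂ))) _ 0 :=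
    (((hid.add_const (Real.pi : ℂ)).const_mul (Complex.I * (N : ℂ) / 2)).sub_const
      (Complex.I / 2 * (S : ℂ))).cexp
  have h2 : HasDerivAt (fun θ : ℝ => ∏ j, (1 - Complex.exp (-(Complex.I * θ)) * z j)) _ 0 :=
    HasDerivAt.fun_finsetProd (u := Finset.univ) fun j _ =>
      (((hid.const_mul Complex.I).fun_neg.cexp).mul_const (z j : ℂ)).const_sub 1
  have h3 := h1.fun_mul h2
  have h4 : charV (V * diagUnitary N z * V⁻¹) = fun θ : ℝ => Complex.exp (Complex.I * (N : ℂ) / 2 *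
      ((θ : ℂ) + (Real.pi : ℂ)) - Complex.I / 2 * (S : ℂ)) *
        ∏ j, (1 - Complex.exp (-(Complex.I * θ)) * z j) := by
    funext θ
    rw [charV, charZ_conj_diagUnitary]
  rw [h4, h3.deriv]
  set e := Complex.exp (Complex.I * (N : ℂ) / 2 *
      (((0 : ℝ) : ℂ) + (Real.pi : ℂ)) - Complex.I / 2 * (S : ℂ)) with he
  have hen : ‖e‖ = 1 := by rw [he, Complex.norm_exp]; simp
  rw [torusCharpoly_derivative_eval_one, torusCharpoly_eval_one]
  have h5 : ∀ j, (∏ i ∈ Finset.univ.erase j, (1 - (z i : ℂ))) * z j =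
      (∏ i ∈ Finset.univ.erase j, (1 - (z i : ℂ))) - ∏ i, (1 - (z i : ℂ)) := fun j => by
    rw [← Finset.mul_prod_erase Finset.univ (fun i => 1 - (z i : ℂ)) (Finset.mem_univ j)]
    ring
  have h6 : ∑ j, (∏ i ∈ Finset.univ.erase j, (1 - (z i : ℂ))) * z j =
      (∑ j, ∏ i ∈ Finset.univ.erase j, (1 - (z i : ℂ))) - N * ∏ i, (1 - (z i : ℂ)) := by
    simp only [h5, Finset.sum_sub_distrib]
    simp
  have h7 : ∀ D P : ℂ, ‖e * (Complex.I * (D - N * P) + Complex.I * N / 2 * P)‖ =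
      ‖D - N / 2 * P‖ := fun D P => by
    rw [norm_mul, hen, one_mul, show Complex.I * (D - N * P) + Complex.I * N / 2 * P =
      Complex.I * (D - N / 2 * P) by ring, norm_mul, Complex.norm_I, one_mul]
  rw [← h7, ← h6]
  congr 1
  simp only [Complex.ofReal_zero, mul_zero, neg_zero, Complex.exp_zero, one_mul, mul_one]
  have h8 : ∀ j, (∏ i ∈ Finset.univ.erase j, (1 - (z i : ℂ))) • -(-Complex.I * (z j : ℂ)) =
      Complex.I * ((∏ i ∈ Finset.univ.erase j, (1 - (z i : ℂ))) * z j) := fun j => by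
    rw [smul_eq_mul]; ring
  simp only [h8, ← Finset.mul_sum]
  ring

/-- The joint moment integrand as a function of the power traces. -/
theorem exists_measurable_jointMomentIntegrand (N : ℕ) (s h : ℂ) :
    ∃ G : (ℤ → ℂ) → ℂ, Measurable G ∧ (∀ A, jointMomentIntegrand N s h A = G (powerTrace A)) ∧
      ∀ z : Fin N → Circle, G (torusTrace z) =
        (‖(torusCharpoly z).eval 1‖ : ℂ) ^ (2 * (s - h)) *
        (‖(torusCharpoly z).derivative.eval 1 - N / 2 * (torusCharpoly z).eval 1‖ : ℂ) ^ (2 * h) := by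
  obtain ⟨E, E', hE⟩ := exists_aeval_eq_torusCharpoly N
  have hm : ∀ r : PowerSumRing, Measurable fun p : ℤ → ℂ => MvPolynomial.aeval p r := fun r =>
    (continuous_aeval (p := fun p : ℤ → ℂ => p) continuous_apply r).measurable
  refine ⟨fun p => (‖MvPolynomial.aeval p E‖ : ℂ) ^ (2 * (s - h)) *
    (‖MvPolynomial.aeval p E' - N / 2 * MvPolynomial.aeval p E‖ : ℂ) ^ (2 * h), ?_, fun A => ?_,
    fun z => by simp only [(hE z).1, (hE z).2]⟩
  · exact ((Complex.measurable_ofReal.comp (hm E).norm).pow_const _).mul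
      ((Complex.measurable_ofReal.comp ((hm E').sub ((hm E).const_mul _)).norm).pow_const _)
  · obtain ⟨V, z, rfl⟩ := exists_diagonalization A
    rw [jointMomentIntegrand, norm_charV_zero, norm_deriv_charV_zero, powerTrace_conj,
      powerTrace_diagUnitary]
    simp only [(hE z).1, (hE z).2]

end ClassFunctions

/-! ### The integrand in Cayley coordinates -/

section CayleyCoordinates
variable {N : ℕ}

lemma one_sub_cayley (x : ℝ) : 1 - (cayley x : ℂ) = -2 * Complex.I / (x - Complex.I) := by
  have := ofReal_sub_I_ne_zero x
  rw [coe_cayley]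
  field_simp
  ring

lemma one_sub_cayley_ne_zero (x : ℝ) : 1 - (cayley x : ℂ) ≠ 0 := by
  rw [one_sub_cayley]
  exact div_ne_zero (by simp) (ofReal_sub_I_ne_zero x)

lemma norm_one_sub_cayley_sq (x : ℝ) : ‖1 - (cayley x : ℂ)‖ ^ 2 = 4 / (1 + x ^ 2) := by
  rw [one_sub_cayley, norm_div, div_pow, ← Complex.normSq_eq_norm_sq, ← Complex.normSq_eq_norm_sq]
  simp [Complex.normSq_apply]
  ring

/-- Since 1/(1 - z_j) = (1 + i x_j)/2, the logarithmic derivative of the characteristic polynomial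
at 1 is N/2 + (i/2) ∑ x_j. The phase of V removes exactly the N/2, which leaves a linear statistic.
-/
lemma torusCharpoly_cayleyPi_derivative (x : Fin N → ℝ) :
    (torusCharpoly (cayleyPi x)).derivative.eval 1 -
      N / 2 * (torusCharpoly (cayleyPi x)).eval 1 =
      (torusCharpoly (cayleyPi x)).eval 1 * (Complex.I / 2 * ((∑ j, x j : ℝ) : ℂ)) := by
  rw [torusCharpoly_derivative_eval_one, torusCharpoly_eval_one]
  have h : ∀ j, ∏ i ∈ Finset.univ.erase j, (1 - (cayleyPi x i : ℂ)) =
      (∏ i, (1 - (cayleyPi x i : ℂ))) * ((1 + Complex.I * x j) / 2) := by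
    intro j
    rw [← Finset.prod_erase_mul Finset.univ (fun i => 1 - (cayleyPi x i : ℂ)) (Finset.mem_univ j),
      mul_assoc]
    have : (1 - (cayleyPi x j : ℂ)) * ((1 + Complex.I * x j) / 2) = 1 := by
      rw [cayleyPi, one_sub_cayley]
      have := ofReal_sub_I_ne_zero (x j)
      field_simp
      linear_combination (-(x j : ℂ)) * Complex.I_sq
    rw [this, mul_one]
  simp only [h]
  rw [← Finset.mul_sum]
  have h2 : ∑ j, (1 + Complex.I * (x j : ℂ)) / 2 = N / 2 + Complex.I / 2 * ((∑ j, x j : ℝ) : ℂ) := by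
    rw [← Finset.sum_div, Finset.sum_add_distrib, ← Finset.mul_sum]
    simp
    ring
  rw [h2]
  ring

/-- The density `∏_j (4 / (1 + x_j ^ 2)) ^ s`, in Cayley coordinates, of `|det (1 - A)| ^ (2 s)`. -/
noncomputable def cayleyDensity (s : ℂ) (x : Fin N → ℝ) : ℂ :=
  ∏ j, ((4 / (1 + x j ^ 2) : ℝ) : ℂ) ^ s

lemma ofReal_cpow_two_mul {r : ℝ} (hr : 0 < r) (s : ℂ) :
    (r : ℂ) ^ (2 * s) = ((r ^ 2 : ℝ) : ℂ) ^ s := by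
  rw [Complex.cpow_def_of_ne_zero (Complex.ofReal_ne_zero.mpr hr.ne'),
    Complex.cpow_def_of_ne_zero (Complex.ofReal_ne_zero.mpr (pow_pos hr 2).ne'),
    ← Complex.ofReal_log hr.le, ← Complex.ofReal_log (pow_pos hr 2).le, Real.log_pow]
  congr 1
  push_cast
  ring

lemma norm_torusCharpoly_cayleyPi_cpow (s : ℂ) (x : Fin N → ℝ) :
    (‖(torusCharpoly (cayleyPi x)).eval 1‖ : ℂ) ^ (2 * s) = cayleyDensity s x := by
  have hpos : 0 < ‖∏ j, (1 - (cayleyPi x j : ℂ))‖ :=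
    norm_pos_iff.mpr (Finset.prod_ne_zero_iff.mpr fun j _ => one_sub_cayley_ne_zero (x j))
  rw [torusCharpoly_eval_one, ofReal_cpow_two_mul hpos, norm_prod, ← Finset.prod_pow, cayleyDensity]
  simp only [cayleyPi, norm_one_sub_cayley_sq]
  have h2 : ∀ t : Finset (Fin N), ((∏ j ∈ t, (4 / (1 + x j ^ 2)) : ℝ) : ℂ) ^ s =
      ∏ j ∈ t, ((4 / (1 + x j ^ 2) : ℝ) : ℂ) ^ s := fun t => by
    induction t using Finset.induction_on with
    | empty => simp
    | insert j t hj ih =>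
      rw [Finset.prod_insert hj, Finset.prod_insert hj, Complex.ofReal_mul,
        Complex.mul_cpow_ofReal_nonneg (by positivity) (Finset.prod_nonneg fun _ _ => by positivity),
        ih]
  exact h2 _

/-- The derivative factor is |V| · |∑ x_j|/2, so the powers of |V| combine to 2(s - h) + 2h = 2s. -/
lemma integrand_cayleyPi (s h : ℂ) (x : Fin N → ℝ) :
    (‖(torusCharpoly (cayleyPi x)).eval 1‖ : ℂ) ^ (2 * (s - h)) *
      (‖(torusCharpoly (cayleyPi x)).derivative.eval 1 -
        N / 2 * (torusCharpoly (cayleyPi x)).eval 1‖ : ℂ) ^ (2 * h) =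
      cayleyDensity s x * ((2 : ℂ) ^ (-(2 * h)) * ((|∑ j, x j| : ℝ) : ℂ) ^ (2 * h)) := by
  have hne : (‖(torusCharpoly (cayleyPi x)).eval 1‖ : ℂ) ≠ 0 := by
    rw [Complex.ofReal_ne_zero, norm_ne_zero_iff, torusCharpoly_eval_one]
    exact Finset.prod_ne_zero_iff.mpr fun j _ => one_sub_cayley_ne_zero _
  have hn : ‖Complex.I / 2 * ((∑ j, x j : ℝ) : ℂ)‖ = 2⁻¹ * |∑ j, x j| := by
    rw [norm_mul, Complex.norm_real, Real.norm_eq_abs]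
    simp
  have h2 : ((2⁻¹ : ℝ) : ℂ) ^ (2 * h) = (2 : ℂ) ^ (-(2 * h)) := by
    rw [Complex.cpow_neg, Complex.ofReal_inv, Complex.ofReal_ofNat, Complex.inv_cpow]
    rw [Complex.ofNat_arg]
    exact Real.pi_pos.ne
  rw [torusCharpoly_cayleyPi_derivative, norm_mul, hn, Complex.ofReal_mul,
    Complex.mul_cpow_ofReal_nonneg (norm_nonneg _) (by positivity), Complex.ofReal_mul,
    Complex.mul_cpow_ofReal_nonneg (by positivity) (abs_nonneg _), h2,
    ← mul_assoc, ← Complex.cpow_add _ _ hne, ← norm_torusCharpoly_cayleyPi_cpow]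
  congr 2
  ring

/-- The weight of the joint moments in Cayley coordinates. -/
noncomputable def cayleyWeight (s : ℂ) (x : Fin N → ℝ) : ℂ :=
  torusWeight (cayleyPi x) * cayleyDensity s x

theorem jointMoment_eq_integral (N : ℕ) (s h : ℂ) :
    jointMoment N s h = (2 : ℂ) ^ (-(2 * h)) * (N.factorial : ℂ)⁻¹ *
      ∫ x, cayleyWeight s x * ((|∑ j, x j| : ℝ) : ℂ) ^ (2 * h) ∂(cauchyPi N) := by
  obtain ⟨G, hG, hU, hT⟩ := exists_measurable_jointMomentIntegrand N s h
  rw [jointMoment]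
  simp only [hU]
  rw [integral_comp_powerTrace hG]
  simp only [hT, integrand_cayleyPi]
  rw [mul_assoc, mul_left_comm, ← integral_const_mul ((2 : ℂ) ^ (-(2 * h)))]
  congr 1
  refine integral_congr_ae (Eventually.of_forall fun x => ?_)
  simp only [cayleyWeight]
  ring

theorem integrable_jointMomentIntegrand_of {s h : ℂ}
    (hi : Integrable (fun x => cayleyWeight s x * ((|∑ j, x j| : ℝ) : ℂ) ^ (2 * h)) (cauchyPi N)) :
    Integrable (jointMomentIntegrand N s h) (unitaryHaar N) := by
  obtain ⟨G, hG, hU, hT⟩ := exists_measurable_jointMomentIntegrand N s h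
  rw [funext hU]
  refine integrable_comp_powerTrace hG ((hi.const_mul ((2 : ℂ) ^ (-(2 * h)))).congr
    (Eventually.of_forall fun x => ?_))
  simp only [hT, integrand_cayleyPi, cayleyWeight]
  ring

end CayleyCoordinates

end

/-! ### The Fourier transform of ∑ x_j as a Hankel determinant -/

section

open PowerSumRing

section HankelFormula
variable {N : ℕ}

lemma prod_Ioi_const {M : Type*} [CommMonoid M] (N : ℕ) (c : M) :
    ∏ i : Fin N, ∏ _j ∈ Finset.Ioi i, c = c ^ (N * (N - 1) / 2) := by
  simp only [Finset.prod_const, Fin.card_Ioi]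
  rw [Finset.prod_pow_eq_pow_sum, Fin.sum_univ_eq_sum_range (fun i => N - 1 - i),
    Finset.sum_range_reflect (fun i => i), Finset.sum_range_id]

lemma prod_Ioi_mul {M : Type*} [CommMonoid M] (a : Fin N → M) :
    ∏ i, ∏ j ∈ Finset.Ioi i, a i * a j = ∏ i, a i ^ (N - 1) := by
  rw [Finset.prod_prod_Ioi_mul_eq_prod_prod_off_diag fun _ i => a i]
  simp [Finset.card_compl]

lemma norm_cayley_sub_cayley_sq (x y : ℝ) :
    ‖(cayley x : ℂ) - cayley y‖ ^ 2 = 4 * (x - y) ^ 2 / ((1 + y ^ 2) * (1 + x ^ 2)) := by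
  have h : (cayley x : ℂ) - cayley y =
      2 * Complex.I * ((y - x : ℝ) : ℂ) / ((x - Complex.I) * (y - Complex.I)) := by
    have := ofReal_sub_I_ne_zero x
    have := ofReal_sub_I_ne_zero y
    rw [coe_cayley, coe_cayley]
    push_cast
    field_simp
    ring
  have hn : ∀ x : ℝ, ‖(x : ℂ) - Complex.I‖ ^ 2 = 1 + x ^ 2 := fun x => by
    rw [← Complex.normSq_eq_norm_sq]
    simp [Complex.normSq_apply]
    ring
  rw [h, norm_div, norm_mul, norm_mul, norm_mul, div_pow, mul_pow, mul_pow, mul_pow, hn, hn, Complex.norm_real,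
    Real.norm_eq_abs, sq_abs]
  simp
  ring

/-- The Vandermonde determinant is taken in powers of 1 - ix rather than x: multiplying the
one-dimensional weight by (1 - ix)^{j+k} merely lowers its second exponent. The price is a factor i²
for each pair, hence -4 in place of 4. -/
lemma torusWeight_cayleyPi (x : Fin N → ℝ) :
    torusWeight (cayleyPi x) = (-4) ^ (N * (N - 1) / 2) *
      (∏ i, ((1 + x i ^ 2 : ℝ) : ℂ) ^ (N - 1))⁻¹ *
      ((Matrix.of fun j k : Fin N => (1 - Complex.I * x k) ^ (j : ℕ)).det *
        (Matrix.of fun j k : Fin N => (1 - Complex.I * x k) ^ (j : ℕ)).det) := by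
  have h1 : (Matrix.of fun j k : Fin N => (1 - Complex.I * x k) ^ (j : ℕ)).det =
      ∏ i, ∏ j ∈ Finset.Ioi i, ((1 - Complex.I * x j) - (1 - Complex.I * x i)) := by
    rw [← Matrix.det_vandermonde, ← Matrix.det_transpose]
    rfl
  rw [torusWeight_eq, h1, ← prod_Ioi_const, ← prod_Ioi_mul]
  push_cast
  simp only [← Finset.prod_inv_distrib, ← Finset.prod_mul_distrib]
  refine Finset.prod_congr rfl fun i _ => Finset.prod_congr rfl fun j _ => ?_
  rw [← Complex.ofReal_pow, cayleyPi, cayleyPi, norm_cayley_sub_cayley_sq]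
  push_cast
  rw [div_eq_mul_inv]
  linear_combination (4 * ((x j : ℂ) - x i) ^ 2 * ((1 + (x i : ℂ) ^ 2) * (1 + (x j : ℂ) ^ 2))⁻¹) *
    Complex.I_sq

lemma ofReal_div_cpow {p q : ℝ} (hp : 0 < p) (hq : 0 < q) (s : ℂ) :
    ((p / q : ℝ) : ℂ) ^ s = (p : ℂ) ^ s * (q : ℂ) ^ (-s) := by
  rw [Complex.cpow_def_of_ne_zero (Complex.ofReal_ne_zero.mpr (div_pos hp hq).ne'),
    Complex.cpow_def_of_ne_zero (Complex.ofReal_ne_zero.mpr hp.ne'),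
    Complex.cpow_def_of_ne_zero (Complex.ofReal_ne_zero.mpr hq.ne'), ← Complex.exp_add,
    ← Complex.ofReal_log hp.le, ← Complex.ofReal_log hq.le, ← Complex.ofReal_log (div_pos hp hq).le,
    Real.log_div hp.ne' hq.ne']
  congr 1
  push_cast
  ring

lemma cauchyWeight_self (a : ℂ) (x : ℝ) :
    cauchyWeight a a x = ((1 + x ^ 2 : ℝ) : ℂ) ^ (-a) := by
  have h0 : 0 < 1 + x ^ 2 := by positivity
  have hc : 1 - Complex.I * x = starRingEnd ℂ (1 + Complex.I * x) := by simp [sub_eq_add_neg]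
  have harg : (1 + Complex.I * x).arg ≠ Real.pi :=
    Complex.slitPlane_arg_ne_pi (one_add_I_mul_mem_slitPlane x)
  rw [cauchyWeight, Complex.cpow_def_of_ne_zero (one_add_I_mul_ne_zero x),
    Complex.cpow_def_of_ne_zero (one_sub_I_mul_ne_zero x),
    Complex.cpow_def_of_ne_zero (Complex.ofReal_ne_zero.mpr h0.ne'), ← Complex.exp_add, ← add_mul,
    hc, Complex.log_conj _ harg, Complex.add_conj, Complex.log_re, norm_one_add_I_mul,
    Real.log_rpow h0, ← Complex.ofReal_log h0.le]
  congr 3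
  ring

lemma cauchyWeight_sub_natCast (a b : ℂ) (n : ℕ) (x : ℝ) :
    cauchyWeight a (b - n) x = cauchyWeight a b x * (1 - Complex.I * x) ^ n := by
  rw [cauchyWeight, cauchyWeight, show -(b - n) = -b + n by ring,
    Complex.cpow_add _ _ (one_sub_I_mul_ne_zero x), Complex.cpow_natCast, mul_assoc]

/-- The exponents of 1/(1 + x²) add up to s + N: s from the density, N - 1 from the Vandermonde
factor and 1 from the Cauchy distribution. -/
lemma cauchy_density_mul_eq (hN : 1 ≤ N) (s : ℂ) (t : ℝ) (m n : ℕ) (x : ℝ) :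
    (((Real.pi * (1 + x ^ 2))⁻¹ : ℝ) : ℂ) *
      (((4 / (1 + x ^ 2) : ℝ) : ℂ) ^ s * (((1 + x ^ 2 : ℝ) : ℂ) ^ (N - 1))⁻¹ *
        Complex.exp (Complex.I * t * x) * (1 - Complex.I * x) ^ m * (1 - Complex.I * x) ^ n) =
      (4 : ℂ) ^ s / Real.pi * (cauchyWeight (s + N) (s + N - m - n) x *
        Complex.exp (Complex.I * t * x)) := by
  have h0 : 0 < 1 + x ^ 2 := by positivity
  have h0C : ((1 + x ^ 2 : ℝ) : ℂ) ≠ 0 := Complex.ofReal_ne_zero.mpr h0.ne'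
  have hpi : (Real.pi : ℂ) ≠ 0 := Complex.ofReal_ne_zero.mpr Real.pi_ne_zero
  rw [cauchyWeight_sub_natCast, cauchyWeight_sub_natCast, cauchyWeight_self,
    ofReal_div_cpow (by norm_num) h0, neg_add, Complex.cpow_add _ _ h0C, Complex.cpow_neg _ (N : ℂ),
    Complex.cpow_natCast, Complex.ofReal_inv, Complex.ofReal_mul Real.pi]
  obtain ⟨M, rfl⟩ : ∃ M, N = M + 1 := ⟨N - 1, by omega⟩
  rw [Nat.add_sub_cancel, pow_succ _ M]
  generalize ((1 + x ^ 2 : ℝ) : ℂ) ^ (-s) = A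
  generalize ((1 + x ^ 2 : ℝ) : ℂ) = B at h0C ⊢
  generalize Complex.exp (Complex.I * t * x) = E
  generalize (1 - Complex.I * x) ^ m = P
  generalize (1 - Complex.I * x) ^ n = Q
  push_cast
  field_simp

/-- All factors that split over coordinates are absorbed into the columns of one of the two
determinants, the shape required by Andréief's identity. -/
lemma cayleyWeight_mul_exp_eq (s : ℂ) (t : ℝ) (x : Fin N → ℝ) :
    cayleyWeight s x * Complex.exp (Complex.I * t * ((∑ j, x j : ℝ) : ℂ)) =
      (-4) ^ (N * (N - 1) / 2) *
      ((Matrix.of fun j k : Fin N => ((4 / (1 + x k ^ 2) : ℝ) : ℂ) ^ s *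
        (((1 + x k ^ 2 : ℝ) : ℂ) ^ (N - 1))⁻¹ * Complex.exp (Complex.I * t * x k) *
          (1 - Complex.I * x k) ^ (j : ℕ)).det *
        (Matrix.of fun j k : Fin N => (1 - Complex.I * x k) ^ (j : ℕ)).det) := by
  have e : (Matrix.of fun j k : Fin N => ((4 / (1 + x k ^ 2) : ℝ) : ℂ) ^ s *
        (((1 + x k ^ 2 : ℝ) : ℂ) ^ (N - 1))⁻¹ * Complex.exp (Complex.I * t * x k) *
          (1 - Complex.I * x k) ^ (j : ℕ)).det =
      (∏ k, ((4 / (1 + x k ^ 2) : ℝ) : ℂ) ^ s * (((1 + x k ^ 2 : ℝ) : ℂ) ^ (N - 1))⁻¹ *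
        Complex.exp (Complex.I * t * x k)) *
      (Matrix.of fun j k : Fin N => (1 - Complex.I * x k) ^ (j : ℕ)).det :=
    Matrix.det_mul_row _ _
  rw [e, cayleyWeight,
    torusWeight_cayleyPi, cayleyDensity, Finset.prod_mul_distrib, Finset.prod_mul_distrib,
    Complex.ofReal_sum, Finset.mul_sum, Complex.exp_sum, Finset.prod_inv_distrib]
  ring

theorem integral_cayleyWeight_mul_exp (hN : 1 ≤ N) {s : ℂ} (hs : -(1 / 2) < s.re) (t : ℝ) :
    ∫ x : Fin N → ℝ, cayleyWeight s x * Complex.exp (Complex.I * t * ((∑ j, x j : ℝ) : ℂ))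
      ∂(cauchyPi N) = (-4) ^ (N * (N - 1) / 2) * (N.factorial *
        (Matrix.of fun j k : Fin N => (4 : ℂ) ^ s / Real.pi *
          cauchyFourier (s + N) (s + N - (j : ℕ) - (k : ℕ)) t).det) := by
  simp only [cayleyWeight_mul_exp_eq]
  rw [integral_const_mul, cauchyPi]
  congr 1
  have h := integral_det_mul_det (μ := ProbabilityTheory.cauchyMeasure 0 1) (N := N)
    (f := fun j x => ((4 / (1 + x ^ 2) : ℝ) : ℂ) ^ s * (((1 + x ^ 2 : ℝ) : ℂ) ^ (N - 1))⁻¹ *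
      Complex.exp (Complex.I * t * x) * (1 - Complex.I * x) ^ (j : ℕ))
    (g := fun k x => (1 - Complex.I * x) ^ (k : ℕ)) (by
      intro j k
      rw [integrable_cauchyMeasure_iff]
      simp only [cauchy_density_mul_eq hN]
      refine (integrable_cauchyWeight_mul_exp ?_ t).const_mul _
      have hj : ((j : ℕ) : ℝ) + 1 ≤ N := by exact_mod_cast j.2
      have hk : ((k : ℕ) : ℝ) + 1 ≤ N := by exact_mod_cast k.2
      simp
      linarith)
  rw [h]
  simp only [integral_cauchyMeasure, cauchy_density_mul_eq hN, integral_const_mul, cauchyFourier]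

theorem integral_cayleyWeight_mul_exp_eq_hankelJ (hN : 1 ≤ N) {s : ℂ} (hs : -(1 / 2) < s.re)
    {t : ℝ} (ht : 0 < t) :
    ∫ x : Fin N → ℝ, cayleyWeight s x * Complex.exp (Complex.I * t * ((∑ j, x j : ℝ) : ℂ))
      ∂(cauchyPi N) = N.factorial * ((-1) ^ (N * (N - 1) / 2) / Complex.Gamma (s + N) ^ N) *
        (Complex.exp (-((N : ℂ) * (t : ℂ))) * hankelJ N t s) := by
  have hN' : (1 : ℝ) ≤ N := by exact_mod_cast hN
  have hα : 0 < (s + N).re := by simp; linarith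
  have hΓ := Complex.Gamma_ne_zero_of_re_pos hα
  have hpi : (Real.pi : ℂ) ≠ 0 := Complex.ofReal_ne_zero.mpr Real.pi_ne_zero
  -- The constant in `kummerU_two_mul` contains 2^{2s+2N-j-k-1}. Its dependence on j and k is a
  -- product of a row factor and a column factor, which leave the determinant.
  have hentry : ∀ j k : Fin N, (4 : ℂ) ^ s / Real.pi *
      cauchyFourier (s + N) (s + N - (j : ℕ) - (k : ℕ)) t =
      (4 * Complex.exp (-t) / (Complex.Gamma (s + N) * 4 ^ N)) * (2 ^ (j : ℕ) * (2 ^ (k : ℕ) *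
        kummerU (1 - s - (N : ℂ))
          (2 - 2 * s - 2 * (N : ℂ) + ((j : ℕ) : ℂ) + ((k : ℕ) : ℂ)) (2 * t))) := by
    intro j k
    have hj : ((j : ℕ) : ℝ) + 1 ≤ N := by exact_mod_cast j.2
    have hk : ((k : ℕ) : ℝ) + 1 ≤ N := by exact_mod_cast k.2
    have h := kummerU_two_mul (β := s + N - (j : ℕ) - (k : ℕ)) hα (by simp; linarith) ht
    rw [show 1 - s - (N : ℂ) = 1 - (s + N) by ring, show 2 - 2 * s - 2 * (N : ℂ) + ((j : ℕ) : ℂ) +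
      ((k : ℕ) : ℂ) = 2 - (s + N) - (s + N - (j : ℕ) - (k : ℕ)) by ring, h, expCauchyFourier]
    have h2 : (2 : ℂ) ^ (s + N + (s + N - (j : ℕ) - (k : ℕ)) - 1) =
        (4 : ℂ) ^ s * 4 ^ N / (2 ^ (j : ℕ) * 2 ^ (k : ℕ) * 2) := by
      have e4 : (4 : ℂ) ^ s = 2 ^ (2 * s) := by
        have := ofReal_cpow_two_mul two_pos s
        norm_num at this
        exact this.symm
      rw [e4, show s + N + (s + N - (j : ℕ) - (k : ℕ)) - 1 =
        2 * s + ((2 * N : ℕ) : ℂ) - ((j : ℕ) : ℂ) - ((k : ℕ) : ℂ) - 1 by push_cast; ring,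
        Complex.cpow_sub _ _ two_ne_zero, Complex.cpow_sub _ _ two_ne_zero,
        Complex.cpow_sub _ _ two_ne_zero, Complex.cpow_add _ _ two_ne_zero, Complex.cpow_natCast,
        Complex.cpow_natCast, Complex.cpow_natCast, Complex.cpow_one, pow_mul]
      norm_num
      field_simp
    rw [h2, Complex.exp_neg]
    have := Complex.exp_ne_zero (t : ℂ)
    have h4 : (4 : ℂ) ^ s ≠ 0 := by simp [Complex.cpow_eq_zero_iff]
    generalize Complex.Gamma (s + N) = g at *
    generalize (4 : ℂ) ^ s = f at *
    generalize Complex.exp (t : ℂ) = e at *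
    field_simp
    ring
  rw [integral_cayleyWeight_mul_exp hN hs]
  simp only [hentry]
  have hdet : (Matrix.of fun j k : Fin N =>
      (4 * Complex.exp (-t) / (Complex.Gamma (s + N) * 4 ^ N)) * (2 ^ (j : ℕ) * (2 ^ (k : ℕ) *
        kummerU (1 - s - (N : ℂ))
          (2 - 2 * s - 2 * (N : ℂ) + ((j : ℕ) : ℂ) + ((k : ℕ) : ℂ)) (2 * t)))).det =
      (4 * Complex.exp (-t) / (Complex.Gamma (s + N) * 4 ^ N)) ^ N *
        (2 ^ (N * (N - 1) / 2) * (2 ^ (N * (N - 1) / 2) * hankelJ N t s)) := by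
    have h2 : ∏ j : Fin N, (2 : ℂ) ^ (j : ℕ) = 2 ^ (N * (N - 1) / 2) := by
      rw [Finset.prod_pow_eq_pow_sum, Fin.sum_univ_eq_sum_range (fun i => i), Finset.sum_range_id]
    set K : Matrix (Fin N) (Fin N) ℂ := Matrix.of fun j k : Fin N =>
      kummerU (1 - s - (N : ℂ))
        (2 - 2 * s - 2 * (N : ℂ) + ((j : ℕ) : ℂ) + ((k : ℕ) : ℂ)) (2 * t) with hK
    have e1 := Matrix.det_mul_row (fun k : Fin N => (2 : ℂ) ^ (k : ℕ)) K
    have e2 := Matrix.det_mul_column (fun k : Fin N => (2 : ℂ) ^ (k : ℕ))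
      (Matrix.of fun i j : Fin N => (2 : ℂ) ^ (j : ℕ) * K i j)
    have e3 := Matrix.det_smul (Matrix.of fun i j : Fin N => (2 : ℂ) ^ (i : ℕ) *
      (Matrix.of fun i j : Fin N => (2 : ℂ) ^ (j : ℕ) * K i j) i j)
      (4 * Complex.exp (-t) / (Complex.Gamma (s + N) * 4 ^ N))
    rw [Fintype.card_fin] at e3
    rw [h2] at e1 e2
    rw [hankelJ, ← hK, ← e1, ← e2, ← e3]
    rfl
  rw [hdet]
  have hexp : Complex.exp (-((N : ℂ) * (t : ℂ))) = Complex.exp (-t) ^ N := by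
    rw [← Complex.exp_nat_mul]; ring_nf
  rw [hexp, show (-4 : ℂ) = (-1) * 2 ^ 2 by norm_num, show (4 : ℂ) = 2 ^ 2 by norm_num, mul_pow,
    div_pow, mul_pow, mul_pow]
  have hm : N * (N - 1) / 2 * 2 = N * (N - 1) := Nat.div_two_mul_two_of_even (Nat.even_mul_pred_self N)
  set m := N * (N - 1) / 2
  -- All powers of 2 cancel: with 2m = N(N - 1) the exponents satisfy 2m + 2N + 2m = 2N².
  have hp : ((2 : ℂ) ^ 2) ^ m * (((2 : ℂ) ^ 2) ^ N) * (2 ^ m * 2 ^ m) = (((2 : ℂ) ^ 2) ^ N) ^ N := by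
    simp only [← pow_mul, ← pow_add]
    congr 1
    have : N * N = N * (N - 1) + N := by
      obtain ⟨M, rfl⟩ : ∃ M, N = M + 1 := ⟨N - 1, by omega⟩
      simp; ring
    nlinarith
  have hne : (((2 : ℂ) ^ 2) ^ N) ^ N ≠ 0 := pow_ne_zero _ (pow_ne_zero _ (by norm_num))
  have hΓN : Complex.Gamma (s + N) ^ N ≠ 0 := pow_ne_zero _ hΓ
  generalize Complex.Gamma (s + N) ^ N = g at *
  rw [← hp] at hne ⊢
  generalize (((2 : ℂ) ^ 2) ^ m) = a at *
  generalize ((2 : ℂ) ^ m) = b at *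
  generalize (((2 : ℂ) ^ 2) ^ N) = c at *
  have ha : a ≠ 0 := by rintro rfl; simp at hne
  have hb : b ≠ 0 := by rintro rfl; simp at hne
  have hc : c ≠ 0 := by rintro rfl; simp at hne
  field_simp

end HankelFormula

end

/-! ### Integrability and reflection symmetry -/

section

open PowerSumRing

section Integrability
variable {N : ℕ}

/-- Including the Cauchy density, the integrand is a multiple of (1 + x²)^{-(σ+1-a)}, integrable
since 2(σ + 1 - a) > 1. -/
lemma integrable_cauchyMeasure_rpow {σ a : ℝ} (h : a < σ + 1 / 2) :
    Integrable (fun x : ℝ => (((4 / (1 + x ^ 2)) ^ σ * (1 + x ^ 2) ^ a : ℝ) : ℂ))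
      (ProbabilityTheory.cauchyMeasure 0 1) := by
  rw [integrable_cauchyMeasure_iff]
  have h1 : Integrable (fun x : ℝ => Complex.ofReal
      (4 ^ σ / Real.pi * (1 + x ^ 2) ^ (-(2 * (σ + 1 - a)) / 2))) := ((integrable_one_add_sq_rpow (r := 2 * (σ + 1 - a)) (by linarith)).const_mul
    (4 ^ σ / Real.pi)).ofReal (𝕜 := ℂ)
  refine h1.congr (Eventually.of_forall fun x => ?_)
  have h0 : 0 < 1 + x ^ 2 := by positivity
  simp only
  rw [← Complex.ofReal_mul, show -(2 * (σ + 1 - a)) / 2 = -σ + (-1) + a by ring,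
    Real.rpow_add h0, Real.rpow_add h0, Real.rpow_neg_one, Real.div_rpow (by norm_num) h0.le,
    Real.rpow_neg h0.le]
  refine congrArg Complex.ofReal ?_
  have := Real.pi_ne_zero
  have := (Real.rpow_pos_of_pos h0 σ).ne'
  field_simp

lemma integrable_prod_rpow {σ : ℝ} {a : Fin N → ℝ} (h : ∀ j, a j < σ + 1 / 2) :
    Integrable (fun x : Fin N → ℝ => ∏ j, ((4 / (1 + x j ^ 2)) ^ σ * (1 + x j ^ 2) ^ a j))
      (cauchyPi N) := by
  have h1 := (Integrable.fintype_prod (μ := fun _ : Fin N => ProbabilityTheory.cauchyMeasure 0 1)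
    (f := fun j x => (((4 / (1 + x ^ 2)) ^ σ * (1 + x ^ 2) ^ a j : ℝ) : ℂ))
    fun j => integrable_cauchyMeasure_rpow (h j)).re
  refine h1.congr (Eventually.of_forall fun x => ?_)
  simp only
  rw [← Complex.ofReal_prod]
  exact Complex.ofReal_re _

lemma norm_cayleyDensity (s : ℂ) (x : Fin N → ℝ) :
    ‖cayleyDensity s x‖ = ∏ j, (4 / (1 + x j ^ 2)) ^ s.re := by
  rw [cayleyDensity, norm_prod]
  exact Finset.prod_congr rfl fun j _ => Complex.norm_cpow_eq_rpow_re_of_pos (by positivity) _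

lemma exists_norm_torusWeight_le (N : ℕ) :
    ∃ B : ℝ, ∀ z : Fin N → Circle, ‖torusWeight z‖ ≤ B := by
  obtain ⟨B, hB⟩ := isCompact_univ.exists_bound_of_continuousOn
    (continuous_torusWeight (N := N)).continuousOn
  exact ⟨B, fun z => hB z trivial⟩

lemma measurable_cayleyWeight (s : ℂ) : Measurable (cayleyWeight (N := N) s) := by
  refine (continuous_torusWeight.comp continuous_cayleyPi).measurable.mul ?_
  unfold cayleyDensity
  fun_prop

lemma integrable_cayleyWeight {s : ℂ} (hs : -(1 / 2) < s.re) :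
    Integrable (cayleyWeight (N := N) s) (cauchyPi N) := by
  obtain ⟨B, hB⟩ := exists_norm_torusWeight_le N
  refine ((integrable_prod_rpow (N := N) (σ := s.re) (a := fun _ => 0)
    (fun _ => by linarith)).const_mul B).mono' (measurable_cayleyWeight s).aestronglyMeasurable
    (Eventually.of_forall fun x => ?_)
  rw [cayleyWeight, norm_mul, norm_cayleyDensity]
  simp only [Real.rpow_zero, mul_one]
  gcongr
  exact hB _

/-- (∑ x_j)² is at most N² times the largest 1 + x_k², and the largest power is at most the sum of
all of them. -/
lemma abs_sum_rpow_le (x : Fin N → ℝ) {η : ℝ} (hη : 0 < η) :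
    |∑ j, x j| ^ (2 * η) ≤ ((N : ℝ) ^ 2) ^ η * ∑ k, (1 + x k ^ 2) ^ η := by
  rcases Nat.eq_zero_or_pos N with rfl | hN
  · simp [Real.zero_rpow (by positivity : 2 * η ≠ 0)]
  have : Nonempty (Fin N) := ⟨⟨0, hN⟩⟩
  obtain ⟨k, -, hk⟩ := Finset.exists_max_image Finset.univ (fun j => 1 + x j ^ 2)
    Finset.univ_nonempty
  rw [Real.rpow_mul (abs_nonneg _), Real.rpow_two, sq_abs]
  have h1 : (∑ j, x j) ^ 2 ≤ (N : ℝ) ^ 2 * (1 + x k ^ 2) := by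
    have h2 := sq_sum_le_card_mul_sum_sq (s := Finset.univ) (f := x)
    have h3 : ∑ j, x j ^ 2 ≤ ∑ _j : Fin N, (1 + x k ^ 2) :=
      Finset.sum_le_sum fun j _ => by linarith [hk j (Finset.mem_univ j)]
    simp only [Finset.card_univ, Fintype.card_fin, Finset.sum_const, nsmul_eq_mul] at h2 h3
    nlinarith [(N.cast_nonneg : (0 : ℝ) ≤ N)]
  calc ((∑ j, x j) ^ 2) ^ η ≤ ((N : ℝ) ^ 2 * (1 + x k ^ 2)) ^ η := by gcongr
    _ = ((N : ℝ) ^ 2) ^ η * (1 + x k ^ 2) ^ η := Real.mul_rpow (by positivity) (by positivity)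
    _ ≤ _ := by
      gcongr
      exact Finset.single_le_sum (f := fun k => (1 + x k ^ 2) ^ η) (fun _ _ => by positivity)
        (Finset.mem_univ k)

/-- The bound on |∑ x_j| puts the growth into one coordinate at a time, so each dominating product
has a single factor with exponent Re h. That factor is where Re h < Re s + 1/2 is needed. -/
lemma integrable_cayleyWeight_mul_cpow {s h : ℂ} (hh : 0 < h.re) (hhs : h.re < s.re + 1 / 2) :
    Integrable (fun x => cayleyWeight s x * ((|∑ j, x j| : ℝ) : ℂ) ^ (2 * h)) (cauchyPi N) := by
  obtain ⟨B, hB⟩ := exists_norm_torusWeight_le N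
  have hB0 : 0 ≤ B := (norm_nonneg _).trans (hB 1)
  have hD : Integrable (fun x : Fin N → ℝ => B * (((N : ℝ) ^ 2) ^ h.re *
      ∑ k, ∏ j, ((4 / (1 + x j ^ 2)) ^ s.re * (1 + x j ^ 2) ^ (if j = k then h.re else 0))))
      (cauchyPi N) := by
    refine ((integrable_finsetSum _ fun k _ => integrable_prod_rpow fun j => ?_).const_mul
      _).const_mul _
    by_cases hj : j = k
    · subst hj; simpa using hhs
    · simp only [if_neg hj]; linarith
  refine hD.mono' ((measurable_cayleyWeight s).mul (by fun_prop)).aestronglyMeasurable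
    (Eventually.of_forall fun x => ?_)
  have h2 : (2 * h).re = 2 * h.re := by simp
  rw [cayleyWeight, norm_mul, norm_mul, norm_cayleyDensity,
    Complex.norm_cpow_eq_rpow_re_of_nonneg (abs_nonneg _) (by rw [h2]; positivity), h2, mul_assoc]
  have h3 : ∀ k, ∏ j, ((4 / (1 + x j ^ 2)) ^ s.re * (1 + x j ^ 2) ^ (if j = k then h.re else 0)) =
      (∏ j, (4 / (1 + x j ^ 2)) ^ s.re) * (1 + x k ^ 2) ^ h.re := by
    intro k
    rw [Finset.prod_mul_distrib]
    congr 1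
    rw [Finset.prod_eq_single k]
    · simp
    · intro j _ hj
      simp [hj]
    · simp
  simp only [h3, ← Finset.mul_sum]
  have h4 : 0 ≤ ∏ j, (4 / (1 + x j ^ 2)) ^ s.re := Finset.prod_nonneg fun _ _ => by positivity
  rw [mul_left_comm (((N : ℝ) ^ 2) ^ h.re)]
  have h5 := abs_sum_rpow_le x hh
  gcongr
  exact hB _

end Integrability

section Symmetry
variable {N : ℕ}

lemma cayleyWeight_neg (s : ℂ) (x : Fin N → ℝ) : cayleyWeight s (-x) = cayleyWeight s x := by
  rw [cayleyWeight, cayleyWeight, torusWeight_eq, torusWeight_eq]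
  have e : ∀ a b : ℝ, (-a - -b) ^ 2 = (a - b) ^ 2 := fun a b => by ring
  simp only [cayleyPi, cayleyDensity, norm_cayley_sub_cayley_sq, Pi.neg_apply, neg_sq, e]

lemma measurePreserving_neg_cauchyMeasure : MeasurePreserving (fun x : ℝ => -x)
    (ProbabilityTheory.cauchyMeasure 0 1) (ProbabilityTheory.cauchyMeasure 0 1) := by
  refine ⟨measurable_neg, ?_⟩
  ext A hA
  rw [Measure.map_apply measurable_neg hA,
    ProbabilityTheory.cauchyMeasure_of_scale_ne_zero _ one_ne_zero,
    withDensity_apply _ (measurable_neg hA), withDensity_apply _ hA,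
    ← (Measure.measurePreserving_neg (volume : Measure ℝ)).setLIntegral_comp_preimage hA
      (ProbabilityTheory.measurable_cauchyPDF 0 1)]
  refine lintegral_congr fun x => ?_
  simp [ProbabilityTheory.cauchyPDF, ProbabilityTheory.cauchyPDFReal_def]

lemma integral_comp_neg_cauchyPi (f : (Fin N → ℝ) → ℂ) :
    ∫ x, f (-x) ∂(cauchyPi N) = ∫ x, f x ∂(cauchyPi N) := by
  have h : MeasurePreserving (fun x : Fin N → ℝ => -x) (cauchyPi N) (cauchyPi N) :=
    measurePreserving_pi (fun _ => ProbabilityTheory.cauchyMeasure 0 1)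
      (fun _ => ProbabilityTheory.cauchyMeasure 0 1) (f := fun _ x => -x)
      fun _ => measurePreserving_neg_cauchyMeasure
  exact h.integral_comp (MeasurableEquiv.neg (Fin N → ℝ)).measurableEmbedding f

/-- Reflecting all coordinates preserves the Cauchy law and the weight, so the Fourier transform is
even. -/
lemma integral_cayleyWeight_mul_exp_neg (s : ℂ) (t : ℝ) :
    ∫ x : Fin N → ℝ, cayleyWeight s x * Complex.exp (Complex.I * ((-t : ℝ) : ℂ) *
      ((∑ j, x j : ℝ) : ℂ)) ∂(cauchyPi N) =
      ∫ x : Fin N → ℝ, cayleyWeight s x * Complex.exp (Complex.I * t * ((∑ j, x j : ℝ) : ℂ))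
        ∂(cauchyPi N) := by
  rw [← integral_comp_neg_cauchyPi]
  refine integral_congr_ae (Eventually.of_forall fun x => ?_)
  simp only [cayleyWeight_neg, Pi.neg_apply, Finset.sum_neg_distrib]
  push_cast
  congr 2
  ring

end Symmetry

end

/-! ### The regularised kernel and Parseval's formula -/

section

section Kernel

/-- The regularised power `|x| ^ κ e^{-ε|x|}`. -/
noncomputable def dampedPower (κ : ℂ) (ε x : ℝ) : ℂ :=
  ((|x| : ℝ) : ℂ) ^ κ * Complex.exp (-((ε : ℂ) * ((|x| : ℝ) : ℂ)))

lemma continuous_dampedPower {κ : ℂ} (hκ : 0 < κ.re) (ε : ℝ) : Continuous (dampedPower κ ε) := by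
  refine Continuous.mul ?_ (by fun_prop)
  exact (Complex.continuous_ofReal_cpow_const hκ).comp continuous_abs

lemma dampedPower_neg (κ : ℂ) (ε x : ℝ) : dampedPower κ ε (-x) = dampedPower κ ε x := by
  simp [dampedPower]

lemma dampedPower_mul_exp_of_pos (κ : ℂ) (ε t : ℝ) {x : ℝ} (hx : 0 < x) :
    Complex.exp (-(Complex.I * t * x)) * dampedPower κ ε x =
      (x : ℂ) ^ (κ + 1 - 1) * Complex.exp (-((ε + Complex.I * t) * x)) := by
  rw [dampedPower, abs_of_pos hx, add_sub_cancel_right, mul_left_comm, ← Complex.exp_add]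
  ring_nf

lemma integral_eq_add_integral_Ioi {f : ℝ → ℂ} (h1 : IntegrableOn f (Set.Ioi 0))
    (h2 : IntegrableOn (fun x => f (-x)) (Set.Ioi 0)) :
    Integrable f ∧ ∫ x, f x = (∫ x in Set.Ioi 0, f (-x)) + ∫ x in Set.Ioi 0, f x := by
  have h3 : IntegrableOn f (Set.Iic 0) := by
    rw [integrableOn_Iic_iff_integrableOn_Iio]
    refine ((Measure.measurePreserving_neg (volume : Measure ℝ)).integrableOn_comp_preimage
      (MeasurableEquiv.neg ℝ).measurableEmbedding).mp ?_
    have : Neg.neg ⁻¹' Set.Iio (0 : ℝ) = Set.Ioi 0 := by ext; simp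
    rw [this]
    exact h2
  refine ⟨?_, ?_⟩
  · rw [← integrableOn_univ, ← Set.Iic_union_Ioi (a := (0 : ℝ))]
    exact h3.union h1
  · rw [← setIntegral_univ, ← Set.Iic_union_Ioi (a := (0 : ℝ)),
      setIntegral_union (Set.Iic_disjoint_Ioi le_rfl) measurableSet_Ioi h3 h1,
      integral_comp_neg_Ioi, neg_zero]

/-- Splitting the line at 0 gives two Gamma integrals, with rates ε - it and ε + it. -/
lemma integrable_exp_mul_dampedPower {κ : ℂ} (hκ : 0 < κ.re) {ε : ℝ} (hε : 0 < ε) (t : ℝ) :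
    Integrable (fun x : ℝ => Complex.exp (-(Complex.I * t * x)) * dampedPower κ ε x) ∧
    ∫ x : ℝ, Complex.exp (-(Complex.I * t * x)) * dampedPower κ ε x =
      (ε + Complex.I * ((-t : ℝ) : ℂ)) ^ (-(κ + 1)) * Complex.Gamma (κ + 1) +
      (ε + Complex.I * t) ^ (-(κ + 1)) * Complex.Gamma (κ + 1) := by
  have ha : 0 < (κ + 1).re := by simp; linarith
  have hr : ∀ t : ℝ, 0 < ((ε : ℂ) + Complex.I * t).re := fun t => by simpa using hε
  have e1 : ∀ t : ℝ, Set.EqOn (fun x : ℝ => Complex.exp (-(Complex.I * t * x)) * dampedPower κ ε x)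
      (fun x => (x : ℂ) ^ (κ + 1 - 1) * Complex.exp (-((ε + Complex.I * t) * x))) (Set.Ioi 0) :=
    fun t x hx => dampedPower_mul_exp_of_pos κ ε t hx
  have e2 : (fun x : ℝ => Complex.exp (-(Complex.I * t * ((-x : ℝ) : ℂ))) * dampedPower κ ε (-x)) =
      fun x : ℝ => Complex.exp (-(Complex.I * ((-t : ℝ) : ℂ) * x)) * dampedPower κ ε x := by
    funext x
    rw [dampedPower_neg]
    push_cast
    ring_nf
  have hi : ∀ t : ℝ, IntegrableOn
      (fun x : ℝ => Complex.exp (-(Complex.I * t * x)) * dampedPower κ ε x) (Set.Ioi 0) := fun t =>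
    (integrableOn_congr_fun (e1 t) measurableSet_Ioi).mpr
      (integrableOn_cpow_mul_exp_neg_mul ha (hr t))
  have h := integral_eq_add_integral_Ioi (hi t) (by rw [e2]; exact hi (-t))
  refine ⟨h.1, ?_⟩
  rw [h.2, e2, setIntegral_congr_fun measurableSet_Ioi (e1 t),
    setIntegral_congr_fun measurableSet_Ioi (e1 (-t)),
    integral_cpow_mul_exp_neg_mul_Ioi_complex ha (hr t),
    integral_cpow_mul_exp_neg_mul_Ioi_complex ha (hr (-t))]

lemma integrable_dampedPower {κ : ℂ} (hκ : 0 < κ.re) {ε : ℝ} (hε : 0 < ε) :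
    Integrable (dampedPower κ ε) := by
  simpa using (integrable_exp_mul_dampedPower hκ hε 0).1

lemma two_pi_mul_kernelK (κ : ℂ) (ε t : ℝ) : 2 * Real.pi * kernelK κ ε t =
    ∫ x : ℝ, Complex.exp (-(Complex.I * t * x)) * dampedPower κ ε x := by
  rw [kernelK, ← mul_assoc, mul_one_div_cancel (by simp), one_mul]
  refine integral_congr_ae (Eventually.of_forall fun x => ?_)
  simp only [dampedPower]
  rw [mul_left_comm, ← Complex.exp_add]
  ring_nf

lemma kernelK_neg {κ : ℂ} (hκ : 0 < κ.re) {ε : ℝ} (hε : 0 < ε) (t : ℝ) :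
    kernelK κ ε (-t) = kernelK κ ε t := by
  have hpi : (2 * Real.pi : ℂ) ≠ 0 := by simp
  rw [← mul_right_inj' hpi, two_pi_mul_kernelK, two_pi_mul_kernelK,
    (integrable_exp_mul_dampedPower hκ hε _).2, (integrable_exp_mul_dampedPower hκ hε _).2,
    neg_neg, add_comm]

lemma ofReal_add_I_mul_cpow {ε : ℝ} (hε : 0 < ε) (a : ℂ) (t : ℝ) :
    ((ε : ℂ) + Complex.I * t) ^ (-a) = (ε : ℂ) ^ (-a) * cauchyWeight a 0 (t / ε) := by
  have hεC : (ε : ℂ) ≠ 0 := Complex.ofReal_ne_zero.mpr hε.ne'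
  have h1 : (ε : ℂ) + Complex.I * t = ε * (1 + Complex.I * ((t / ε : ℝ) : ℂ)) := by
    push_cast
    field_simp
  have hne := one_add_I_mul_ne_zero (t / ε)
  rw [h1, cauchyWeight, neg_zero, Complex.cpow_zero, mul_one,
    Complex.cpow_def_of_ne_zero (mul_ne_zero hεC hne), Complex.log_ofReal_mul hε hne,
    Complex.cpow_def_of_ne_zero hεC, Complex.cpow_def_of_ne_zero hne, ← Complex.exp_add, add_mul,
    Complex.ofReal_log hε.le]

/-- After scaling by ε the two terms are multiples of Cauchy weights with exponent κ + 1, and Re κ >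
0 makes them integrable. -/
lemma integrable_kernelK {κ : ℂ} (hκ : 0 < κ.re) {ε : ℝ} (hε : 0 < ε) :
    Integrable (kernelK κ ε) := by
  have hpi : (2 * Real.pi : ℂ) ≠ 0 := by simp
  have h1 : Integrable fun t : ℝ => ((ε : ℂ) + Complex.I * t) ^ (-(κ + 1)) := by
    simp only [ofReal_add_I_mul_cpow hε]
    exact ((integrable_cauchyWeight (by simpa using hκ)).comp_div hε.ne').const_mul _
  have h2 := (h1.comp_neg.mul_const (Complex.Gamma (κ + 1))).add
    (h1.mul_const (Complex.Gamma (κ + 1)))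
  refine (h2.const_mul (2 * Real.pi : ℂ)⁻¹).congr (Eventually.of_forall fun t => ?_)
  simp only [Pi.add_apply]
  rw [inv_mul_eq_iff_eq_mul₀ hpi, two_pi_mul_kernelK, (integrable_exp_mul_dampedPower hκ hε _).2]

/-- Fourier inversion for the kernel. -/
lemma integral_kernelK_mul_exp {κ : ℂ} (hκ : 0 < κ.re) {ε : ℝ} (hε : 0 < ε) (y : ℝ) :
    ∫ t : ℝ, kernelK κ ε t * Complex.exp (Complex.I * t * y) = dampedPower κ ε y := by
  have hpi : (2 * Real.pi : ℂ) ≠ 0 := by simp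
  have h := integral_exp_mul_fourier (f := dampedPower κ ε)
    (F := fun t => 2 * Real.pi * kernelK κ ε t) (integrable_dampedPower hκ hε)
    (fun t => two_pi_mul_kernelK κ ε t) ((integrable_kernelK hκ hε).const_mul _)
    (continuous_dampedPower hκ ε).continuousAt (y := y)
  rw [← mul_right_inj' hpi, ← h, ← integral_const_mul]
  exact integral_congr_ae (Eventually.of_forall fun t => by simp only; ring)

end Kernel

section FourierRepresentation
variable {Ω : Type*} [MeasurableSpace Ω] {P : Measure Ω}

/-- Parseval's formula for `∫ w |S| ^ κ e^{-ε|S|}` in terms of the kernel. -/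
lemma integral_mul_dampedPower [SFinite P] {w : Ω → ℂ} {S : Ω → ℝ} (hw : Integrable w P) (hS : Measurable S)
    {κ : ℂ} (hκ : 0 < κ.re) {ε : ℝ} (hε : 0 < ε) :
    Integrable (fun t : ℝ => kernelK κ ε t * ∫ ω, w ω * Complex.exp (Complex.I * t * S ω) ∂P) ∧
      ∫ t : ℝ, kernelK κ ε t * ∫ ω, w ω * Complex.exp (Complex.I * t * S ω) ∂P =
        ∫ ω, w ω * dampedPower κ ε (S ω) ∂P := by
  -- Fubini applies because the kernel is integrable in t, w is integrable in ω, and the exponential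
  -- is unimodular.
  have hprod : Integrable (fun p : ℝ × Ω => kernelK κ ε p.1 *
      (w p.2 * Complex.exp (Complex.I * p.1 * S p.2))) (volume.prod P) := by
    have h1 : Integrable (fun p : ℝ × Ω => kernelK κ ε p.1 * w p.2) (volume.prod P) :=
      (integrable_kernelK hκ hε).mul_prod hw
    have h2 : Integrable (fun p : ℝ × Ω => kernelK κ ε p.1 * w p.2 *
        Complex.exp (Complex.I * p.1 * S p.2)) (volume.prod P) :=
      h1.mul_bdd (c := 1) (by fun_prop)
        (Eventually.of_forall fun p => (norm_exp_I_mul_mul p.1 (S p.2)).le)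
    simpa only [mul_assoc] using h2
  refine ⟨?_, ?_⟩
  · have := hprod.integral_prod_left
    simpa only [integral_const_mul] using this
  · simp only [← integral_const_mul]
    rw [integral_integral_swap hprod]
    refine integral_congr_ae (Eventually.of_forall fun ω => ?_)
    simp only
    rw [← integral_kernelK_mul_exp hκ hε, ← integral_const_mul]
    exact integral_congr_ae (Eventually.of_forall fun t => by simp only; ring)

/-- The damping factor is at most 1, so the undamped integrand dominates. -/
lemma tendsto_integral_mul_dampedPower {w : Ω → ℂ} {S : Ω → ℝ} (hw : AEStronglyMeasurable w P)
    (hS : Measurable S) {κ : ℂ} (hκ : 0 < κ.re)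
    (hi : Integrable (fun ω => w ω * ((|S ω| : ℝ) : ℂ) ^ κ) P) :
    Tendsto (fun ε : ℝ => ∫ ω, w ω * dampedPower κ ε (S ω) ∂P) (𝓝[>] 0)
      (𝓝 (∫ ω, w ω * ((|S ω| : ℝ) : ℂ) ^ κ ∂P)) := by
  refine tendsto_integral_filter_of_dominated_convergence
    (fun ω => ‖w ω * ((|S ω| : ℝ) : ℂ) ^ κ‖) (Eventually.of_forall fun ε => ?_) ?_ hi.norm
    (Eventually.of_forall fun ω => ?_)
  · exact hw.mul ((continuous_dampedPower hκ ε).measurable.comp hS).aestronglyMeasurable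
  · filter_upwards [self_mem_nhdsWithin] with ε hε
    refine Eventually.of_forall fun ω => ?_
    rw [dampedPower, ← mul_assoc, norm_mul _ (Complex.exp _)]
    refine mul_le_of_le_one_right (norm_nonneg _) ?_
    rw [Complex.norm_exp, Real.exp_le_one_iff]
    have : (0 : ℝ) ≤ ε * |S ω| := mul_nonneg (le_of_lt hε) (abs_nonneg _)
    simpa using this
  · have hc : Continuous fun ε : ℝ => w ω * dampedPower κ ε (S ω) := by
      unfold dampedPower
      fun_prop
    have := (hc.tendsto 0).mono_left (nhdsWithin_le_nhds (s := Set.Ioi 0))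
    simpa [dampedPower] using this

end FourierRepresentation

end

/-! ### Conclusion -/

theorem proposition1p2 (N : ℕ) (hN : 1 ≤ N) (s h : ℂ)
    (hs : -(1 / 2 : ℝ) < s.re) (hh : 0 < h.re) (hhs : h.re < s.re + 1 / 2) :
    Integrable (jointMomentIntegrand N s h) (unitaryHaar N) ∧
    (∀ ε : ℝ, 0 < ε →
      IntegrableOn
        (fun t : ℝ => kernelK (2 * h) ε t * Complex.exp (-((N : ℂ) * (t : ℂ))) * hankelJ N t s)
        (Set.Ioi 0)) ∧
    ∃ L : ℂ,
      Tendsto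
        (fun ε : ℝ => ∫ t in Set.Ioi (0 : ℝ),
          kernelK (2 * h) ε t * Complex.exp (-((N : ℂ) * (t : ℂ))) * hankelJ N t s)
        (𝓝[>] 0) (𝓝 L) ∧
      jointMoment N s h =
        (-1 : ℂ) ^ (N * (N - 1) / 2) * (2 : ℂ) ^ (1 - 2 * h) / Complex.Gamma (s + (N : ℂ)) ^ N
          * L := by
  have hκ : 0 < (2 * h).re := by simpa using hh
  have hs' : -(1 / 2) < s.re := by simpa using hs
  have hN' : (1 : ℝ) ≤ N := by exact_mod_cast hN
  have hΓ : Complex.Gamma (s + N) ^ N ≠ 0 := pow_ne_zero _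
    (Complex.Gamma_ne_zero_of_re_pos (by simp; linarith))
  have hi : Integrable (fun x : Fin N → ℝ =>
      cayleyWeight s x * ((|∑ j, x j| : ℝ) : ℂ) ^ (2 * h)) (cauchyPi N) :=
    integrable_cayleyWeight_mul_cpow hh hhs
  have hw := integrable_cayleyWeight (N := N) hs'
  have hS : Measurable fun x : Fin N → ℝ => ∑ j, x j := by fun_prop
  set φ : ℝ → ℂ := fun t => ∫ x : Fin N → ℝ, cayleyWeight s x *
    Complex.exp (Complex.I * t * ((∑ j, x j : ℝ) : ℂ)) ∂(cauchyPi N) with hφ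
  -- The constant with φ(t) = c e^{-Nt} 𝒥_N(t; s) for t > 0.
  set c : ℂ := N.factorial * ((-1) ^ (N * (N - 1) / 2) / Complex.Gamma (s + N) ^ N) with hc
  have hfac : (N.factorial : ℂ) ≠ 0 := Nat.cast_ne_zero.mpr N.factorial_ne_zero
  have hc0 : c ≠ 0 := mul_ne_zero hfac (div_ne_zero (pow_ne_zero _ (by norm_num)) hΓ)
  have hφpos : ∀ ε : ℝ, Set.EqOn
      (fun t : ℝ => kernelK (2 * h) ε t * Complex.exp (-((N : ℂ) * (t : ℂ))) * hankelJ N t s)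
      (fun t => c⁻¹ * (kernelK (2 * h) ε t * φ t)) (Set.Ioi 0) := fun ε t ht => by
    simp only [hφ]
    rw [integral_cayleyWeight_mul_exp_eq_hankelJ hN hs' ht, ← hc]
    field_simp
  have hpars : ∀ ε : ℝ, 0 < ε → Integrable (fun t => kernelK (2 * h) ε t * φ t) ∧
      ∫ t, kernelK (2 * h) ε t * φ t = ∫ x : Fin N → ℝ, cayleyWeight s x *
        dampedPower (2 * h) ε (∑ j, x j) ∂(cauchyPi N) := fun ε hε =>
    integral_mul_dampedPower hw hS hκ hε
  -- Kernel and φ are even, so the half-line integral is half of the Parseval integral. This is the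
  -- origin of the 1 in the exponent 1 - 2h.
  have hhalf : ∀ ε : ℝ, 0 < ε → ∫ t in Set.Ioi (0 : ℝ),
      kernelK (2 * h) ε t * Complex.exp (-((N : ℂ) * (t : ℂ))) * hankelJ N t s =
      (2 * c)⁻¹ * ∫ x : Fin N → ℝ, cayleyWeight s x *
        dampedPower (2 * h) ε (∑ j, x j) ∂(cauchyPi N) := fun ε hε => by
    have heven : (fun t => kernelK (2 * h) ε (-t) * φ (-t)) =
        fun t => kernelK (2 * h) ε t * φ t := by
      funext t
      rw [kernelK_neg hκ hε]
      congr 1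
      exact integral_cayleyWeight_mul_exp_neg s t
    have hK := (hpars ε hε).1.integrableOn (s := Set.Ioi (0 : ℝ))
    have h2 := (integral_eq_add_integral_Ioi hK (by rw [heven]; exact hK)).2
    rw [heven, (hpars ε hε).2] at h2
    rw [setIntegral_congr_fun measurableSet_Ioi (hφpos ε), integral_const_mul, h2]
    field_simp
    ring
  refine ⟨integrable_jointMomentIntegrand_of hi, fun ε hε => ?_, (2 * c)⁻¹ *
    ∫ x : Fin N → ℝ, cayleyWeight s x * ((|∑ j, x j| : ℝ) : ℂ) ^ (2 * h) ∂(cauchyPi N), ?_, ?_⟩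
  · exact (integrableOn_congr_fun (hφpos ε) measurableSet_Ioi).mpr
      ((hpars ε hε).1.integrableOn.const_mul _)
  · have ht := (tendsto_integral_mul_dampedPower hw.aestronglyMeasurable hS hκ hi).const_mul
      (2 * c)⁻¹
    refine ht.congr' ?_
    filter_upwards [self_mem_nhdsWithin] with ε hε
    exact (hhalf ε hε).symm
  · rw [jointMoment_eq_integral, sub_eq_add_neg, Complex.cpow_add _ _ two_ne_zero, Complex.cpow_one,
      hc]
    have h1 : ((-1 : ℂ)) ^ (N * (N - 1) / 2) ≠ 0 := pow_ne_zero _ (by norm_num)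
    field_simp
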